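/- Fix an integer $m_0\ge 1$. Let $L^2_r$ be the space of complex functions on $(0,\infty)$ that are square integrable for $r\,dr$, let $\Delta_m=\partial_r^2+r^{-1}\partial_r-r^{-2}m^2$ for $m\in\mathbb Z$, and let $e_{m_0,0}(r)=\sqrt{2/m_0!}\;r^{m_0}e^{-r^2/2}$. A radial profile $V$ carrying the angular index $m$ is in $H^2_r\cap L^{2,2}_r$ (respectively $H^1_r$) if $V(r)e^{im\theta}$ is in $H^2(\mathbb R^2)\cap L^{2,2}(\mathbb R^2)$ (respectively $H^1(\mathbb R^2)$), and it is given the norm of that function divided by $\sqrt{2\pi}$; here $\|u\|_{H^2\cap L^{2,2}}^2=\|u\|_{H^2}^2+\||x|^2u\|_{L^2}^2$. Let $(\psi(\cdot;a),\omega(a))$ be the primary branch of vortices of charge $m_0$: for small $a>0$, $\psi(\cdot;a)$ is real, lies in $H^2_r\cap L^{2,2}_r$ (index $m_0$) and solves $-\Delta_{m_0}\psi+r^2\psi+\psi^3=\omega(a)\psi$, with $\psi=a\,e_{m_0,0}+\mathcal O_{H^1_r}(a^3)$ and $\omega(a)=2(m_0+1)+a^2\|e_{m_0,0}\|_{L^4_r}^4+\mathcal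 O(a^4)$ as $a\to0^+$. For integers $m$ and real $\Omega$, let $$H_m(a,\Omega)=\begin{bmatrix}-\Delta_m+r^2-\omega(a)+2\psi^2&\psi^2\\ \psi^2&-\Delta_{m-2m_0}+r^2-\omega(a)+2\psi^2\end{bmatrix}-\Omega(m-m_0)\begin{bmatrix}1&0\\0&-1\end{bmatrix}$$ act in $L^2_r\times L^2_r$ on pairs $(V,W)$ in $H^2_r\cap L^{2,2}_r$, where $V$ has index $m$ and $W$ has index $m-2m_0$. Numbers of negative eigenvalues are counted with multiplicity. For $m>m_0$ and $n\in\{0,1,2,\dots\}$ put $\Omega_{m,n}(0)=\dfrac{2(m_0-|m-2m_0|)-4n}{m-m_0}$. The bifurcation point $\Omega_{m,n}(a)$, considered when $\Omega_{m,n}(0)\in(0,2)$, is a value $\Omega_{m,n}(a)=\Omega_{m,n}(0)+\mathcal O(a^2)$ such that $H_m(a,\Omega_{m,n}(a))$ has a nontrivial kernel for all small $a>0$. Proposition. Let $\Omega_*(a)$ be one of these bifurcation points, with limit $\Omega_*(0)\in(0,2)$. Let $(m_1,n_1),\dots,(m_k,n_k)$ be all the pairs with $m_j>m_0$ and $\Omega_{m_j,n_j}(0)=\Omega_*(0)$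 ($k$ is the multiplicity; the $m_j$ are distinct), and write $\Omega_j(a)=\Omega_{m_j,n_j}(a)$, so that $\Omega_*=\Omega_i$ for some $i$. There exist $a_0>0$, $C>0$ and $E>0$ such that for every $0<a<a_0$ the following hold. (1) For every integer $m>m_0$ with $m\notin\{m_1,\dots,m_k\}$ and every $\Omega$ with $|\Omega-\Omega_*(a)|<Ca^2$, the operator $H_m(a,\Omega)$ is invertible, with $$\|H_m(a,\Omega)^{-1}\|_{L^2_r\to H^2_r\cap L^{2,2}_r}\le E,$$ and its number of negative eigenvalues is finite and is the same for all these $\Omega$. (2) For every $m=m_j$, the number of negative eigenvalues of $H_{m_j}(a,\Omega)$ is reduced by one when $\Omega$ crosses $\Omega_j(a)$ upwards: there is an integer $N\ge0$ such that for $|\Omega-\Omega_*(a)|<Ca^2$ this number is $N+1$ if $\Omega<\Omega_j(a)$ and $N$ if $\Omega>\Omega_j(a)$, and $H_{m_j}(a,\Omega)$ is invertible for all these $\Omega\ne\Omega_j(a)$. Moreover the Krein quantity $\|V\|^2_{L^2_r}-\|W\|^2_{L^2_r}$ is negative for every nonzero $(V,W)$ in the kernel of $H_{m_j}(a,\Omega_j(a))$.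 In particular, if the $k$ bifurcation points coincide, $\Omega_j(a)=\Omega_*(a)$ for all $j$, then every one of these drops occurs as $\Omega$ crosses $\Omega_*(a)$. -/

import Mathlib

open MeasureTheory Set Filter Asymptotics
open scoped Topology

noncomputable section

namespace Vortex

/-- The measure `r dr` on the half-line `(0, ∞)`. -/
def radialMeasure : Measure ℝ :=
  (volume.restrict (Ioi 0)).withDensity (fun r => ENNReal.ofReal r)

/-- The Hilbert space `L²_r(ℝ⁺)` of complex-valued functions. -/
abbrev L2r : Type := Lp ℂ 2 radialMeasure

/-- The `L²_r` norm of a function (used only for functions with `MemLp u 2 radialMeasure`). -/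
def l2rNorm (u : ℝ → ℂ) : ℝ := (eLpNorm u 2 radialMeasure).toReal

/-- `v` is the weak derivative of `u` on `(0, ∞)`. -/
def HasWeakDeriv (u v : ℝ → ℂ) : Prop :=
  LocallyIntegrableOn u (Ioi 0) ∧ LocallyIntegrableOn v (Ioi 0) ∧
    ∀ φ : ℝ → ℝ, ContDiff ℝ (⊤ : ℕ∞) φ → HasCompactSupport φ → tsupport φ ⊆ Ioi 0 →
      ∫ r in Ioi (0 : ℝ), deriv φ r • u r = -∫ r in Ioi (0 : ℝ), φ r • v r

/-- Weak derivatives on `(0, ∞)` are unique almost everywhere. -/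
theorem HasWeakDeriv.ae_unique {u v w : ℝ → ℂ} (hv : HasWeakDeriv u v) (hw : HasWeakDeriv u w) :
    ∀ᵐ r ∂(volume : Measure ℝ), r ∈ Ioi (0 : ℝ) → v r = w r := by
  have hsub := isOpen_Ioi.ae_eq_zero_of_integral_contDiff_smul_eq_zero (hv.2.1.sub hw.2.1) ?_
  · filter_upwards [hsub] with r hr hr0
    exact sub_eq_zero.mp (hr hr0)
  intro φ h1 h2 h3
  have key : ∀ f : ℝ → ℂ, ∫ r, φ r • f r = ∫ r in Ioi (0 : ℝ), φ r • f r := by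
    intro f
    refine (setIntegral_eq_integral_of_forall_compl_eq_zero ?_).symm
    intro r hr
    have : φ r = 0 := image_eq_zero_of_notMem_tsupport (fun h => hr (h3 h))
    simp [this]
  have hint : ∀ f : ℝ → ℂ, LocallyIntegrableOn f (Ioi 0) → Integrable (fun r => φ r • f r) := by
    intro f hf
    refine (integrableOn_iff_integrable_of_support_subset (s := tsupport φ) ?_).mp
      ((hf.integrableOn_compact_subset h3 h2).continuousOn_smul h1.continuous.continuousOn h2)
    exact (Function.support_smul_subset_left φ f).trans (subset_tsupport φ)
  simp only [Pi.sub_apply, smul_sub]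
  rw [integral_sub (hint v hv.2.1) (hint w hw.2.1), sub_eq_zero, key, key]
  exact neg_injective ((hv.2.2 φ h1 h2 h3).symm.trans (hw.2.2 φ h1 h2 h3))

open Classical in
/-- The weak derivative on `(0, ∞)` (a representative of it; zero if there is none). -/
def weakDeriv (u : ℝ → ℂ) : ℝ → ℂ :=
  if h : ∃ v, HasWeakDeriv u v then h.choose else 0

/-- `u` has weak derivatives of first and second order on `(0, ∞)`. -/
def HasTwoWeakDerivs (u : ℝ → ℂ) : Prop :=
  ∃ u₁ u₂, HasWeakDeriv u u₁ ∧ HasWeakDeriv u₁ u₂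

/-- `r⁻¹ ∂_θ` of `V(r) e^{imθ}`, up to a factor of modulus one. -/
def angularGrad (m : ℤ) (V : ℝ → ℂ) : ℝ → ℂ := fun r => (m : ℂ) * V r / r

/-- The mixed component of the Hessian matrix of `V(r) e^{imθ}` in the polar frame,
up to a factor of modulus one. -/
def mixedHess (m : ℤ) (V : ℝ → ℂ) : ℝ → ℂ :=
  fun r => (m : ℂ) * (weakDeriv V r / r - V r / (r : ℂ) ^ 2)

/-- The angular component of the Hessian matrix of `V(r) e^{imθ}` in the polar frame. -/
def angularHess (m : ℤ) (V : ℝ → ℂ) : ℝ → ℂ :=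
  fun r => weakDeriv V r / r - (m : ℂ) ^ 2 * V r / (r : ℂ) ^ 2

/-- The weighted function `r² V`. -/
def sqWeight (V : ℝ → ℂ) : ℝ → ℂ := fun r => (r : ℂ) ^ 2 * V r

/-- The space `H²_r ∩ L^{2,2}_r` for the angular index `m`: the radial profiles `V` such that
`V(r) e^{imθ}` belongs to `H²(ℝ²) ∩ L^{2,2}(ℝ²)`. -/
structure MemH2 (m : ℤ) (V : ℝ → ℂ) : Prop where
  derivs : HasTwoWeakDerivs V
  memLp : MemLp V 2 radialMeasure
  memLp_deriv : MemLp (weakDeriv V) 2 radialMeasure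
  memLp_angularGrad : MemLp (angularGrad m V) 2 radialMeasure
  memLp_deriv2 : MemLp (weakDeriv (weakDeriv V)) 2 radialMeasure
  memLp_mixedHess : MemLp (mixedHess m V) 2 radialMeasure
  memLp_angularHess : MemLp (angularHess m V) 2 radialMeasure
  memLp_sqWeight : MemLp (sqWeight V) 2 radialMeasure

/-- The `H¹` norm for the angular index `m`: the norm of `V(r) e^{imθ}` in `H¹(ℝ²)`, divided
by `√(2π)`. -/
def h1Norm (m : ℤ) (V : ℝ → ℂ) : ℝ :=
  √(l2rNorm V ^ 2 + l2rNorm (weakDeriv V) ^ 2 + l2rNorm (angularGrad m V) ^ 2)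

/-- The square of the norm of `H²_r ∩ L^{2,2}_r` for the angular index `m`: the squared norm of
`V(r) e^{imθ}` in `H²(ℝ²) ∩ L^{2,2}(ℝ²)`, divided by `2π`. -/
def h2NormSq (m : ℤ) (V : ℝ → ℂ) : ℝ :=
  l2rNorm V ^ 2 + l2rNorm (weakDeriv V) ^ 2 + l2rNorm (angularGrad m V) ^ 2 +
    l2rNorm (weakDeriv (weakDeriv V)) ^ 2 + 2 * l2rNorm (mixedHess m V) ^ 2 +
    l2rNorm (angularHess m V) ^ 2 + l2rNorm (sqWeight V) ^ 2

/-- `Δ_m = ∂_r² + r⁻¹ ∂_r - r⁻² m²`. -/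
def radialLaplacian (m : ℤ) (V : ℝ → ℂ) : ℝ → ℂ :=
  fun r => weakDeriv (weakDeriv V) r + weakDeriv V r / r - (m : ℂ) ^ 2 * V r / (r : ℂ) ^ 2

/-- The normalized ground state `e_{m₀,0}` of `-Δ_{m₀} + r²`. -/
def groundState (m₀ : ℕ) (r : ℝ) : ℝ :=
  √2 / √(m₀.factorial : ℝ) * r ^ m₀ * Real.exp (-r ^ 2 / 2)

/-- `ψ(·; a)`, `ω(a)` is the primary branch of radially symmetric vortices of charge `m₀`:
a solution of `-Δ_{m₀} ψ + r² ψ + ψ³ - ω ψ = 0` for every small `a > 0`, with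
`ψ = a e_{m₀,0} + O_{H¹}(a³)` and `ω = 2(m₀+1) + a² ‖e_{m₀,0}‖⁴_{L⁴_r} + O(a⁴)` as `a → 0⁺`. -/
structure IsPrimaryBranch (m₀ : ℕ) (ψ : ℝ → ℝ → ℝ) (ω : ℝ → ℝ) : Prop where
  mem : ∀ᶠ a in 𝓝[>] (0 : ℝ), MemH2 m₀ (fun r => (ψ a r : ℂ))
  eqn : ∀ᶠ a in 𝓝[>] (0 : ℝ), ∀ᵐ r ∂radialMeasure,
    -radialLaplacian m₀ (fun s => (ψ a s : ℂ)) r + (r : ℂ) ^ 2 * ψ a r + (ψ a r : ℂ) ^ 3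
      - ω a * ψ a r = 0
  profile : (fun a => h1Norm m₀ (fun r => ((ψ a r - a * groundState m₀ r : ℝ) : ℂ)))
    =O[𝓝[>] 0] (fun a : ℝ => a ^ 3)
  frequency : (fun a => ω a - (2 * ((m₀ : ℝ) + 1)
    + a ^ 2 * ∫ r, groundState m₀ r ^ 4 ∂radialMeasure)) =O[𝓝[>] 0] (fun a : ℝ => a ^ 4)

/-- The matrix operator `K_m` with profile `ψ` and frequency `ω`, acting on `(V, W)`. -/
def blockK (m₀ : ℕ) (ψ : ℝ → ℝ) (ω : ℝ) (m : ℤ) (V W : ℝ → ℂ) : (ℝ → ℂ) × (ℝ → ℂ) :=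
  (fun r => -radialLaplacian m V r + (r : ℂ) ^ 2 * V r - ω * V r
      + 2 * (ψ r : ℂ) ^ 2 * V r + (ψ r : ℂ) ^ 2 * W r,
   fun r => (ψ r : ℂ) ^ 2 * V r + (-radialLaplacian (m - 2 * m₀) W r + (r : ℂ) ^ 2 * W r
      - ω * W r + 2 * (ψ r : ℂ) ^ 2 * W r))

/-- The block `H_m = K_m - Ω (m - m₀) R` with `R = diag(1, -1)`, acting on `(V, W)`. -/
def blockH (m₀ : ℕ) (ψ : ℝ → ℝ) (ω : ℝ) (m : ℤ) (Ω : ℝ) (V W : ℝ → ℂ) :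
    (ℝ → ℂ) × (ℝ → ℂ) :=
  (fun r => (blockK m₀ ψ ω m V W).1 r - Ω * ((m : ℂ) - m₀) * V r,
   fun r => (blockK m₀ ψ ω m V W).2 r + Ω * ((m : ℂ) - m₀) * W r)

/-- `p = (V, W)` is in the domain of `H_m` and `H_m p = q` in `L²_r × L²_r`. -/
def Maps (m₀ : ℕ) (ψ : ℝ → ℝ) (ω : ℝ) (m : ℤ) (Ω : ℝ) (p q : L2r × L2r) : Prop :=
  MemH2 m p.1 ∧ MemH2 (m - 2 * m₀) p.2 ∧
    (blockH m₀ ψ ω m Ω p.1 p.2).1 =ᵐ[radialMeasure] q.1 ∧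
    (blockH m₀ ψ ω m Ω p.1 p.2).2 =ᵐ[radialMeasure] q.2

/-- `H_m` is a bijection from its domain onto `L²_r × L²_r`. -/
def Invertible (m₀ : ℕ) (ψ : ℝ → ℝ) (ω : ℝ) (m : ℤ) (Ω : ℝ) : Prop :=
  ∀ q : L2r × L2r, ∃! p : L2r × L2r, Maps m₀ ψ ω m Ω p q

/-- The norm of `H_m⁻¹` from `L²_r` to `H²_r ∩ L^{2,2}_r` is at most `E`. -/
def InverseBoundedBy (m₀ : ℕ) (ψ : ℝ → ℝ) (ω : ℝ) (m : ℤ) (Ω E : ℝ) : Prop :=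
  ∀ p q : L2r × L2r, Maps m₀ ψ ω m Ω p q →
    √(h2NormSq m p.1 + h2NormSq (m - 2 * m₀) p.2) ≤ E * √(‖q.1‖ ^ 2 + ‖q.2‖ ^ 2)

/-- The number of negative eigenvalues of `H_m`, with multiplicity: the dimension of the span of
all eigenvectors for negative eigenvalues. -/
def negCount (m₀ : ℕ) (ψ : ℝ → ℝ) (ω : ℝ) (m : ℤ) (Ω : ℝ) : Cardinal :=
  Module.rank ℂ (Submodule.span ℂ
    {p : L2r × L2r | ∃ μ : ℝ, μ < 0 ∧ Maps m₀ ψ ω m Ω p ((μ : ℂ) • p)})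

/-- The Krein quantity `‖V‖² - ‖W‖²` of `p = (V, W)`. -/
def krein (p : L2r × L2r) : ℝ := ‖p.1‖ ^ 2 - ‖p.2‖ ^ 2

/-- The value `Ω_{m,n}(0)`. -/
def limitFreq (m₀ : ℕ) (m : ℤ) (n : ℕ) : ℝ :=
  2 * ((m₀ : ℝ) - |(m : ℝ) - 2 * m₀|) / ((m : ℝ) - m₀) - 4 * n / ((m : ℝ) - m₀)

/-- `Ω(a)` is the bifurcation point `Ω_{m,n}(a)` along the primary branch: for all small `a > 0`
zero is an eigenvalue of `H_m(a, Ω(a))`, and `Ω(a) = Ω_{m,n}(0) + O(a²)` as `a → 0⁺`. -/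
structure IsBifurcationPoint (m₀ : ℕ) (ψ : ℝ → ℝ → ℝ) (ω : ℝ → ℝ) (m : ℤ) (n : ℕ)
    (Ω : ℝ → ℝ) : Prop where
  kernel : ∀ᶠ a in 𝓝[>] (0 : ℝ), ∃ p : L2r × L2r, p ≠ 0 ∧ Maps m₀ (ψ a) (ω a) m (Ω a) p 0
  expansion : (fun a => Ω a - limitFreq m₀ m n) =O[𝓝[>] 0] (fun a : ℝ => a ^ 2)

end Vortex

end

/-! At `a = 0` the vortex vanishes and `H_m` is diagonal in the Laguerre–Gauss eigenbasis of the two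
oscillators `-Δ_m + r²` and `-Δ_{m-2m₀} + r²`. For `m > m₀` its entries are `(2 - Ω)(m - m₀) + 4n`
on the `V` side, positive when `Ω < 2`, and `(Ω - Ω_{m,n}(0))(m - m₀)` on the `W` side. Only
finitely many of the numbers `Ω_{m,n}(0)` are positive. Hence, for `Ω` near the limit `Ω_*(0)`, all
entries other than those vanishing at `Ω_*(0)` stay at distance at least a constant times `m - m₀`
from zero, uniformly in `m` (`exists_blockDiag_gap`).

For `a > 0` the block is this diagonal operator plus a bounded symmetric one made of `ψ²` and `ω(a)
- 2(m₀+1)`. Its norm is small: the frequency converges, and `ψ` is small in `L^∞` because a profile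
with nonzero angular index is bounded by the `L²` norm of its gradient
(`IsPrimaryBranch.eventually_abs_le`).

If no entry of the block is critical, the quadratic form is definite, with a gap, on the span of the
basis vectors with negative entries and on its orthogonal complement. This gives invertibility and
the number of negative eigenvalues (`IsSelfAdjointRel.invertible_and_rank`, `diagRel_gap`). The
inverse has `L²` norm `O(1/(m - m₀))`, which offsets the growth of `Ω(m - m₀)` in the elliptic
estimate, so the bound into `H² ∩ L^{2,2}` is uniform in `m` (`block_gap`).

If `m = m_j`, exactly one entry is critical, and it lies on the `W` side. A kernel vector at
`Ω_j(a)` is concentrated on the corresponding basis vector, so its Krein quantity is negative.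
Passing from `Ω_j(a)` to `Ω` adds `(Ω_j(a) - Ω)(m - m₀) diag(1, -1)` to the operator; on the kernel
vector the form becomes negative for `Ω < Ω_j(a)` and positive for `Ω > Ω_j(a)`. Joining this vector
to the negative or to the positive subspace makes the count drop by one (`diagRel_crossing`,
`block_crossing`).

The analytic part identifies the concrete domain with the one given by coefficients
(`memH2_and_oscillator_iff`, `maps_iff_diagRel`). It rests on Green's identity against Gaussian
profiles, on completeness of the eigenfunctions through a moment problem, and on an energy estimate
which makes eigenfunction expansions converge together with all their derivatives. -/

noncomputable section

namespace Vortex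

/-! ### Self-adjoint relations: inverses and variational count of negative eigenvalues. -/

section AbstractSpectral

variable {K : Type*} [NormedAddCommGroup K] [InnerProductSpace ℂ K] [CompleteSpace K]

/-- The span of the eigenvectors for negative eigenvalues of a bounded operator. -/
def negEigenspan (R : K →L[ℂ] K) : Submodule ℂ K :=
  Submodule.span ℂ {q | ∃ ν : ℝ, ν < 0 ∧ R q = (ν : ℂ) • q}

/-- With `G = S²` and `S` self-adjoint, the form of `G` is `‖S x‖²`. -/
theorem eq_zero_of_isPositive_of_inner_eq_zero {G : K →L[ℂ] K} (hG : 0 ≤ G) {x : K}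
    (hx : (inner ℂ (G x) x : ℂ).re = 0) : G x = 0 := by
  obtain ⟨S, hS, hSG⟩ : ∃ S : K →L[ℂ] K, IsSelfAdjoint S ∧ S * S = G :=
    ⟨CFC.sqrt G, (CFC.sqrt_nonneg G).isSelfAdjoint, CFC.sqrt_mul_sqrt_self G hG⟩
  have h2 : S x = 0 := by
    have : (inner ℂ (G x) x : ℂ) = inner ℂ (S x) (S x) := by
      rw [← hSG]; exact hS.isSymmetric (S x) x
    rw [this, inner_self_eq_norm_sq_to_K] at hx
    have h3 : ‖S x‖ ^ 2 = 0 := by exact_mod_cast hx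
    simpa using h3
  rw [← hSG]
  change S (S x) = 0
  rw [h2, map_zero]

/-- Variational count of the negative eigenvalues of a bounded self-adjoint operator. -/
theorem rank_negEigenspan (R : K →L[ℂ] K) (hR : IsSelfAdjoint R) {U : Submodule ℂ K}
    [FiniteDimensional ℂ U] (hU : ∀ q ∈ U, q ≠ 0 → (inner ℂ (R q) q : ℂ).re < 0)
    {E : Type*} [AddCommGroup E] [Module ℂ E] [FiniteDimensional ℂ E] (π : K →ₗ[ℂ] E)
    (hπ : ∀ q, π q = 0 → 0 ≤ (inner ℂ (R q) q : ℂ).re)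
    (hdim : Module.finrank ℂ E = Module.finrank ℂ U) :
    Module.rank ℂ (negEigenspan R) = Module.finrank ℂ U := by
  set G : K →L[ℂ] K := R⁻ with hGdef
  set F : K →L[ℂ] K := R⁺ with hFdef
  have hFG : F - G = R := CFC.posPart_sub_negPart R hR
  have hF0 : 0 ≤ F := CFC.posPart_nonneg R
  have hG0 : 0 ≤ G := CFC.negPart_nonneg R
  have hFmG : F * G = 0 := CFC.posPart_mul_negPart R
  have hGmF : G * F = 0 := CFC.negPart_mul_posPart R
  have hFG' (x : K) : F (G x) = 0 := DFunLike.congr_fun hFmG x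
  have hGF' (x : K) : G (F x) = 0 := DFunLike.congr_fun hGmF x
  have hRx (x : K) : R x = F x - G x := by rw [← hFG]; rfl
  have hFpos (x : K) : 0 ≤ (inner ℂ (F x) x : ℂ).re :=
    ((ContinuousLinearMap.nonneg_iff_isPositive F).1 hF0).re_inner_nonneg_left x
  have hGpos (x : K) : 0 ≤ (inner ℂ (G x) x : ℂ).re :=
    ((ContinuousLinearMap.nonneg_iff_isPositive G).1 hG0).re_inner_nonneg_left x
  have hGsymm (x y : K) : (inner ℂ (G x) y : ℂ) = inner ℂ x (G y) :=
    hG0.isSelfAdjoint.isSymmetric x y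
  -- The range of the negative part is the negative spectral subspace. Its dimension is squeezed:
  -- `π` is injective on it, and the negative part is injective on `U`.
  set W : Submodule ℂ K := LinearMap.range (G : K →ₗ[ℂ] K) with hW
  have hWneg : ∀ q ∈ W, q ≠ 0 → (inner ℂ (R q) q : ℂ).re < 0 := by
    rintro _ ⟨x, rfl⟩ hne
    have h1 : R (G x) = - G (G x) := by rw [hRx, hFG', zero_sub]
    have h2 : (inner ℂ (R (G x)) (G x) : ℂ).re = -(inner ℂ (G (G x)) (G x) : ℂ).re := by
      rw [h1, inner_neg_left, Complex.neg_re]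
    change (inner ℂ (R (G x)) (G x) : ℂ).re < 0
    rw [h2, neg_lt_zero]
    refine lt_of_le_of_ne (hGpos _) fun h => hne ?_
    have h3 : G (G x) = 0 := eq_zero_of_isPositive_of_inner_eq_zero hG0 h.symm
    have h4 : (inner ℂ (G x) (G x) : ℂ) = 0 := by rw [hGsymm, h3, inner_zero_right]
    exact inner_self_eq_zero.1 h4
  have hinj : Function.Injective (π.domRestrict W) := by
    rw [← LinearMap.ker_eq_bot, LinearMap.ker_eq_bot']
    rintro ⟨q, hq⟩ h
    by_contra hne
    have h1 := hWneg q hq (fun h0 => hne (Subtype.ext h0))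
    exact absurd (hπ q h) (not_le.2 h1)
  have : FiniteDimensional ℂ W := FiniteDimensional.of_injective _ hinj
  have hle : Module.finrank ℂ W ≤ Module.finrank ℂ U :=
    hdim ▸ LinearMap.finrank_le_finrank_of_injective hinj
  have hge : Module.finrank ℂ U ≤ Module.finrank ℂ W := by
    let j : U →ₗ[ℂ] W := ((G : K →ₗ[ℂ] K).rangeRestrict).comp U.subtype
    refine LinearMap.finrank_le_finrank_of_injective (f := j) ?_
    rw [← LinearMap.ker_eq_bot, LinearMap.ker_eq_bot']
    rintro ⟨q, hq⟩ h
    by_contra hne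
    have h1 := hU q hq (fun h0 => hne (Subtype.ext h0))
    have h2 : G q = 0 := congrArg Subtype.val h
    rw [hRx, h2, sub_zero] at h1
    exact absurd (hFpos q) (not_le.2 h1)
  have hWR : ∀ q ∈ W, R q ∈ W := by
    rintro _ ⟨x, rfl⟩
    refine ⟨-(G x), ?_⟩
    change G (-(G x)) = R (G x)
    rw [hRx, hFG', map_neg, zero_sub]
  have hspan : negEigenspan R = W := by
    apply le_antisymm
    · refine Submodule.span_le.2 ?_
      rintro q ⟨ν, hν, hq⟩
      have hFq : F q = 0 := by
        have h1 : F (R q) = F (F q) := by rw [hRx, map_sub, hFG', sub_zero]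
        have h2 : (ν : ℂ) • F q = F (F q) := by rw [← h1, hq, map_smul]
        have h3 : (inner ℂ (F q) (F q) : ℂ) = (ν : ℂ) * inner ℂ (F q) q := by
          have : (inner ℂ (F q) (F q) : ℂ) = inner ℂ (F (F q)) q :=
            (hF0.isSelfAdjoint.isSymmetric (F q) q).symm
          rw [this, ← h2, inner_smul_left, Complex.conj_ofReal]
        have h4 : ‖F q‖ ^ 2 = ν * (inner ℂ (F q) q : ℂ).re := by
          have := congrArg Complex.re h3
          rw [inner_self_eq_norm_sq_to_K, Complex.re_ofReal_mul] at this
          rw [← this]; norm_cast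
        have h5 : ‖F q‖ ^ 2 ≤ 0 := by
          rw [h4]; exact mul_nonpos_of_nonpos_of_nonneg hν.le (hFpos q)
        have : ‖F q‖ = 0 := by nlinarith [norm_nonneg (F q)]
        simpa using this
      refine ⟨-(ν : ℂ)⁻¹ • q, ?_⟩
      change G (-(ν : ℂ)⁻¹ • q) = q
      have h6 : G q = -((ν : ℂ) • q) := by rw [← hq, hRx, hFq, zero_sub, neg_neg]
      have hν' : (ν : ℂ) ≠ 0 := by exact_mod_cast hν.ne
      rw [map_smul, h6, smul_neg, neg_smul, neg_neg, smul_smul, inv_mul_cancel₀ hν', one_smul]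
    -- The range is now finite-dimensional and invariant, so it has a basis of eigenvectors of `R`;
    -- their eigenvalues are negative because the form is.
    · have hsymm : ((R : K →ₗ[ℂ] K).restrict hWR).IsSymmetric := fun x y => hR.isSymmetric x y
      let b := hsymm.eigenvectorBasis rfl
      intro q hq
      have hrep := b.sum_repr ⟨q, hq⟩
      have h7 : q = ∑ i, b.repr ⟨q, hq⟩ i • (b i : K) := by
        have := congrArg Subtype.val hrep
        simpa using this.symm
      rw [h7]
      refine Submodule.sum_mem _ fun i _ => Submodule.smul_mem _ _ (Submodule.subset_span ?_)
      have h8 : R (b i) = ((hsymm.eigenvalues rfl i : ℝ) : ℂ) • (b i : K) :=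
        congrArg Subtype.val (hsymm.apply_eigenvectorBasis rfl i)
      refine ⟨hsymm.eigenvalues rfl i, ?_, h8⟩
      have h9 := hWneg (b i) (b i).2 (fun h => b.toBasis.ne_zero i (by
        rw [OrthonormalBasis.coe_toBasis]; exact Subtype.ext h))
      rw [h8, inner_smul_left, Complex.conj_ofReal, inner_self_eq_norm_sq_to_K] at h9
      have h10 : ‖(b i : K)‖ = 1 := b.orthonormal.1 i
      rw [h10] at h9
      simpa using h9
  rw [hspan, ← Module.finrank_eq_rank, le_antisymm hle hge]

/-- A linear relation that is the graph of a (densely defined) self-adjoint operator. -/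
structure IsSelfAdjointRel (G : Submodule ℂ (K × K)) : Prop where
  symm : ∀ x ∈ G, ∀ y ∈ G, (inner ℂ x.2 y.1 : ℂ) = inner ℂ x.1 y.2
  maximal : ∀ p q : K, (∀ y ∈ G, (inner ℂ q y.1 : ℂ) = inner ℂ p y.2) → (p, q) ∈ G
  dense : ∀ q : K, (∀ y ∈ G, (inner ℂ q y.1 : ℂ) = 0) → q = 0

-- The graph coincides with its adjoint, which is an intersection of closed conditions.
omit [CompleteSpace K] in
theorem IsSelfAdjointRel.isClosed {G : Submodule ℂ (K × K)} (hG : IsSelfAdjointRel G) :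
    IsClosed (G : Set (K × K)) := by
  have : (G : Set (K × K)) = ⋂ y ∈ G, {x : K × K | (inner ℂ x.2 y.1 : ℂ) = inner ℂ x.1 y.2} := by
    ext x
    simp only [mem_iInter, SetLike.mem_coe, mem_ofPred_eq]
    exact ⟨fun hx y hy => hG.symm x hx y hy, fun h => hG.maximal x.1 x.2 h⟩
  rw [this]
  refine isClosed_biInter fun y _ => isClosed_eq ?_ ?_ <;> fun_prop

/-- A self-adjoint relation that is bounded below in norm has a bounded self-adjoint inverse. -/
theorem IsSelfAdjointRel.exists_inverse {G : Submodule ℂ (K × K)} (hG : IsSelfAdjointRel G)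
    {C : ℝ} (hC : ∀ x ∈ G, ‖x.1‖ ≤ C * ‖x.2‖) :
    ∃ R : K →L[ℂ] K, IsSelfAdjoint R ∧ ∀ p q, (p, q) ∈ G ↔ R q = p := by
  have huniq : ∀ p p' q, (p, q) ∈ G → (p', q) ∈ G → p = p' := by
    intro p p' q h h'
    have h1 := hC _ (G.sub_mem h h')
    simp only [Prod.mk_sub_mk, sub_self, norm_zero, mul_zero] at h1
    exact sub_eq_zero.1 (norm_le_zero_iff.1 h1)
  -- The range is closed by the lower bound. A vector orthogonal to it lies in the kernel by
  -- maximality, hence vanishes.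
  set Rg : Submodule ℂ K := G.map (LinearMap.snd ℂ K K) with hRg
  have hclosed : IsClosed (Rg : Set K) := by
    refine IsSeqClosed.isClosed fun u q hu hq => ?_
    choose x hxG hxu using hu
    have hxu' : ∀ n, (x n).2 = u n := hxu
    have hcau : CauchySeq fun n => (x n).1 := by
      have hu' := hq.cauchySeq
      rw [Metric.cauchySeq_iff'] at hu' ⊢
      intro ε hε
      obtain ⟨N, hN⟩ := hu' (ε / (|C| + 1)) (by positivity)
      refine ⟨N, fun n hn => ?_⟩
      have h1 := hC _ (G.sub_mem (hxG n) (hxG N))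
      have h2 := hN n hn
      rw [dist_eq_norm] at h2 ⊢
      simp only [Prod.fst_sub, Prod.snd_sub, hxu'] at h1
      rw [lt_div_iff₀ (by positivity)] at h2
      calc ‖(x n).1 - (x N).1‖ ≤ C * ‖u n - u N‖ := h1
        _ ≤ (|C| + 1) * ‖u n - u N‖ := by
            gcongr; exact (le_abs_self C).trans (by linarith)
        _ < ε := by linarith
    obtain ⟨p, hp⟩ := cauchySeq_tendsto_of_complete hcau
    refine ⟨(p, q), ?_, rfl⟩
    refine hG.isClosed.mem_of_tendsto (hp.prodMk_nhds hq) (Eventually.of_forall fun n => ?_)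
    rw [← hxu' n]
    exact hxG n
  have htop : Rg = ⊤ := by
    have : CompleteSpace Rg := hclosed.completeSpace_coe
    refine Submodule.orthogonal_eq_bot_iff.1 ?_
    rw [Submodule.eq_bot_iff]
    intro p hp
    have h0 : (p, (0 : K)) ∈ G := by
      refine hG.maximal p 0 fun y hy => ?_
      rw [inner_zero_left, eq_comm, inner_eq_zero_symm]
      exact hp y.2 ⟨y, hy, rfl⟩
    exact huniq p 0 0 h0 G.zero_mem
  have hex : ∀ q, ∃ p, (p, q) ∈ G := by
    intro q
    have : q ∈ Rg := htop ▸ Submodule.mem_top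
    obtain ⟨x, hx, rfl⟩ := this
    exact ⟨x.1, hx⟩
  choose f hf using hex
  let f' : K →ₗ[ℂ] K :=
    { toFun := f
      map_add' := fun q q' => huniq _ _ _ (hf _) (G.add_mem (hf q) (hf q'))
      map_smul' := fun c q => huniq _ _ _ (hf _) (G.smul_mem c (hf q)) }
  let R : K →L[ℂ] K := f'.mkContinuous C fun q => hC _ (hf q)
  refine ⟨R, ?_, fun p q => ⟨fun h => huniq _ _ _ (hf q) h, ?_⟩⟩
  · rw [ContinuousLinearMap.isSelfAdjoint_iff_isSymmetric]
    intro q q'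
    exact (hG.symm _ (hf q) _ (hf q')).symm
  · rintro rfl
    exact hf q

/-- A self-adjoint operator with quadratic form at most `-c` on a finite-dimensional subspace of
its domain and at least `c` on a complement is invertible, and its number of negative
eigenvalues is the dimension of the former subspace. -/
theorem IsSelfAdjointRel.invertible_and_rank {G : Submodule ℂ (K × K)} (hG : IsSelfAdjointRel G)
    {U V : Submodule ℂ K} (hUV : IsCompl U V) [FiniteDimensional ℂ U] {c : ℝ} (hc : 0 < c)
    (hdom : ∀ u ∈ U, ∃ q, (u, q) ∈ G)
    (hneg : ∀ x ∈ G, x.1 ∈ U → (inner ℂ x.2 x.1 : ℂ).re ≤ -c * ‖x.1‖ ^ 2)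
    (hpos : ∀ x ∈ G, x.1 ∈ V → c * ‖x.1‖ ^ 2 ≤ (inner ℂ x.2 x.1 : ℂ).re) :
    (∀ q, ∃! p, (p, q) ∈ G) ∧ (∀ x ∈ G, ‖x.1‖ ≤ 2 / c * ‖x.2‖) ∧
      Module.rank ℂ (Submodule.span ℂ {p : K | ∃ μ : ℝ, μ < 0 ∧ (p, (μ : ℂ) • p) ∈ G}) =
        Module.finrank ℂ U := by
  have hbound : ∀ x ∈ G, ‖x.1‖ ≤ 2 / c * ‖x.2‖ := by
    rintro ⟨p, q⟩ hx
    obtain ⟨u, hu, v, hv, rfl⟩ : ∃ u ∈ U, ∃ v ∈ V, u + v = p :=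
      Submodule.mem_sup.1 (by rw [hUV.sup_eq_top]; trivial)
    obtain ⟨qu, hqu⟩ := hdom u hu
    have hqv : (v, q - qu) ∈ G := by
      have := G.sub_mem hx hqu
      simpa using this
    have h1 := hneg _ hqu hu
    have h2 := hpos _ hqv hv
    have h3 := hG.symm _ hqu _ hqv
    simp only at h1 h2 h3
    -- Testing against `v - u` instead of `u + v` makes the cross terms cancel by symmetry and gives
    -- both definite forms the same sign.
    have key : (inner ℂ q (v - u) : ℂ).re =
        (inner ℂ (q - qu) v : ℂ).re - (inner ℂ qu u : ℂ).re := by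
      have e1 : (inner ℂ (q - qu) u : ℂ).re = (inner ℂ qu v : ℂ).re := by
        rw [h3, ← inner_conj_symm, Complex.conj_re]
      have e2 : (inner ℂ q (v - u) : ℂ) = inner ℂ (q - qu) v + inner ℂ qu v
          - inner ℂ (q - qu) u - inner ℂ qu u := by
        simp only [inner_sub_left, inner_sub_right]; ring
      rw [e2]
      simp only [Complex.sub_re, Complex.add_re]
      linarith
    have h4 : (inner ℂ q (v - u) : ℂ).re ≤ ‖q‖ * ‖v - u‖ :=
      (Complex.re_le_norm _).trans (norm_inner_le_norm _ _)
    have h5 : c * (‖u‖ ^ 2 + ‖v‖ ^ 2) ≤ ‖q‖ * ‖v - u‖ := by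
      rw [key] at h4; linarith
    have hpar := parallelogram_law_with_norm ℂ u v
    rw [norm_sub_rev u v] at hpar
    have hs := norm_nonneg (u + v)
    have hd := norm_nonneg (v - u)
    have hq := norm_nonneg q
    change ‖u + v‖ ≤ 2 / c * ‖q‖
    rw [div_mul_eq_mul_div, le_div_iff₀ hc]
    by_contra hlt
    push Not at hlt
    -- The parallelogram law replaces Pythagoras, since `U` and `V` need not be orthogonal.
    have h6 : c / 2 * (‖u + v‖ ^ 2 + ‖v - u‖ ^ 2) ≤ ‖q‖ * ‖v - u‖ := by nlinarith
    have h7 : 0 < ‖u + v‖ := by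
      rcases hs.eq_or_lt with h | h
      · rw [← h] at hlt; nlinarith
      · exact h
    nlinarith [sq_nonneg (‖u + v‖ - ‖v - u‖), mul_pos hc h7,
      mul_nonneg hc.le (sq_nonneg (‖u + v‖ - ‖v - u‖)), mul_nonneg hd (sub_nonneg.2 hlt.le),
      mul_pos (mul_pos hc h7) h7]
  obtain ⟨R, hR, hRG⟩ := hG.exists_inverse hbound
  refine ⟨fun q => ⟨R q, (hRG _ _).2 rfl, fun p hp => ((hRG _ _).1 hp).symm⟩, hbound, ?_⟩
  have hRinj : ∀ q, R q = 0 → q = 0 := by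
    intro q hq
    refine hG.dense q fun y hy => ?_
    have := hG.symm _ ((hRG 0 q).2 hq) _ hy
    simpa using this
  have hset : {p : K | ∃ μ : ℝ, μ < 0 ∧ (p, (μ : ℂ) • p) ∈ G} =
      {q | ∃ ν : ℝ, ν < 0 ∧ R q = (ν : ℂ) • q} := by
    ext p
    constructor
    · rintro ⟨μ, hμ, h⟩
      have hμ' : (μ : ℂ) ≠ 0 := by exact_mod_cast hμ.ne
      refine ⟨μ⁻¹, inv_lt_zero.2 hμ, ?_⟩
      have h1 := (hRG _ _).1 h
      rw [map_smul] at h1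
      rw [Complex.ofReal_inv]
      conv_rhs => rw [← h1]
      rw [smul_smul, inv_mul_cancel₀ hμ', one_smul]
    · rintro ⟨ν, hν, h⟩
      have hν' : (ν : ℂ) ≠ 0 := by exact_mod_cast hν.ne
      refine ⟨ν⁻¹, inv_lt_zero.2 hν, (hRG _ _).2 ?_⟩
      rw [map_smul, h, smul_smul, Complex.ofReal_inv, inv_mul_cancel₀ hν', one_smul]
  rw [hset]
  -- This is the operator itself restricted to `U`. The form of the inverse at the image of `p` is
  -- the form of the operator at `p`, so the image of `U` is a negative subspace for `R`.
  let e : U →ₗ[ℂ] K :=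
    { toFun := fun u => (hdom u u.2).choose
      map_add' := fun u v => by
        have h1 := (hRG _ _).1 (hdom u u.2).choose_spec
        have h2 := (hRG _ _).1 (hdom v v.2).choose_spec
        have h3 := (hRG _ _).1 (hdom (u + v : U) (u + v).2).choose_spec
        refine sub_eq_zero.1 (hRinj _ ?_)
        rw [map_sub, map_add, h1, h2, h3]; simp
      map_smul' := fun t u => by
        have h1 := (hRG _ _).1 (hdom u u.2).choose_spec
        have h3 := (hRG _ _).1 (hdom (t • u : U) (t • u).2).choose_spec
        refine sub_eq_zero.1 (hRinj _ ?_)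
        rw [map_sub, RingHom.id_apply, map_smul, h1, h3]; simp }
  have heR (u : U) : R (e u) = u := (hRG _ _).1 (hdom u u.2).choose_spec
  have hek : Function.Injective e := fun u v h => by
    have := congrArg R h
    rw [heR, heR] at this
    exact Subtype.ext this
  have hfr : Module.finrank ℂ (LinearMap.range e) = Module.finrank ℂ U :=
    LinearMap.finrank_range_of_inj hek
  rw [← hfr]
  -- Composing `R` with the projection onto `U` along `V` yields a map to a space of the right
  -- dimension, on whose kernel `R q` lies in `V` and the form is nonnegative.
  refine rank_negEigenspan R hR (U := LinearMap.range e) ?_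
    (π := (U.projectionOnto V hUV).comp (R : K →ₗ[ℂ] K)) ?_ hfr.symm
  · rintro _ ⟨u, rfl⟩ hne
    have h1 := hneg (u, e u) ((hRG _ _).2 (heR u)) u.2
    rw [heR]
    have h2 : (inner ℂ (u : K) (e u) : ℂ).re = (inner ℂ (e u) (u : K) : ℂ).re := by
      rw [← inner_conj_symm, Complex.conj_re]
    rw [h2]
    have h3 : 0 < ‖(u : K)‖ := by
      rw [norm_pos_iff]
      intro h0
      apply hne
      rw [show u = 0 from Subtype.ext h0, map_zero]
    simp only at h1
    nlinarith [mul_pos hc (pow_pos h3 2)]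
  · intro q hq
    have hV : R q ∈ V := by
      have : R q ∈ LinearMap.ker (U.projectionOnto V hUV) := hq
      rwa [Submodule.ker_projectionOnto] at this
    have h1 := hpos (R q, q) ((hRG _ _).2 rfl) hV
    have h2 : (inner ℂ (R q) q : ℂ).re = (inner ℂ q (R q) : ℂ).re := by
      rw [← inner_conj_symm, Complex.conj_re]
    rw [h2]
    exact le_trans (by positivity) h1

end AbstractSpectral

/-! ### Bounded symmetric perturbations of diagonal operators. -/

section Diagonal

theorem hasSum_of_forall_eq {α β : Type*} [AddCommMonoid α] [TopologicalSpace α] {f g : β → α}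
    {a : α} (h : HasSum f a) (hfg : ∀ i, g i = f i) : HasSum g a := by
  rwa [funext hfg]

variable {K : Type*} [NormedAddCommGroup K] [InnerProductSpace ℂ K] {ι : Type*}

/-- The graph of the sum of the diagonal operator with entries `d` in the basis `b` and of the
bounded operator `B`. -/
def diagRel (b : HilbertBasis ι ℂ K) (d : ι → ℝ) (B : K →L[ℂ] K) : Submodule ℂ (K × K) where
  carrier := {x | ∀ i, (inner ℂ (b i) x.2 : ℂ) = d i * inner ℂ (b i) x.1 + inner ℂ (b i) (B x.1)}
  add_mem' := by
    intro x y hx hy i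
    simp only [Prod.fst_add, Prod.snd_add, inner_add_right, map_add, hx i, hy i]
    ring
  zero_mem' := by intro i; simp
  smul_mem' := by
    intro t x hx i
    simp only [Prod.smul_fst, Prod.smul_snd, inner_smul_right, map_smul, hx i]
    ring

variable {b : HilbertBasis ι ℂ K} {d : ι → ℝ} {B : K →L[ℂ] K}

theorem mem_diagRel {x : K × K} : x ∈ diagRel b d B ↔
    ∀ i, (inner ℂ (b i) x.2 : ℂ) = d i * inner ℂ (b i) x.1 + inner ℂ (b i) (B x.1) := Iff.rfl

theorem HilbertBasis.eq_zero_of_forall_inner {x : K} (b : HilbertBasis ι ℂ K)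
    (h : ∀ i, (inner ℂ (b i) x : ℂ) = 0) : x = 0 := by
  have h1 := b.hasSum_inner_mul_inner x x
  simp only [h, mul_zero] at h1
  exact inner_self_eq_zero.1 (h1.unique hasSum_zero)

theorem HilbertBasis.inner_self_or_zero (b : HilbertBasis ι ℂ K) [DecidableEq ι] (i j : ι) :
    (inner ℂ (b i) (b j) : ℂ) = if i = j then 1 else 0 :=
  orthonormal_iff_ite.1 b.orthonormal i j

theorem HilbertBasis.hasSum_norm_sq (b : HilbertBasis ι ℂ K) (x : K) :
    HasSum (fun i => ‖(inner ℂ (b i) x : ℂ)‖ ^ 2) (‖x‖ ^ 2) := by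
  have h := Complex.reCLM.hasSum (b.hasSum_inner_mul_inner x x)
  have h1 : Complex.reCLM (inner ℂ x x : ℂ) = ‖x‖ ^ 2 := by
    rw [inner_self_eq_norm_sq_to_K]; norm_cast
  rw [h1] at h
  refine hasSum_of_forall_eq h fun i => ?_
  rw [← inner_conj_symm, Complex.mul_conj]
  simp only [Complex.reCLM_apply, Complex.ofReal_re, RCLike.norm_conj, Complex.normSq_eq_norm_sq]

theorem basis_mem_diagRel (i : ι) : (b i, (d i : ℂ) • b i + B (b i)) ∈ diagRel b d B := by
  classical
  intro j
  rw [inner_add_right, inner_smul_right, HilbertBasis.inner_self_or_zero]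
  split_ifs with h
  · rw [h]
  · simp

theorem hasSum_diagRel_inner {x : K × K} (hx : x ∈ diagRel b d B) (y : K) :
    HasSum (fun i => (d i : ℂ) * (inner ℂ x.1 (b i) * inner ℂ (b i) y))
      (inner ℂ (x.2 - B x.1) y : ℂ) := by
  have h := b.hasSum_inner_mul_inner (x.2 - B x.1) y
  refine hasSum_of_forall_eq h fun i => ?_
  have h1 : (inner ℂ (b i) (x.2 - B x.1) : ℂ) = d i * inner ℂ (b i) x.1 := by
    rw [inner_sub_right, hx i]; ring
  rw [← inner_conj_symm (x.2 - B x.1), h1, map_mul, Complex.conj_ofReal, inner_conj_symm]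
  ring

/-- Symmetry is Parseval's identity with real entries. Maximality only needs test vectors from the
basis: they recover each coefficient identity, and membership asks for nothing else. -/
theorem isSelfAdjointRel_diagRel (hB : ∀ x y, (inner ℂ (B x) y : ℂ) = inner ℂ x (B y)) :
    IsSelfAdjointRel (diagRel b d B) where
  symm x hx y hy := by
    have h1 := hasSum_diagRel_inner hx y.1
    have h2 := (hasSum_diagRel_inner hy x.1).map (starRingEnd ℂ) Complex.continuous_conj
    have h3 : (inner ℂ (x.2 - B x.1) y.1 : ℂ) = inner ℂ x.1 (y.2 - B y.1) := by
      rw [← inner_conj_symm x.1]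
      refine h1.unique ?_
      refine hasSum_of_forall_eq h2 fun i => ?_
      simp only [Function.comp_apply, map_mul, Complex.conj_ofReal, inner_conj_symm]
      ring
    rw [inner_sub_left, inner_sub_right, hB] at h3
    exact sub_left_injective h3
  maximal p q h i := by
    have h1 := h _ (basis_mem_diagRel (b := b) (d := d) (B := B) i)
    have h2 := congrArg (starRingEnd ℂ) h1
    simp only [inner_conj_symm, inner_add_left, inner_smul_left, Complex.conj_ofReal, hB] at h2
    exact h2
  dense q h := by
    refine HilbertBasis.eq_zero_of_forall_inner b fun i => ?_
    rw [inner_eq_zero_symm]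
    exact h _ (basis_mem_diagRel (d := d) (B := B) i)

theorem abs_re_inner_clm_le {ε : ℝ} (hBε : ∀ x, ‖B x‖ ≤ ε * ‖x‖) (x : K) :
    |(inner ℂ (B x) x : ℂ).re| ≤ ε * ‖x‖ ^ 2 := by
  calc |(inner ℂ (B x) x : ℂ).re| ≤ ‖(inner ℂ (B x) x : ℂ)‖ := Complex.abs_re_le_norm _
    _ ≤ ‖B x‖ * ‖x‖ := norm_inner_le_norm _ _
    _ ≤ ε * ‖x‖ * ‖x‖ := by gcongr; exact hBε x
    _ = _ := by ring

theorem hasSum_diagRel_re {x : K × K} (hx : x ∈ diagRel b d B) :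
    HasSum (fun i => d i * ‖(inner ℂ (b i) x.1 : ℂ)‖ ^ 2)
      ((inner ℂ x.2 x.1 : ℂ).re - (inner ℂ (B x.1) x.1 : ℂ).re) := by
  have h := Complex.reCLM.hasSum (hasSum_diagRel_inner hx x.1)
  have h1 : Complex.reCLM (inner ℂ (x.2 - B x.1) x.1 : ℂ) =
      (inner ℂ x.2 x.1 : ℂ).re - (inner ℂ (B x.1) x.1 : ℂ).re := by
    rw [inner_sub_left]; simp
  rw [h1] at h
  refine hasSum_of_forall_eq h fun i => ?_
  rw [← inner_conj_symm, Complex.mul_conj]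
  simp only [Complex.reCLM_apply, Complex.re_ofReal_mul, Complex.ofReal_re, RCLike.norm_conj,
    Complex.normSq_eq_norm_sq]

theorem le_re_inner_of_diagRel {c ε : ℝ} (hBε : ∀ x, ‖B x‖ ≤ ε * ‖x‖) {x : K × K}
    (hx : x ∈ diagRel b d B) (h : ∀ i, (inner ℂ (b i) x.1 : ℂ) = 0 ∨ c ≤ d i) :
    (c - ε) * ‖x.1‖ ^ 2 ≤ (inner ℂ x.2 x.1 : ℂ).re := by
  have h1 := hasSum_le (fun i => ?_) ((HilbertBasis.hasSum_norm_sq b x.1).mul_left c)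
    (hasSum_diagRel_re hx)
  · have h2 := abs_le.1 (abs_re_inner_clm_le hBε x.1)
    linarith [h2.1]
  · rcases h i with h0 | h0
    · simp [h0]
    · exact mul_le_mul_of_nonneg_right h0 (sq_nonneg _)

theorem re_inner_le_of_diagRel {c ε : ℝ} (hBε : ∀ x, ‖B x‖ ≤ ε * ‖x‖) {x : K × K}
    (hx : x ∈ diagRel b d B) (h : ∀ i, (inner ℂ (b i) x.1 : ℂ) = 0 ∨ d i ≤ -c) :
    (inner ℂ x.2 x.1 : ℂ).re ≤ -(c - ε) * ‖x.1‖ ^ 2 := by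
  have h1 := hasSum_le (fun i => ?_) (hasSum_diagRel_re hx)
    ((HilbertBasis.hasSum_norm_sq b x.1).mul_left (-c))
  · have h2 := abs_le.1 (abs_re_inner_clm_le hBε x.1)
    linarith [h2.2]
  · rcases h i with h0 | h0
    · simp [h0]
    · exact mul_le_mul_of_nonneg_right h0 (sq_nonneg _)

/-- A kernel vector is concentrated on the only basis vector with a small diagonal entry. -/
theorem norm_sq_sub_le_of_kernel {c ε : ℝ} (hc : 0 < c) (hBε : ∀ x, ‖B x‖ ≤ ε * ‖x‖) {p : K}
    (hp : (p, 0) ∈ diagRel b d B) {i₀ : ι} (h : ∀ i, i ≠ i₀ → c ≤ |d i|) :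
    c ^ 2 * (‖p‖ ^ 2 - ‖(inner ℂ (b i₀) p : ℂ)‖ ^ 2) ≤ (ε * ‖p‖) ^ 2 := by
  classical
  -- Off `i₀` the kernel equation reads `d i * p_i = -(B p)_i`, so the Parseval sum without the `i₀`
  -- term is controlled by `‖B p‖²`.
  have h1 := (HilbertBasis.hasSum_norm_sq b p).update i₀ 0
  have h2 := hasSum_le (fun i => ?_) (h1.mul_left (c ^ 2)) (HilbertBasis.hasSum_norm_sq b (B p))
  · calc c ^ 2 * (‖p‖ ^ 2 - ‖(inner ℂ (b i₀) p : ℂ)‖ ^ 2) =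
        c ^ 2 * (0 - ‖(inner ℂ (b i₀) p : ℂ)‖ ^ 2 + ‖p‖ ^ 2) := by ring
      _ ≤ ‖B p‖ ^ 2 := h2
      _ ≤ (ε * ‖p‖) ^ 2 := by gcongr; exact hBε p
  · rcases eq_or_ne i i₀ with rfl | hi
    · simp
    · rw [Function.update_of_ne hi]
      have h3 := hp i
      simp only [inner_zero_right] at h3
      have h4 : (inner ℂ (b i) (B p) : ℂ) = -(d i * inner ℂ (b i) p) := by
        linear_combination -h3
      rw [h4, norm_neg, norm_mul, mul_pow, Complex.norm_real, Real.norm_eq_abs]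
      gcongr
      exact h i hi

/-- The span of finitely many basis vectors. -/
def basisSpan (b : HilbertBasis ι ℂ K) (N : Finset ι) : Submodule ℂ K :=
  Submodule.span ℂ (b '' (N : Set ι))

instance (N : Finset ι) : FiniteDimensional ℂ (basisSpan b N) :=
  FiniteDimensional.span_of_finite ℂ (N.finite_toSet.image b)

theorem finrank_basisSpan (b : HilbertBasis ι ℂ K) (N : Finset ι) :
    Module.finrank ℂ (basisSpan b N) = N.card := by
  have h := b.orthonormal.linearIndependent.comp (fun i : N => (i : ι)) Subtype.val_injective
  have h1 := finrank_span_eq_card h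
  rw [Fintype.card_coe] at h1
  rw [← h1, basisSpan, show range (b ∘ fun i : N => (i : ι)) = b '' (N : Set ι) by
    rw [range_comp b]; simp]

theorem basisSpan_le_domain (N : Finset ι) {u : K} (hu : u ∈ basisSpan b N) :
    ∃ q, (u, q) ∈ diagRel b d B := by
  have h : basisSpan b N ≤ (diagRel b d B).map (LinearMap.fst ℂ K K) := by
    refine Submodule.span_le.2 ?_
    rintro _ ⟨i, _, rfl⟩
    exact ⟨_, basis_mem_diagRel i, rfl⟩
  obtain ⟨x, hx, rfl⟩ := h hu
  exact ⟨x.2, hx⟩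

theorem inner_eq_zero_of_mem_basisSpan {N : Finset ι} {u : K} (hu : u ∈ basisSpan b N) {i : ι}
    (hi : i ∉ N) : (inner ℂ (b i) u : ℂ) = 0 := by
  have h : basisSpan b N ≤ LinearMap.ker (innerSL ℂ (b i) : K →ₗ[ℂ] ℂ) := by
    refine Submodule.span_le.2 ?_
    rintro _ ⟨j, hj, rfl⟩
    exact b.orthonormal.2 (by rintro rfl; exact hi hj)
  exact h hu

theorem inner_eq_zero_of_mem_basisSpan_orthogonal {N : Finset ι} {u : K}
    (hu : u ∈ (basisSpan b N)ᗮ) {i : ι} (hi : i ∈ N) : (inner ℂ (b i) u : ℂ) = 0 :=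
  (Submodule.mem_orthogonal _ _).1 hu _ (Submodule.subset_span ⟨i, hi, rfl⟩)

/-- Invertibility and number of negative eigenvalues when the diagonal entries have a gap. -/
theorem diagRel_gap [CompleteSpace K] (hB : ∀ x y, (inner ℂ (B x) y : ℂ) = inner ℂ x (B y))
    {c ε : ℝ} (hBε : ∀ x, ‖B x‖ ≤ ε * ‖x‖) (hεc : ε < c) (N : Finset ι)
    (hN : ∀ i ∈ N, d i ≤ -c) (hP : ∀ i, i ∉ N → c ≤ d i) :
    (∀ q, ∃! p, (p, q) ∈ diagRel b d B) ∧
      (∀ x ∈ diagRel b d B, ‖x.1‖ ≤ 2 / (c - ε) * ‖x.2‖) ∧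
      Module.rank ℂ (Submodule.span ℂ
        {p : K | ∃ μ : ℝ, μ < 0 ∧ (p, (μ : ℂ) • p) ∈ diagRel b d B}) = N.card := by
  rw [← finrank_basisSpan b N]
  refine (isSelfAdjointRel_diagRel hB).invertible_and_rank
    (Submodule.isCompl_orthogonal (K := basisSpan b N))
    (sub_pos.2 hεc) (fun u hu => basisSpan_le_domain N hu) ?_ ?_
  · intro x hx hxU
    refine re_inner_le_of_diagRel hBε hx fun i => ?_
    by_cases hi : i ∈ N
    · exact Or.inr (hN i hi)
    · exact Or.inl (inner_eq_zero_of_mem_basisSpan hxU hi)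
  · intro x hx hxV
    refine le_re_inner_of_diagRel hBε hx fun i => ?_
    by_cases hi : i ∈ N
    · exact Or.inl (inner_eq_zero_of_mem_basisSpan_orthogonal hxV hi)
    · exact Or.inr (hP i hi)

/-- A vector with nonzero `i₀` coefficient can replace `b i₀` in the decomposition. The two
conclusions together allow it to be attached to either summand, which is how both sides of the
crossing are treated. -/
theorem isCompl_sup_kernel [DecidableEq ι] {N : Finset ι} {i₀ : ι} (hi₀ : i₀ ∉ N) {p₀ : K}
    (hp₀ : (inner ℂ (b i₀) p₀ : ℂ) ≠ 0) :
    Disjoint (basisSpan b N) (Submodule.span ℂ {p₀}) ∧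
    IsCompl (basisSpan b N ⊔ Submodule.span ℂ {p₀}) (basisSpan b (insert i₀ N))ᗮ := by
  have hcoef : ∀ x ∈ basisSpan b N, ∀ t : ℂ, (inner ℂ (b i₀) (x + t • p₀) : ℂ) = 0 → t = 0 := by
    intro x hx t h
    rw [inner_add_right, inner_eq_zero_of_mem_basisSpan hx hi₀, zero_add, inner_smul_right] at h
    exact (mul_eq_zero.1 h).resolve_right hp₀
  have hmono : basisSpan b N ≤ basisSpan b (insert i₀ N) :=
    Submodule.span_mono (image_mono (by simp))
  refine ⟨?_, ⟨?_, ?_⟩⟩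
  · rw [Submodule.disjoint_def]
    intro x hx hx'
    obtain ⟨t, rfl⟩ := Submodule.mem_span_singleton.1 hx'
    have h := inner_eq_zero_of_mem_basisSpan hx hi₀
    rw [inner_smul_right] at h
    rw [(mul_eq_zero.1 h).resolve_right hp₀, zero_smul]
  · rw [Submodule.disjoint_def]
    intro y hy hy'
    obtain ⟨x, hx, z, hz, rfl⟩ := Submodule.mem_sup.1 hy
    obtain ⟨t, rfl⟩ := Submodule.mem_span_singleton.1 hz
    have ht := hcoef x hx t
      (inner_eq_zero_of_mem_basisSpan_orthogonal hy' (Finset.mem_insert_self _ _))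
    rw [ht, zero_smul, add_zero] at hy' ⊢
    exact Submodule.disjoint_def.1 (Submodule.orthogonal_disjoint (basisSpan b N)) x hx
      (Submodule.orthogonal_le hmono hy')
  · rw [codisjoint_iff, eq_top_iff]
    intro p _
    set t : ℂ := inner ℂ (b i₀) p / inner ℂ (b i₀) p₀ with ht
    obtain ⟨x, hx, v, hv, hxv⟩ : ∃ x ∈ basisSpan b N, ∃ v ∈ (basisSpan b N)ᗮ, x + v = p - t • p₀ :=
      Submodule.mem_sup.1 (by
        rw [(Submodule.isCompl_orthogonal
          (K := basisSpan b N)).sup_eq_top]; trivial)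
    refine Submodule.mem_sup.2 ⟨x + t • p₀, Submodule.add_mem_sup hx
      (Submodule.mem_span_singleton.2 ⟨t, rfl⟩), v, ?_, ?_⟩
    · rw [Submodule.mem_orthogonal]
      intro u hu
      have hle : basisSpan b (insert i₀ N) ≤ LinearMap.ker ((innerSL ℂ v) : K →ₗ[ℂ] ℂ) := by
        refine Submodule.span_le.2 ?_
        rintro _ ⟨j, hj, rfl⟩
        change (inner ℂ v (b j) : ℂ) = 0
        rw [inner_eq_zero_symm]
        rcases Finset.mem_insert.1 hj with rfl | hj
        · have h1 : v = p - t • p₀ - x := by rw [← hxv]; abel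
          rw [h1, inner_sub_right, inner_sub_right, inner_eq_zero_of_mem_basisSpan hx hi₀,
            inner_smul_right, ht, div_mul_cancel₀ _ hp₀, sub_self, sub_zero]
        · exact inner_eq_zero_of_mem_basisSpan_orthogonal hv hj
      rw [inner_eq_zero_symm]
      exact hle hu
    · rw [add_right_comm, hxv, sub_add_cancel]

theorem mem_diagRel_shift {d' : ι → ℝ} {σ : ι → ℝ} {δ : ℝ} {S : K →L[ℂ] K}
    (hS : ∀ i x, (inner ℂ (b i) (S x) : ℂ) = σ i * inner ℂ (b i) x)
    (hd : ∀ i, d' i = d i + δ * σ i) {p q : K} (h : (p, q) ∈ diagRel b d B) :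
    (p, q + (δ : ℂ) • S p) ∈ diagRel b d' B := by
  intro i
  simp only [inner_add_right, inner_smul_right, hS, h i, hd i, Complex.ofReal_add,
    Complex.ofReal_mul]
  ring

/-- The sign `s = ±1` treats both sides of the crossing at once. On the kernel direction `z` the
shifted operator acts as `s δ S`, so the form there has size only `δ κ`; the cross term is also of
order `δ` and is absorbed by Young's inequality, provided `δ` is small against the gap `g`. -/
theorem re_inner_add_kernel_le {S : K →L[ℂ] K} (hS1 : ∀ x, ‖S x‖ ≤ ‖x‖) {g κ δ : ℝ}
    (hκ : 0 < κ) (hδ : 0 < δ) (hδg : 4 * δ ≤ g * κ) {x z qx : K} (s : ℝ)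
    (hx : s * (inner ℂ qx x : ℂ).re ≤ -g * ‖x‖ ^ 2)
    (hsym : (inner ℂ qx z : ℂ) = inner ℂ x ((((s * δ : ℝ)) : ℂ) • S z)) (hs : s ^ 2 = 1)
    (hz : (inner ℂ (S z) z : ℂ).re ≤ -κ * ‖z‖ ^ 2) :
    s * (inner ℂ (qx + ((s * δ : ℝ) : ℂ) • S z) (x + z) : ℂ).re ≤
      -(min (g / 4) (δ * κ / 4)) * ‖x + z‖ ^ 2 := by
  have e1 : s * (inner ℂ (qx + ((s * δ : ℝ) : ℂ) • S z) (x + z) : ℂ).re =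
      s * (inner ℂ qx x : ℂ).re + 2 * δ * (inner ℂ (S z) x : ℂ).re
        + δ * (inner ℂ (S z) z : ℂ).re := by
    have e2 : (inner ℂ x (S z) : ℂ).re = (inner ℂ (S z) x : ℂ).re := by
      rw [← inner_conj_symm, Complex.conj_re]
    simp only [inner_add_left, inner_add_right, hsym, inner_smul_left, inner_smul_right,
      Complex.conj_ofReal, Complex.add_re, Complex.re_ofReal_mul, e2]
    linear_combination (2 * δ * (inner ℂ (S z) x : ℂ).re + δ * (inner ℂ (S z) z : ℂ).re) * hs
  have e3 : (inner ℂ (S z) x : ℂ).re ≤ ‖z‖ * ‖x‖ :=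
    (Complex.re_le_norm _).trans ((norm_inner_le_norm _ _).trans (by gcongr; exact hS1 z))
  have e4 : ‖x + z‖ ^ 2 ≤ 2 * ‖x‖ ^ 2 + 2 * ‖z‖ ^ 2 := by
    have := norm_add_le x z
    have h0 := norm_nonneg (x + z)
    nlinarith [sq_nonneg (‖x‖ - ‖z‖)]
  -- Young's inequality weighted to give up half of `δ κ ‖z‖²`; the remaining coefficient `2δ/κ` is
  -- at most `g/2` by `4δ ≤ gκ`.
  have e5 : 2 * δ * (‖z‖ * ‖x‖) ≤ δ * κ / 2 * ‖z‖ ^ 2 + g / 2 * ‖x‖ ^ 2 := by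
    have h1 : 0 ≤ δ / (2 * κ) * (κ * ‖z‖ - 2 * ‖x‖) ^ 2 := by positivity
    have h2 : δ / (2 * κ) * (κ * ‖z‖ - 2 * ‖x‖) ^ 2 =
        δ * κ / 2 * ‖z‖ ^ 2 - 2 * δ * (‖z‖ * ‖x‖) + 2 * δ / κ * ‖x‖ ^ 2 := by
      field_simp; ring
    have h3 : 2 * δ / κ ≤ g / 2 := by rw [div_le_iff₀ hκ]; linarith
    nlinarith [mul_le_mul_of_nonneg_right h3 (sq_nonneg ‖x‖)]
  have m1 := min_le_left (g / 4) (δ * κ / 4)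
  have m2 := min_le_right (g / 4) (δ * κ / 4)
  have hg : 0 < g := by
    by_contra hg
    push Not at hg
    nlinarith
  have m0 : 0 ≤ min (g / 4) (δ * κ / 4) := by positivity
  rw [e1]
  have e6 := mul_le_mul_of_nonneg_left e3 (by positivity : 0 ≤ 2 * δ)
  have e7 := mul_le_mul_of_nonneg_left hz hδ.le
  nlinarith [mul_le_mul_of_nonneg_left e4 m0, mul_le_mul_of_nonneg_right m1 (sq_nonneg ‖x‖),
    mul_le_mul_of_nonneg_right m2 (sq_nonneg ‖z‖)]

/-- Crossing: a simple eigenvalue passes through zero when the diagonal is shifted by `δ σ`. -/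
theorem diagRel_crossing [CompleteSpace K] [DecidableEq ι]
    (hB : ∀ x y, (inner ℂ (B x) y : ℂ) = inner ℂ x (B y))
    {c ε κ δ : ℝ} (hBε : ∀ x, ‖B x‖ ≤ ε * ‖x‖) (hεc : ε < c) (hκ : 0 < κ) {N : Finset ι} {i₀ : ι}
    (hi₀ : i₀ ∉ N) {d' σ : ι → ℝ} {S : K →L[ℂ] K} (hS1 : ∀ x, ‖S x‖ ≤ ‖x‖)
    (hS : ∀ i x, (inner ℂ (b i) (S x) : ℂ) = σ i * inner ℂ (b i) x)
    (hd : ∀ i, d' i = d i + δ * σ i) (hN : ∀ i ∈ N, d' i ≤ -c)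
    (hP : ∀ i, i ∉ N → i ≠ i₀ → c ≤ d' i) {p₀ : K} (hp₀ : (p₀, 0) ∈ diagRel b d B)
    (hp₀i : (inner ℂ (b i₀) p₀ : ℂ) ≠ 0) (hp₀κ : (inner ℂ (S p₀) p₀ : ℂ).re ≤ -κ * ‖p₀‖ ^ 2)
    (hδ0 : δ ≠ 0) (hδ : 4 * |δ| ≤ (c - ε) * κ) :
    (∀ q, ∃! p, (p, q) ∈ diagRel b d' B) ∧
      Module.rank ℂ (Submodule.span ℂ
        {p : K | ∃ μ : ℝ, μ < 0 ∧ (p, (μ : ℂ) • p) ∈ diagRel b d' B}) =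
        (if 0 < δ then N.card + 1 else N.card : ℕ) := by
  have hsa := isSelfAdjointRel_diagRel (b := b) (d := d') hB
  obtain ⟨hdis, hcompl⟩ := isCompl_sup_kernel hi₀ hp₀i
  have hz (z : K) (hz : z ∈ Submodule.span ℂ {p₀}) : (z, (δ : ℂ) • S z) ∈ diagRel b d' B ∧
      (inner ℂ (S z) z : ℂ).re ≤ -κ * ‖z‖ ^ 2 := by
    obtain ⟨t, rfl⟩ := Submodule.mem_span_singleton.1 hz
    constructor
    · have h1 := (diagRel b d B).smul_mem t hp₀
      have h2 := mem_diagRel_shift hS hd (p := t • p₀) (q := 0) (by simpa using h1)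
      simpa using h2
    · rw [map_smul, inner_smul_left, inner_smul_right, ← mul_assoc,
        ← Complex.normSq_eq_conj_mul_self, Complex.re_ofReal_mul, norm_smul, mul_pow,
        Complex.normSq_eq_norm_sq]
      nlinarith [mul_le_mul_of_nonneg_left hp₀κ (sq_nonneg ‖t‖)]
  have hxneg : ∀ x ∈ diagRel b d' B, x.1 ∈ basisSpan b N →
      (inner ℂ x.2 x.1 : ℂ).re ≤ -(c - ε) * ‖x.1‖ ^ 2 := by
    intro x hx hxU
    refine re_inner_le_of_diagRel hBε hx fun i => ?_
    by_cases hi : i ∈ N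
    · exact Or.inr (hN i hi)
    · exact Or.inl (inner_eq_zero_of_mem_basisSpan hxU hi)
  have hxpos : ∀ x ∈ diagRel b d' B, x.1 ∈ (basisSpan b (insert i₀ N))ᗮ →
      (c - ε) * ‖x.1‖ ^ 2 ≤ (inner ℂ x.2 x.1 : ℂ).re := by
    intro x hx hxV
    refine le_re_inner_of_diagRel hBε hx fun i => ?_
    by_cases hi : i ∈ insert i₀ N
    · exact Or.inl (inner_eq_zero_of_mem_basisSpan_orthogonal hxV hi)
    · rw [Finset.mem_insert, not_or] at hi
      exact Or.inr (hP i hi.2 hi.1)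
  have hg : 0 < c - ε := sub_pos.2 hεc
  -- For `δ < 0` the kernel vector joins the positive complement and the count is the size of `N`;
  -- for `δ > 0` it joins the negative space and adds one.
  rcases hδ0.lt_or_gt with hneg | hpos
  · rw [if_neg (not_lt.2 hneg.le)]
    rw [abs_of_neg hneg] at hδ
    have hc' : 0 < min ((c - ε) / 4) (-δ * κ / 4) := by
      have := mul_pos (neg_pos.2 hneg) hκ
      positivity
    have h := hsa.invertible_and_rank (U := basisSpan b N)
      (V := Submodule.span ℂ {p₀} ⊔ (basisSpan b (insert i₀ N))ᗮ)
      ⟨hdis.disjoint_sup_right_of_disjoint_sup_left hcompl.disjoint, by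
        rw [codisjoint_iff, ← sup_assoc]; exact hcompl.sup_eq_top⟩
      hc' (fun u hu => basisSpan_le_domain N hu) ?_ ?_
    · rw [finrank_basisSpan] at h
      exact ⟨h.1, h.2.2⟩
    · intro x hx hxU
      refine (hxneg x hx hxU).trans ?_
      have := min_le_left ((c - ε) / 4) (-δ * κ / 4)
      nlinarith [sq_nonneg ‖x.1‖]
    · rintro ⟨p, q⟩ hpq hpV
      obtain ⟨z, hzm, x, hx, rfl⟩ := Submodule.mem_sup.1 hpV
      obtain ⟨hz1, hz2⟩ := hz z hzm
      have hq : (x, q - (δ : ℂ) • S z) ∈ diagRel b d' B := by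
        have := (diagRel b d' B).sub_mem hpq hz1
        simpa using this
      have h1 := hxpos _ hq hx
      have h2 := hsa.symm _ hq _ hz1
      have h3 := re_inner_add_kernel_le hS1 hκ (neg_pos.2 hneg) hδ (x := x) (z := z)
        (qx := q - (δ : ℂ) • S z) (-1) (by simp only at h1; linarith) (by simpa using h2)
        (by norm_num) hz2
      simp only [neg_mul, one_mul, neg_neg, sub_add_cancel] at h3
      rw [add_comm x z] at h3
      simp only [neg_mul]
      linarith
  · rw [if_pos hpos]
    rw [abs_of_pos hpos] at hδ
    have hc' : 0 < min ((c - ε) / 4) (δ * κ / 4) := by positivity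
    have h := hsa.invertible_and_rank (U := basisSpan b N ⊔ Submodule.span ℂ {p₀})
      (V := (basisSpan b (insert i₀ N))ᗮ) hcompl hc' ?_ ?_ ?_
    · refine ⟨h.1, ?_⟩
      rw [h.2.2]
      have h1 := Submodule.finrank_sup_add_finrank_inf_eq (basisSpan b N) (Submodule.span ℂ {p₀})
      rw [hdis.eq_bot, finrank_bot, add_zero, finrank_basisSpan, finrank_span_singleton] at h1
      · rw [h1]
      · rintro rfl
        simp at hp₀i
    · intro u hu
      obtain ⟨x, hx, z, hzm, rfl⟩ := Submodule.mem_sup.1 hu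
      obtain ⟨q, hq⟩ := basisSpan_le_domain (d := d') (B := B) N hx
      exact ⟨_, (diagRel b d' B).add_mem hq (hz z hzm).1⟩
    · rintro ⟨p, q⟩ hpq hpU
      obtain ⟨x, hx, z, hzm, rfl⟩ := Submodule.mem_sup.1 hpU
      obtain ⟨hz1, hz2⟩ := hz z hzm
      have hq : (x, q - (δ : ℂ) • S z) ∈ diagRel b d' B := by
        have := (diagRel b d' B).sub_mem hpq hz1
        simpa using this
      have h1 := hxneg _ hq hx
      have h2 := hsa.symm _ hq _ hz1
      have h3 := re_inner_add_kernel_le hS1 hκ hpos hδ (x := x) (z := z)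
        (qx := q - (δ : ℂ) • S z) 1 (by simpa using h1) (by simpa using h2) (by norm_num) hz2
      simpa using h3
    · intro x hx hxV
      refine le_trans ?_ (hxpos x hx hxV)
      have := min_le_left ((c - ε) / 4) (δ * κ / 4)
      nlinarith [sq_nonneg ‖x.1‖]

end Diagonal

/-! ### The measure `r dr` compared with Lebesgue measure on the half-line. -/

section RadialMeasure

theorem radialMeasure_ac : radialMeasure ≪ (volume : Measure ℝ).restrict (Ioi 0) :=
  withDensity_absolutelyContinuous _ _

theorem ac_radialMeasure : (volume : Measure ℝ).restrict (Ioi 0) ≪ radialMeasure := by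
  refine withDensity_absolutelyContinuous' (by fun_prop) ?_
  refine (ae_restrict_iff' measurableSet_Ioi).2 (Eventually.of_forall fun r hr => ?_)
  simpa using hr

theorem ae_radialMeasure_iff {p : ℝ → Prop} : (∀ᵐ r ∂radialMeasure, p r) ↔
    ∀ᵐ r ∂(volume : Measure ℝ), r ∈ Ioi (0 : ℝ) → p r := by
  rw [← ae_restrict_iff' measurableSet_Ioi]
  exact ⟨fun h => ac_radialMeasure.ae_le h, fun h => radialMeasure_ac.ae_le h⟩

theorem ae_pos_radialMeasure : ∀ᵐ r ∂radialMeasure, 0 < r :=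
  ae_radialMeasure_iff.2 (Eventually.of_forall fun _ h => h)

variable {E : Type*} [NormedAddCommGroup E] [NormedSpace ℝ E]

theorem integral_radialMeasure (f : ℝ → E) :
    ∫ r, f r ∂radialMeasure = ∫ r in Ioi (0 : ℝ), r • f r := by
  rw [radialMeasure, integral_withDensity_eq_integral_toReal_smul (by fun_prop) (by simp)]
  refine setIntegral_congr_fun measurableSet_Ioi fun r hr => ?_
  rw [ENNReal.toReal_ofReal (le_of_lt hr)]

theorem integrable_radialMeasure_iff {f : ℝ → E} :
    Integrable f radialMeasure ↔ IntegrableOn (fun r => r • f r) (Ioi 0) := by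
  rw [radialMeasure, integrable_withDensity_iff_integrable_smul' (by fun_prop) (by simp)]
  refine integrableOn_congr_fun (fun r hr => ?_) measurableSet_Ioi
  rw [ENNReal.toReal_ofReal (le_of_lt hr)]

instance : IsLocallyFiniteMeasure radialMeasure :=
  IsLocallyFiniteMeasure.withDensity_ofReal continuous_id

/-- A compact subset of the open half-line stays away from the origin, so the weight `r` can be
divided out there. -/
theorem locallyIntegrableOn_of_radialMeasure {f : ℝ → E}
    (hf : LocallyIntegrable f radialMeasure) : LocallyIntegrableOn f (Ioi 0) := by
  rw [locallyIntegrableOn_iff isOpen_Ioi.isLocallyClosed]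
  intro k hk hkc
  have h1 : IntegrableOn f k radialMeasure := hf.integrableOn_isCompact hkc
  have h2 : IntegrableOn (fun r => r • f r) k := by
    rw [← integrable_indicator_iff hkc.measurableSet, integrable_radialMeasure_iff] at h1
    have h3 := (integrable_indicator_iff measurableSet_Ioi).2 h1
    rw [← integrable_indicator_iff hkc.measurableSet]
    refine h3.congr (Eventually.of_forall fun r => ?_)
    by_cases hr : r ∈ k
    · rw [indicator_of_mem hr, indicator_of_mem (hk hr), indicator_of_mem hr]
    · by_cases hr' : r ∈ Ioi (0 : ℝ)
      · rw [indicator_of_notMem hr, indicator_of_mem hr', indicator_of_notMem hr, smul_zero]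
      · rw [indicator_of_notMem hr, indicator_of_notMem hr']
  have h4 : IntegrableOn (fun r => r⁻¹ • (r • f r)) k :=
    h2.continuousOn_smul (continuousOn_inv₀.mono fun r hr => ne_of_gt (hk hr)) hkc
  refine h4.congr_fun (fun r hr => ?_) hkc.measurableSet
  change r⁻¹ • r • f r = f r
  rw [smul_smul, inv_mul_cancel₀ (ne_of_gt (hk hr)), one_smul]

theorem locallyIntegrableOn_of_memLp {f : ℝ → E} (hf : MemLp f 2 radialMeasure) :
    LocallyIntegrableOn f (Ioi 0) :=
  locallyIntegrableOn_of_radialMeasure (hf.locallyIntegrable (by norm_num))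

end RadialMeasure

/-! ### Calculus of weak derivatives and cutoffs on the half-line. -/

section WeakDeriv

theorem integral_eq_setIntegral_of_tsupport {E : Type*} [NormedAddCommGroup E] [NormedSpace ℝ E]
    {φ : ℝ → ℝ} (h3 : tsupport φ ⊆ Ioi 0) (f : ℝ → E) :
    ∫ r in Ioi (0 : ℝ), φ r • f r = ∫ r, φ r • f r := by
  refine setIntegral_eq_integral_of_forall_compl_eq_zero fun r hr => ?_
  rw [image_eq_zero_of_notMem_tsupport (fun h => hr (h3 h)), zero_smul]

theorem integrableOn_test_smul {φ : ℝ → ℝ} (h1 : Continuous φ) (h2 : HasCompactSupport φ)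
    (h3 : tsupport φ ⊆ Ioi 0) {f : ℝ → ℂ} (hf : LocallyIntegrableOn f (Ioi 0)) :
    IntegrableOn (fun r => φ r • f r) (Ioi 0) := by
  refine Integrable.integrableOn ?_
  refine (integrableOn_iff_integrable_of_support_subset (s := tsupport φ) ?_).mp
    ((hf.integrableOn_compact_subset h3 h2).continuousOn_smul h1.continuousOn h2)
  exact (Function.support_smul_subset_left φ f).trans (subset_tsupport φ)

theorem HasWeakDeriv.congr {u v u' v' : ℝ → ℂ} (h : HasWeakDeriv u v)
    (hu : u =ᵐ[radialMeasure] u') (hv : v =ᵐ[radialMeasure] v') : HasWeakDeriv u' v' := by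
  have hu' : u =ᵐ[volume.restrict (Ioi 0)] u' := ac_radialMeasure.ae_le hu
  have hv' : v =ᵐ[volume.restrict (Ioi 0)] v' := ac_radialMeasure.ae_le hv
  have key : ∀ {f g : ℝ → ℂ}, f =ᵐ[volume.restrict (Ioi 0)] g → LocallyIntegrableOn f (Ioi 0) →
      LocallyIntegrableOn g (Ioi 0) := by
    intro f g hfg hf
    rw [locallyIntegrableOn_iff isOpen_Ioi.isLocallyClosed] at hf ⊢
    intro k hk hkc
    exact (hf k hk hkc).congr (ae_restrict_of_ae_restrict_of_subset hk hfg)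
  refine ⟨key hu' h.1, key hv' h.2.1, fun φ h1 h2 h3 => ?_⟩
  have e1 : ∫ r in Ioi (0 : ℝ), deriv φ r • u r = ∫ r in Ioi (0 : ℝ), deriv φ r • u' r :=
    integral_congr_ae (hu'.mono fun r hr => congrArg (deriv φ r • ·) hr)
  have e2 : ∫ r in Ioi (0 : ℝ), φ r • v r = ∫ r in Ioi (0 : ℝ), φ r • v' r :=
    integral_congr_ae (hv'.mono fun r hr => congrArg (φ r • ·) hr)
  rw [← e1, ← e2]
  exact h.2.2 φ h1 h2 h3

theorem HasWeakDeriv.weakDeriv_ae {u v : ℝ → ℂ} (h : HasWeakDeriv u v) :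
    weakDeriv u =ᵐ[radialMeasure] v := by
  have h' : ∃ v, HasWeakDeriv u v := ⟨v, h⟩
  rw [weakDeriv, dif_pos h']
  exact ae_radialMeasure_iff.2 (h'.choose_spec.ae_unique h)

theorem HasWeakDeriv.hasWeakDeriv_weakDeriv {u v : ℝ → ℂ} (h : HasWeakDeriv u v) :
    HasWeakDeriv u (weakDeriv u) :=
  h.congr (ae_eq_refl _) h.weakDeriv_ae.symm

theorem HasTwoWeakDerivs.fst {u : ℝ → ℂ} (h : HasTwoWeakDerivs u) :
    HasWeakDeriv u (weakDeriv u) := by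
  obtain ⟨u₁, u₂, h1, h2⟩ := h
  exact h1.hasWeakDeriv_weakDeriv

theorem HasTwoWeakDerivs.snd {u : ℝ → ℂ} (h : HasTwoWeakDerivs u) :
    HasWeakDeriv (weakDeriv u) (weakDeriv (weakDeriv u)) := by
  obtain ⟨u₁, u₂, h1, h2⟩ := h
  exact (h2.congr h1.weakDeriv_ae.symm (ae_eq_refl _)).hasWeakDeriv_weakDeriv

theorem deriv_test {φ : ℝ → ℝ} (h1 : ContDiff ℝ (⊤ : ℕ∞) φ) (h2 : HasCompactSupport φ)
    (h3 : tsupport φ ⊆ Ioi 0) :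
    Continuous (deriv φ) ∧ HasCompactSupport (deriv φ) ∧ tsupport (deriv φ) ⊆ Ioi 0 :=
  ⟨h1.continuous_deriv (by simp), h2.deriv, (tsupport_deriv_subset).trans h3⟩

theorem HasWeakDeriv.add {u v u' v' : ℝ → ℂ} (h : HasWeakDeriv u v) (h' : HasWeakDeriv u' v') :
    HasWeakDeriv (fun r => u r + u' r) (fun r => v r + v' r) := by
  refine ⟨h.1.add h'.1, h.2.1.add h'.2.1, fun φ h1 h2 h3 => ?_⟩
  obtain ⟨d1, d2, d3⟩ := deriv_test h1 h2 h3
  simp only [smul_add]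
  rw [integral_add (integrableOn_test_smul d1 d2 d3 h.1) (integrableOn_test_smul d1 d2 d3 h'.1),
    integral_add (integrableOn_test_smul h1.continuous h2 h3 h.2.1)
      (integrableOn_test_smul h1.continuous h2 h3 h'.2.1), h.2.2 φ h1 h2 h3, h'.2.2 φ h1 h2 h3]
  ring

theorem HasWeakDeriv.const_mul {u v : ℝ → ℂ} (h : HasWeakDeriv u v) (c : ℂ) :
    HasWeakDeriv (fun r => c * u r) (fun r => c * v r) := by
  refine ⟨h.1.continuousOn_mul continuousOn_const isOpen_Ioi.isLocallyClosed,
    h.2.1.continuousOn_mul continuousOn_const isOpen_Ioi.isLocallyClosed, fun φ h1 h2 h3 => ?_⟩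
  simp only [← smul_eq_mul, smul_comm _ c]
  rw [integral_smul, integral_smul, h.2.2 φ h1 h2 h3, smul_neg]

theorem HasWeakDeriv.sub {u v u' v' : ℝ → ℂ} (h : HasWeakDeriv u v) (h' : HasWeakDeriv u' v') :
    HasWeakDeriv (fun r => u r - u' r) (fun r => v r - v' r) := by
  simpa [sub_eq_add_neg] using h.add (h'.const_mul (-1))

/-- The product rule for the product with a smooth function. -/
theorem HasWeakDeriv.smooth_mul {u v : ℝ → ℂ} (h : HasWeakDeriv u v) {g : ℝ → ℝ}
    (hg : ContDiff ℝ (⊤ : ℕ∞) g) :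
    HasWeakDeriv (fun r => (g r : ℂ) * u r) (fun r => ((deriv g r : ℝ) : ℂ) * u r + g r * v r) := by
  have hgd : Continuous (deriv g) := hg.continuous_deriv (by simp)
  have m1 : ∀ {f : ℝ → ℝ} {w : ℝ → ℂ}, Continuous f → LocallyIntegrableOn w (Ioi 0) →
      LocallyIntegrableOn (fun r => (f r : ℂ) * w r) (Ioi 0) := fun hf hw =>
    hw.continuousOn_mul (Complex.continuous_ofReal.comp hf).continuousOn
      isOpen_Ioi.isLocallyClosed
  refine ⟨m1 hg.continuous h.1, (m1 hgd h.1).add (m1 hg.continuous h.2.1), fun φ h1 h2 h3 => ?_⟩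
  obtain ⟨d1, d2, d3⟩ := deriv_test h1 h2 h3
  have t2 : HasCompactSupport fun r => φ r * g r := h2.mul_right
  have t3 : tsupport (fun r => φ r * g r) ⊆ Ioi 0 := (tsupport_mul_subset_left).trans h3
  have hk := h.2.2 (fun r => φ r * g r) (h1.mul hg) t2 t3
  have hd : ∀ r, deriv (fun r => φ r * g r) r = deriv φ r * g r + φ r * deriv g r := fun r =>
    deriv_fun_mul (h1.differentiable (by simp)).differentiableAt
      (hg.differentiable (by simp)).differentiableAt
  have e1 : ∫ r in Ioi (0 : ℝ), deriv (fun r => φ r * g r) r • u r =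
      (∫ r in Ioi (0 : ℝ), deriv φ r • ((g r : ℂ) * u r)) +
        ∫ r in Ioi (0 : ℝ), φ r • (((deriv g r : ℝ) : ℂ) * u r) := by
    rw [← integral_add (integrableOn_test_smul d1 d2 d3 (m1 hg.continuous h.1))
      (integrableOn_test_smul h1.continuous h2 h3 (m1 hgd h.1))]
    refine integral_congr_ae (Eventually.of_forall fun r => ?_)
    simp only [hd, Complex.real_smul]
    push_cast
    ring
  have e2 : ∫ r in Ioi (0 : ℝ), (φ r * g r) • v r =
      ∫ r in Ioi (0 : ℝ), φ r • ((g r : ℂ) * v r) := by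
    refine integral_congr_ae (Eventually.of_forall fun r => ?_)
    simp only [Complex.real_smul]
    push_cast
    ring
  simp only [smul_add]
  rw [integral_add (integrableOn_test_smul h1.continuous h2 h3 (m1 hgd h.1))
      (integrableOn_test_smul h1.continuous h2 h3 (m1 hg.continuous h.2.1)), ← e2]
  rw [e1] at hk
  linear_combination hk

/-- A differentiable function with continuous derivative has it as weak derivative. -/
theorem hasWeakDeriv_of_hasDerivAt {u v : ℝ → ℂ} (h : ∀ r, HasDerivAt u (v r) r)
    (hv : Continuous v) : HasWeakDeriv u v := by
  have hu : Continuous u := continuous_iff_continuousAt.2 fun r => (h r).continuousAt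
  refine ⟨hu.locallyIntegrable.locallyIntegrableOn _, hv.locallyIntegrable.locallyIntegrableOn _,
    fun φ h1 h2 h3 => ?_⟩
  obtain ⟨d1, d2, d3⟩ := deriv_test h1 h2 h3
  rw [integral_eq_setIntegral_of_tsupport d3, integral_eq_setIntegral_of_tsupport h3,
    eq_neg_iff_add_eq_zero]
  have i1 : Integrable fun r => deriv φ r • u r :=
    (d1.smul hu).integrable_of_hasCompactSupport d2.smul_right
  have i2 : Integrable fun r => φ r • v r :=
    (h1.continuous.smul hv).integrable_of_hasCompactSupport h2.smul_right
  have i3 : Integrable fun r => φ r • u r :=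
    (h1.continuous.smul hu).integrable_of_hasCompactSupport h2.smul_right
  rw [← integral_add i1 i2]
  refine integral_eq_zero_of_hasDerivAt_of_integrable (f := fun r => φ r • u r) (fun r => ?_)
    (i1.add i2) i3
  have h4 := ((h1.differentiable (by simp)).differentiableAt (x := r)).hasDerivAt.smul (h r)
  rw [add_comm] at h4
  exact h4

/-- A cutoff function that is `1` on `[2/k, k]` and vanishes off `[1/k, 2k]`. -/
def cutoff (k : ℝ) (r : ℝ) : ℝ :=
  Real.smoothTransition (k * r - 1) * Real.smoothTransition (2 - r / k)

theorem contDiff_cutoff (k : ℝ) : ContDiff ℝ (⊤ : ℕ∞) (cutoff k) := by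
  unfold cutoff
  exact (Real.smoothTransition.contDiff.comp (by fun_prop)).mul
    (Real.smoothTransition.contDiff.comp (by fun_prop))

theorem support_cutoff {k : ℝ} (hk : 0 < k) : tsupport (cutoff k) ⊆ Icc (1 / k) (2 * k) := by
  refine closure_minimal (fun r hr => ?_) isClosed_Icc
  rw [Function.mem_support, cutoff, mul_ne_zero_iff, Ne, Ne,
    Real.smoothTransition.zero_iff_nonpos, Real.smoothTransition.zero_iff_nonpos] at hr
  push Not at hr
  constructor
  · rw [div_le_iff₀ hk]; linarith [hr.1]
  · have := hr.2
    rw [sub_pos, div_lt_iff₀ hk] at this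
    exact this.le

theorem cutoff_nonneg (k r : ℝ) : 0 ≤ cutoff k r :=
  mul_nonneg (Real.smoothTransition.nonneg _) (Real.smoothTransition.nonneg _)

theorem cutoff_le_one (k r : ℝ) : cutoff k r ≤ 1 :=
  mul_le_one₀ (Real.smoothTransition.le_one _) (Real.smoothTransition.nonneg _)
    (Real.smoothTransition.le_one _)

theorem cutoff_eventually_eq_one {r : ℝ} (hr : 0 < r) :
    ∀ᶠ k : ℝ in atTop, cutoff k =ᶠ[𝓝 r] fun _ => 1 := by
  filter_upwards [eventually_gt_atTop (2 / r), eventually_gt_atTop r, eventually_gt_atTop 0]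
    with k h1 h2 hk
  rw [div_lt_iff₀ hr] at h1
  have e1 : ∀ᶠ s in 𝓝 r, 2 < k * s :=
    (by fun_prop : Continuous fun s => k * s).continuousAt.eventually (lt_mem_nhds h1)
  have e2 : ∀ᶠ s in 𝓝 r, s < k := gt_mem_nhds h2
  filter_upwards [e1, e2] with s h3 h4
  rw [cutoff, Real.smoothTransition.one_of_one_le (by linarith),
    Real.smoothTransition.one_of_one_le, one_mul]
  have : s / k ≤ 1 := by rw [div_le_one hk]; exact h4.le
  linarith

theorem exists_bound_deriv_smoothTransition :
    ∃ C : ℝ, 0 ≤ C ∧ ∀ x, |deriv Real.smoothTransition x| ≤ C ∧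
      (x < 0 ∨ 1 < x → deriv Real.smoothTransition x = 0) := by
  have hc : Continuous (deriv Real.smoothTransition) :=
    (Real.smoothTransition.contDiff (n := (1 : ℕ∞))).continuous_deriv (by simp)
  have hz : ∀ x : ℝ, x < 0 ∨ 1 < x → deriv Real.smoothTransition x = 0 := by
    rintro x (hx | hx)
    · have : Real.smoothTransition =ᶠ[𝓝 x] fun _ => 0 := by
        filter_upwards [gt_mem_nhds hx] with y hy
        exact Real.smoothTransition.zero_of_nonpos hy.le
      rw [this.deriv_eq, deriv_const]
    · have : Real.smoothTransition =ᶠ[𝓝 x] fun _ => 1 := by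
        filter_upwards [lt_mem_nhds hx] with y hy
        exact Real.smoothTransition.one_of_one_le hy.le
      rw [this.deriv_eq, deriv_const]
  obtain ⟨C, hC⟩ := (isCompact_Icc (a := (0 : ℝ)) (b := 1)).exists_bound_of_continuousOn
    hc.continuousOn
  refine ⟨max C 0, le_max_right _ _, fun x => ⟨?_, hz x⟩⟩
  by_cases hx : x ∈ Icc (0 : ℝ) 1
  · exact (hC x hx).trans (le_max_left _ _)
  · rw [hz x, abs_zero]
    · exact le_max_right _ _
    · rw [mem_Icc, not_and_or, not_le, not_le] at hx
      exact hx

/-- Scale invariance: the derivative of the inner factor lives where `k r` is between `1` and `2`,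
that of the outer one where `r / k` is between `1` and `2`, so both `k` and `1 / k` are at most `2 /
r` where they matter. -/
theorem exists_bound_deriv_cutoff :
    ∃ C : ℝ, ∀ k > 0, ∀ r > 0, |deriv (cutoff k) r| ≤ C / r := by
  obtain ⟨C, hC0, hC⟩ := exists_bound_deriv_smoothTransition
  refine ⟨4 * C, fun k hk r hr => ?_⟩
  have hs : ∀ x, HasDerivAt Real.smoothTransition (deriv Real.smoothTransition x) x := fun x =>
    ((Real.smoothTransition.contDiff (n := (1 : ℕ∞))).differentiable (by simp)).differentiableAt
      |>.hasDerivAt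
  have h1 : HasDerivAt (fun r => Real.smoothTransition (k * r - 1))
      (deriv Real.smoothTransition (k * r - 1) * k) r := by
    have := (((hasDerivAt_id r).const_mul k).sub_const 1)
    rw [mul_one] at this
    exact (hs (k * r - 1)).comp r this
  have h2 : HasDerivAt (fun r => Real.smoothTransition (2 - r / k))
      (deriv Real.smoothTransition (2 - r / k) * -(1 / k)) r := by
    have := ((hasDerivAt_id r).div_const k).const_sub 2
    exact (hs (2 - r / k)).comp r this
  have h3 : deriv (cutoff k) r = _ := (h1.mul h2).deriv
  have b1 : |deriv Real.smoothTransition (k * r - 1) * k| ≤ 2 * C / r := by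
    rw [abs_mul, abs_of_pos hk, le_div_iff₀ hr]
    rcases lt_or_ge 1 (k * r - 1) with h | h
    · rw [(hC _).2 (Or.inr h)]; simpa using hC0
    · nlinarith [(hC (k * r - 1)).1, abs_nonneg (deriv Real.smoothTransition (k * r - 1)),
        mul_pos hk hr]
  have b2 : |deriv Real.smoothTransition (2 - r / k) * -(1 / k)| ≤ 2 * C / r := by
    rw [abs_mul, abs_neg, abs_of_pos (one_div_pos.2 hk), le_div_iff₀ hr]
    rcases lt_or_ge (2 - r / k) 0 with h | h
    · rw [(hC _).2 (Or.inl h)]; simpa using hC0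
    · have h4 : |deriv Real.smoothTransition (2 - r / k)| * (1 / k) * r =
          |deriv Real.smoothTransition (2 - r / k)| * (r / k) := by ring
      rw [h4]
      have h5 : 0 < r / k := div_pos hr hk
      nlinarith [(hC (2 - r / k)).1, abs_nonneg (deriv Real.smoothTransition (2 - r / k))]
  rw [h3]
  refine (abs_add_le _ _).trans ?_
  rw [abs_mul (_ * k), abs_mul (Real.smoothTransition _),
    abs_of_nonneg (Real.smoothTransition.nonneg (2 - r / k)),
    abs_of_nonneg (Real.smoothTransition.nonneg (k * r - 1))]
  have c1 := mul_le_mul b1 (Real.smoothTransition.le_one (2 - r / k))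
    (Real.smoothTransition.nonneg _) (by positivity)
  have c2 := mul_le_mul (Real.smoothTransition.le_one (k * r - 1)) b2
    (abs_nonneg _) zero_le_one
  have c3 : 4 * C / r = 2 * C / r * 1 + 1 * (2 * C / r) := by ring
  rw [c3]
  exact add_le_add c1 c2

/-- If `B / r` and `B'` are integrable on the half-line, then the integral of `B'` vanishes. -/
theorem HasWeakDeriv.integral_eq_zero {B B' : ℝ → ℂ} (h : HasWeakDeriv B B')
    (h1 : IntegrableOn (fun r => B r / r) (Ioi 0)) (h2 : IntegrableOn B' (Ioi 0)) :
    ∫ r in Ioi (0 : ℝ), B' r = 0 := by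
  obtain ⟨C, hC⟩ := exists_bound_deriv_cutoff
  have hpos : ∀ᵐ r : ℝ ∂volume.restrict (Ioi 0), 0 < r :=
    (ae_restrict_iff' measurableSet_Ioi).2 (Eventually.of_forall fun _ h => h)
  have hB : AEStronglyMeasurable B (volume.restrict (Ioi 0)) := h.1.aestronglyMeasurable
  have t1 : Tendsto (fun n : ℕ => ∫ r in Ioi (0 : ℝ), cutoff (n : ℝ) r • B' r) atTop
      (𝓝 (∫ r in Ioi (0 : ℝ), B' r)) := by
    refine tendsto_integral_of_dominated_convergence (fun r => ‖B' r‖) (fun n => ?_) h2.norm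
      (fun n => ?_) ?_
    · exact (contDiff_cutoff _).continuous.aestronglyMeasurable.smul h2.aestronglyMeasurable
    · refine Eventually.of_forall fun r => ?_
      rw [norm_smul, Real.norm_eq_abs, abs_of_nonneg (cutoff_nonneg _ _)]
      exact mul_le_of_le_one_left (norm_nonneg _) (cutoff_le_one _ _)
    · filter_upwards [hpos] with r hr
      refine tendsto_const_nhds.congr' ?_
      filter_upwards [tendsto_natCast_atTop_atTop.eventually (cutoff_eventually_eq_one hr)]
        with n hn
      rw [hn.eq_of_nhds, one_smul]
  -- No boundary term survives at the origin or at infinity: the derivative of the cutoff is at most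
  -- `C / r`, so `C ‖B / r‖` dominates, and it tends to zero pointwise.
  have t2 : Tendsto (fun n : ℕ => ∫ r in Ioi (0 : ℝ), deriv (cutoff (n : ℝ)) r • B r) atTop
      (𝓝 (∫ _ in Ioi (0 : ℝ), (0 : ℂ))) := by
    refine tendsto_integral_filter_of_dominated_convergence (fun r => C * ‖B r / r‖) ?_ ?_
      (h1.norm.const_mul C) ?_
    · exact Eventually.of_forall fun n =>
        ((contDiff_cutoff _).continuous_deriv (by simp)).aestronglyMeasurable.smul hB
    · filter_upwards [eventually_gt_atTop 0] with n hn
      filter_upwards [hpos] with r hr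
      rw [norm_smul, Real.norm_eq_abs, norm_div, Complex.norm_real, Real.norm_eq_abs,
        abs_of_pos hr]
      have := hC n (by exact_mod_cast hn) r hr
      calc _ ≤ C / r * ‖B r‖ := by gcongr
        _ = _ := by ring
    · filter_upwards [hpos] with r hr
      refine tendsto_const_nhds.congr' ?_
      filter_upwards [tendsto_natCast_atTop_atTop.eventually (cutoff_eventually_eq_one hr)]
        with n hn
      rw [hn.deriv_eq, deriv_const, zero_smul]
  rw [integral_zero] at t2
  have t3 : (fun n : ℕ => ∫ r in Ioi (0 : ℝ), deriv (cutoff (n : ℝ)) r • B r) =ᶠ[atTop]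
      fun n : ℕ => -∫ r in Ioi (0 : ℝ), cutoff (n : ℝ) r • B' r := by
    filter_upwards [eventually_gt_atTop 0] with n hn
    have hn' : (0 : ℝ) < n := by exact_mod_cast hn
    exact h.2.2 _ (contDiff_cutoff _)
      (HasCompactSupport.of_support_subset_isCompact isCompact_Icc
        ((subset_tsupport _).trans (support_cutoff hn')))
      ((support_cutoff hn').trans fun r hr => lt_of_lt_of_le (by positivity) hr.1)
  have t4 := tendsto_nhds_unique (t2.congr' t3) t1.neg
  exact (neg_eq_zero.1 t4.symm)

end WeakDeriv

/-! ### Rapidly decaying functions and Gaussian monomials. -/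

section Decay

/-- Continuous functions that decay at infinity faster than `r ^ (-k) e^{-r}` for every `k`. -/
structure RapidDecay (f : ℝ → ℝ) : Prop where
  continuous : Continuous f
  isBigO : ∀ k : ℕ, (fun r => r ^ k * f r) =O[atTop] fun r => Real.exp (-r)

theorem RapidDecay.add {f g : ℝ → ℝ} (hf : RapidDecay f) (hg : RapidDecay g) :
    RapidDecay (fun r => f r + g r) :=
  ⟨hf.1.add hg.1, fun k => by simpa only [mul_add] using (hf.2 k).add (hg.2 k)⟩

theorem RapidDecay.const_mul {f : ℝ → ℝ} (hf : RapidDecay f) (c : ℝ) :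
    RapidDecay (fun r => c * f r) :=
  ⟨continuous_const.mul hf.1, fun k => by
    simpa only [mul_left_comm] using (hf.2 k).const_mul_left c⟩

theorem RapidDecay.neg {f : ℝ → ℝ} (hf : RapidDecay f) : RapidDecay (fun r => -f r) := by
  simpa using hf.const_mul (-1)

theorem RapidDecay.sub {f g : ℝ → ℝ} (hf : RapidDecay f) (hg : RapidDecay g) :
    RapidDecay (fun r => f r - g r) := by
  simpa only [sub_eq_add_neg] using hf.add hg.neg

theorem RapidDecay.zero : RapidDecay (fun _ => 0) :=
  ⟨continuous_const, fun k => by simpa using isBigO_zero _ _⟩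

theorem RapidDecay.pow_mul {f : ℝ → ℝ} (hf : RapidDecay f) (n : ℕ) :
    RapidDecay (fun r => r ^ n * f r) :=
  ⟨(continuous_pow n).mul hf.1, fun k => by
    simpa only [← mul_assoc, ← pow_add] using hf.2 (k + n)⟩

theorem RapidDecay.id_mul {f : ℝ → ℝ} (hf : RapidDecay f) : RapidDecay (fun r => r * f r) := by
  simpa using hf.pow_mul 1

theorem RapidDecay.mul {f g : ℝ → ℝ} (hf : RapidDecay f) (hg : RapidDecay g) :
    RapidDecay (fun r => f r * g r) := by
  refine ⟨hf.1.mul hg.1, fun k => ?_⟩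
  have h1 : g =O[atTop] fun _ => (1 : ℝ) := by
    have h2 : g =O[atTop] fun r => Real.exp (-r) := by simpa using hg.2 0
    refine h2.trans (IsBigO.of_bound 1 ?_)
    filter_upwards [eventually_ge_atTop 0] with r hr
    rw [Real.norm_eq_abs, Real.abs_exp, norm_one, one_mul, Real.exp_le_one_iff]
    linarith
  simpa only [mul_assoc, mul_one] using (hf.2 k).mul h1

theorem RapidDecay.integrableOn {f : ℝ → ℝ} (hf : RapidDecay f) : IntegrableOn f (Ioi 0) :=
  integrable_of_isBigO_exp_neg one_pos hf.1.continuousOn (by simpa using hf.2 0)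

theorem RapidDecay.tendsto {f : ℝ → ℝ} (hf : RapidDecay f) : Tendsto f atTop (𝓝 0) := by
  have h : f =O[atTop] fun r => Real.exp (-r) := by simpa using hf.2 0
  exact h.trans_tendsto (Real.tendsto_exp_neg_atTop_nhds_zero)

/-- The function `r ^ j e^{-r²/2}`. -/
def gaussMono (j : ℕ) (r : ℝ) : ℝ := r ^ j * Real.exp (-r ^ 2 / 2)

theorem rapidDecay_gaussMono (j : ℕ) : RapidDecay (gaussMono j) := by
  refine ⟨by unfold gaussMono; fun_prop, fun k => ?_⟩
  have h1 : (fun r : ℝ => r ^ (k + j)) =O[atTop] fun r => Real.exp r :=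
    (Real.isLittleO_pow_exp_atTop (n := k + j)).isBigO
  have h2 : (fun r : ℝ => Real.exp (-r ^ 2 / 2)) =O[atTop] fun r => Real.exp (-2 * r) := by
    refine IsBigO.of_bound 1 ?_
    filter_upwards [eventually_ge_atTop 4] with r hr
    rw [Real.norm_eq_abs, Real.abs_exp, Real.norm_eq_abs, Real.abs_exp, one_mul, Real.exp_le_exp]
    nlinarith
  have h3 := h1.mul h2
  have e1 : (fun r : ℝ => Real.exp r * Real.exp (-2 * r)) = fun r => Real.exp (-r) := by
    funext r; rw [← Real.exp_add]; ring_nf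
  rw [e1] at h3
  refine h3.congr_left fun r => ?_
  rw [gaussMono, pow_add]; ring

theorem gaussMono_add (j k : ℕ) (r : ℝ) : gaussMono (j + k) r = r ^ k * gaussMono j r := by
  rw [gaussMono, gaussMono, pow_add]; ring

theorem contDiff_gaussMono (j : ℕ) : ContDiff ℝ (⊤ : ℕ∞) (gaussMono j) := by
  unfold gaussMono; fun_prop

theorem hasDerivAt_gaussMono (j : ℕ) (r : ℝ) :
    HasDerivAt (gaussMono j) (j * gaussMono (j - 1) r - gaussMono (j + 1) r) r := by
  have h1 : HasDerivAt (fun r : ℝ => Real.exp (-r ^ 2 / 2)) (Real.exp (-r ^ 2 / 2) * -r) r := by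
    have : HasDerivAt (fun r : ℝ => -r ^ 2 / 2) (-r) r := by
      refine (((hasDerivAt_pow 2 r).neg).div_const 2).congr_deriv ?_
      simp
      ring
    exact this.exp
  refine ((hasDerivAt_pow j r).mul h1).congr_deriv ?_
  simp only [gaussMono, pow_succ]
  ring

end Decay

/-! ### Smooth radial profiles and the energy estimate. -/

section Profile

/-- Rapidly decaying real functions `u`, `w = u'`, `d = u''`, `y = m u / r`, `x = y'` and
`A = u' / r - m² u / r²`, regular at the origin. -/
structure IsProfile (m : ℝ) (u w d y x A : ℝ → ℝ) : Prop where
  decay_u : RapidDecay u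
  decay_w : RapidDecay w
  decay_d : RapidDecay d
  decay_y : RapidDecay y
  decay_x : RapidDecay x
  decay_A : RapidDecay A
  deriv_u : ∀ r, HasDerivAt u (w r) r
  deriv_w : ∀ r, HasDerivAt w (d r) r
  deriv_y : ∀ r, HasDerivAt y (x r) r
  mul_y : ∀ r, r * y r = m * u r
  mul_x : ∀ r, r * x r = m * w r - y r
  mul_A : ∀ r, r * A r = w r - m * y r
  y_zero : y 0 = m * w 0
  w_zero : (m ^ 2 - 1) * w 0 = 0

variable {m : ℝ} {u w d y x A : ℝ → ℝ}

theorem IsProfile.zero (m : ℝ) : IsProfile m (fun _ => 0) (fun _ => 0) (fun _ => 0) (fun _ => 0)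
    (fun _ => 0) (fun _ => 0) := by
  constructor <;> first | exact RapidDecay.zero | (intro r; exact hasDerivAt_const r 0) | simp

theorem IsProfile.add {u' w' d' y' x' A' : ℝ → ℝ} (h : IsProfile m u w d y x A)
    (h' : IsProfile m u' w' d' y' x' A') :
    IsProfile m (fun r => u r + u' r) (fun r => w r + w' r) (fun r => d r + d' r)
      (fun r => y r + y' r) (fun r => x r + x' r) (fun r => A r + A' r) where
  decay_u := h.decay_u.add h'.decay_u
  decay_w := h.decay_w.add h'.decay_w
  decay_d := h.decay_d.add h'.decay_d
  decay_y := h.decay_y.add h'.decay_y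
  decay_x := h.decay_x.add h'.decay_x
  decay_A := h.decay_A.add h'.decay_A
  deriv_u r := (h.deriv_u r).add (h'.deriv_u r)
  deriv_w r := (h.deriv_w r).add (h'.deriv_w r)
  deriv_y r := (h.deriv_y r).add (h'.deriv_y r)
  mul_y r := by linear_combination h.mul_y r + h'.mul_y r
  mul_x r := by linear_combination h.mul_x r + h'.mul_x r
  mul_A r := by linear_combination h.mul_A r + h'.mul_A r
  y_zero := by linear_combination h.y_zero + h'.y_zero
  w_zero := by linear_combination h.w_zero + h'.w_zero

theorem IsProfile.const_mul (h : IsProfile m u w d y x A) (c : ℝ) :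
    IsProfile m (fun r => c * u r) (fun r => c * w r) (fun r => c * d r)
      (fun r => c * y r) (fun r => c * x r) (fun r => c * A r) where
  decay_u := h.decay_u.const_mul c
  decay_w := h.decay_w.const_mul c
  decay_d := h.decay_d.const_mul c
  decay_y := h.decay_y.const_mul c
  decay_x := h.decay_x.const_mul c
  decay_A := h.decay_A.const_mul c
  deriv_u r := (h.deriv_u r).const_mul c
  deriv_w r := (h.deriv_w r).const_mul c
  deriv_y r := (h.deriv_y r).const_mul c
  mul_y r := by linear_combination c * h.mul_y r
  mul_x r := by linear_combination c * h.mul_x r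
  mul_A r := by linear_combination c * h.mul_A r
  y_zero := by linear_combination c * h.y_zero
  w_zero := by linear_combination c * h.w_zero

/-- The energy estimate, obtained from integrations by parts. -/
theorem IsProfile.energy (h : IsProfile m u w d y x A) :
    ∫ r in Ioi (0 : ℝ), r * (u r ^ 2 + w r ^ 2 + y r ^ 2 + d r ^ 2 + 2 * x r ^ 2 + A r ^ 2
      + (r ^ 2 * u r) ^ 2) ≤
    3 * ∫ r in Ioi (0 : ℝ), r * (-d r - A r + r ^ 2 * u r) ^ 2 := by
  -- A combination of boundary terms whose derivative turns the difference of the two sides into a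
  -- sum of squares. Its last bracket expresses that the squared Hessian and the squared Laplacian
  -- have equal integrals: `r ((d + A)² - d² - 2x² - A²)` is minus the derivative of `2 m y w - w² -
  -- y²`.
  set F : ℝ → ℝ := fun r => 7 * (r * (u r * w r)) + 4 * (r ^ 2 * (u r * u r))
    + 2 * (r ^ 3 * (u r * w r)) + (2 * m * (y r * w r) - w r * w r - y r * y r) with hF
  set F' : ℝ → ℝ := fun r => 7 * (u r * w r + r * (w r * w r + u r * d r))
    + 4 * (2 * (r * (u r * u r)) + 2 * (r ^ 2 * (u r * w r)))
    + 2 * (3 * (r ^ 2 * (u r * w r)) + r ^ 3 * (w r * w r + u r * d r))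
    + (2 * m * (x r * w r + y r * d r) - 2 * (w r * d r) - 2 * (y r * x r)) with hF'
  have hderiv : ∀ r, HasDerivAt F (F' r) r := by
    intro r
    have h1 := (h.deriv_u r).mul (h.deriv_w r)
    have h2 := (h.deriv_u r).mul (h.deriv_u r)
    have h3 := (h.deriv_y r).mul (h.deriv_w r)
    have h4 := (h.deriv_w r).mul (h.deriv_w r)
    have h5 := (h.deriv_y r).mul (h.deriv_y r)
    refine ((((((hasDerivAt_id r).mul h1).const_mul 7).add
      (((hasDerivAt_pow 2 r).mul h2).const_mul 4)).add
      (((hasDerivAt_pow 3 r).mul h1).const_mul 2)).add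
      (((h3.const_mul (2 * m)).sub h4).sub h5)).congr_deriv ?_
    simp only [hF', Pi.mul_apply, id]
    push_cast
    ring
  have dF' : RapidDecay F' := by
    have uw := h.decay_u.mul h.decay_w
    have uu := h.decay_u.mul h.decay_u
    have s := (h.decay_w.mul h.decay_w).add (h.decay_u.mul h.decay_d)
    exact ((((uw.add s.id_mul).const_mul 7).add
      (((uu.id_mul.const_mul 2).add ((uw.pow_mul 2).const_mul 2)).const_mul 4)).add
      ((((uw.pow_mul 2).const_mul 3).add (s.pow_mul 3)).const_mul 2)).add
      (((((h.decay_x.mul h.decay_w).add (h.decay_y.mul h.decay_d)).const_mul (2 * m)).sub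
        ((h.decay_w.mul h.decay_d).const_mul 2)).sub ((h.decay_y.mul h.decay_x).const_mul 2))
  have dF : RapidDecay F := by
    have uw := h.decay_u.mul h.decay_w
    have uu := h.decay_u.mul h.decay_u
    exact (((uw.id_mul.const_mul 7).add ((uu.pow_mul 2).const_mul 4)).add
      ((uw.pow_mul 3).const_mul 2)).add
      ((((h.decay_y.mul h.decay_w).const_mul (2 * m)).sub (h.decay_w.mul h.decay_w)).sub
        (h.decay_y.mul h.decay_y))
  -- With `y 0 = m w 0` the last bracket becomes `(m² - 1) (w 0)²`, which vanishes for a regular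
  -- profile: `w 0 = 0` unless `m² = 1`.
  have hF0 : F 0 = 0 := by
    simp only [hF, h.y_zero]
    linear_combination w 0 * h.w_zero
  have hint : ∫ r in Ioi (0 : ℝ), F' r = 0 := by
    rw [integral_Ioi_of_hasDerivAt_of_tendsto' (fun r _ => hderiv r) dF'.integrableOn dF.tendsto,
      hF0, sub_zero]
  have dt : RapidDecay fun r => r * (-d r - A r + r ^ 2 * u r) ^ 2 := by
    have := ((h.decay_d.neg.sub h.decay_A).add (h.decay_u.pow_mul 2))
    simpa only [sq] using (this.mul this).id_mul
  have dQ : RapidDecay fun r => r * (u r ^ 2 + w r ^ 2 + y r ^ 2 + d r ^ 2 + 2 * x r ^ 2 + A r ^ 2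
      + (r ^ 2 * u r) ^ 2) := by
    have s := h.decay_u.pow_mul 2
    have := (((((((h.decay_u.mul h.decay_u).add (h.decay_w.mul h.decay_w)).add
      (h.decay_y.mul h.decay_y)).add (h.decay_d.mul h.decay_d)).add
      ((h.decay_x.mul h.decay_x).const_mul 2)).add (h.decay_A.mul h.decay_A)).add
      (s.mul s)).id_mul
    simpa only [← sq] using this
  have hle : ∫ r in Ioi (0 : ℝ), r * (u r ^ 2 + w r ^ 2 + y r ^ 2 + d r ^ 2 + 2 * x r ^ 2
      + A r ^ 2 + (r ^ 2 * u r) ^ 2) ≤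
      ∫ r in Ioi (0 : ℝ), (3 * (r * (-d r - A r + r ^ 2 * u r) ^ 2) + F' r) := by
    refine setIntegral_mono_on dQ.integrableOn ((dt.const_mul 3).add dF').integrableOn
      measurableSet_Ioi fun r hr => ?_
    have hr0 : 0 < r := hr
    have ey : y r = m * u r / r := by rw [eq_div_iff hr0.ne']; linarith [h.mul_y r]
    have ex : x r = (m * w r - y r) / r := by rw [eq_div_iff hr0.ne']; linarith [h.mul_x r]
    have eA : A r = (w r - m * y r) / r := by rw [eq_div_iff hr0.ne']; linarith [h.mul_A r]
    rw [← sub_nonneg]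
    have key : 3 * (r * (-d r - A r + r ^ 2 * u r) ^ 2) + F' r - r * (u r ^ 2 + w r ^ 2 + y r ^ 2
        + d r ^ 2 + 2 * x r ^ 2 + A r ^ 2 + (r ^ 2 * u r) ^ 2) =
        r * (1 / 4 * (-d r - A r + r ^ 2 * u r) ^ 2 + ((-d r - A r + r ^ 2 * u r) / 2 - u r) ^ 2
          + r ^ 2 * u r ^ 2 + 2 * r ^ 2 * (w r ^ 2 + y r ^ 2)
          + 3 / 2 * ((-d r - A r + r ^ 2 * u r - 2 * u r) ^ 2
            + 4 * ((w r + r * u r) ^ 2 + y r ^ 2))) := by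
      simp only [hF', ex, eA, ey]
      field_simp
      ring
    rw [key]
    positivity
  rw [integral_add (dt.const_mul 3).integrableOn dF'.integrableOn, hint, add_zero,
    integral_const_mul] at hle
  exact hle

/-- The monomial profiles. -/
theorem isProfile_gaussMono (m : ℤ) {j k : ℕ} (hj : j = m.natAbs + 2 * k) :
    IsProfile m (gaussMono j) (fun r => j * gaussMono (j - 1) r - gaussMono (j + 1) r)
      (fun r => j * (j - 1) * gaussMono (j - 2) r - (2 * j + 1) * gaussMono j r
        + gaussMono (j + 2) r)
      (fun r => m * gaussMono (j - 1) r)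
      (fun r => m * ((j - 1) * gaussMono (j - 2) r - gaussMono j r))
      (fun r => (j - (m : ℝ) ^ 2) * gaussMono (j - 2) r - gaussMono j r) := by
  have h0 : j = 0 → m = 0 := by omega
  have h1 : j = 1 → (m : ℝ) ^ 2 = 1 := by
    intro h
    have : m.natAbs = 1 := by omega
    rcases Int.natAbs_eq_iff.1 this with h | h <;> simp [h]
  have D := rapidDecay_gaussMono
  have hd : ∀ i r, HasDerivAt (gaussMono i) (i * gaussMono (i - 1) r - gaussMono (i + 1) r) r :=
    hasDerivAt_gaussMono
  -- Truncated subtraction in `j - 1` and `j - 2` makes `j = 0` and `j = 1` special. There `m = 0`,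
  -- respectively `m² = 1`, and the coefficients of the would-be negative powers vanish.
  rcases j with _ | _ | j
  · obtain rfl := h0 rfl
    constructor
    · exact D 0
    · exact ((D _).const_mul _).sub (D _)
    · exact (((D _).const_mul _).sub ((D _).const_mul _)).add (D _)
    · exact (D _).const_mul _
    · exact (((D _).const_mul _).sub (D _)).const_mul _
    · exact ((D _).const_mul _).sub (D _)
    · exact hd 0
    · intro r
      refine (((hd 0 r).const_mul _).sub (hd 1 r)).congr_deriv ?_
      simp; ring
    all_goals first | (intro r; simp [gaussMono]; done) | skip
    · intro r; simpa using hasDerivAt_const r (0 : ℝ)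
    · simp
    · simp [gaussMono]
  · have hm := h1 rfl
    constructor
    · exact D 1
    · exact ((D _).const_mul _).sub (D _)
    · exact (((D _).const_mul _).sub ((D _).const_mul _)).add (D _)
    · exact (D _).const_mul _
    · exact (((D _).const_mul _).sub (D _)).const_mul _
    · exact ((D _).const_mul _).sub (D _)
    · exact hd 1
    · intro r
      refine (((hd 0 r).const_mul _).sub (hd 2 r)).congr_deriv ?_
      simp; ring
    · intro r
      refine ((hd 0 r).const_mul _).congr_deriv ?_
      simp
    · intro r; simp [gaussMono]; ring
    · intro r; simp [gaussMono]; ring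
    · intro r; simp [gaussMono, hm]; linear_combination (Real.exp (-r ^ 2 / 2)) * hm
    · simp [gaussMono]
    · simp [gaussMono, hm]
  · simp only [show j + 1 + 1 - 1 = j + 1 from rfl,
      show j + 1 + 1 - 2 = j from rfl]
    have e1 : ∀ r, gaussMono (j + 1) r = r * gaussMono j r := fun r => by
      simpa using gaussMono_add j 1 r
    have e2 : ∀ r, gaussMono (j + 1 + 1) r = r ^ 2 * gaussMono j r := fun r => gaussMono_add j 2 r
    have e3 : ∀ r, gaussMono (j + 1 + 1 + 1) r = r ^ 3 * gaussMono j r :=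
      fun r => gaussMono_add j 3 r
    have e4 : ∀ r, gaussMono (j + 1 + 1 + 1 + 1) r = r ^ 4 * gaussMono j r :=
      fun r => gaussMono_add j 4 r
    constructor
    · exact D _
    · exact ((D _).const_mul _).sub (D _)
    · exact (((D _).const_mul _).sub ((D _).const_mul _)).add (D _)
    · exact (D _).const_mul _
    · exact (((D _).const_mul _).sub (D _)).const_mul _
    · exact ((D _).const_mul _).sub (D _)
    · intro r; exact hd (j + 1 + 1) r
    · intro r
      refine (((hd (j + 1) r).const_mul _).sub (hd (j + 1 + 1 + 1) r)).congr_deriv ?_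
      simp only [Nat.add_sub_cancel, e2, e4]
      push_cast
      ring
    · intro r
      refine ((hd (j + 1) r).const_mul _).congr_deriv ?_
      simp only [Nat.add_sub_cancel, e2]
      push_cast
      ring
    · intro r; simp only [e1, e2]; ring
    · intro r; simp only [e1, e2, e3]; push_cast; ring
    · intro r; simp only [e1, e2, e3]; push_cast; ring
    · simp [e1, e3]
    · simp [e1, e3]

end Profile

/-! ### Closed conditions in `L²_r`. -/

section L2

theorem norm_sq_L2r (V : L2r) : ‖V‖ ^ 2 = ∫ r, ‖V r‖ ^ 2 ∂radialMeasure := by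
  have h1 : ((‖V‖ ^ 2 : ℝ) : ℂ) = ∫ r, ((‖V r‖ ^ 2 : ℝ) : ℂ) ∂radialMeasure := by
    have h2 := inner_self_eq_norm_sq_to_K (𝕜 := ℂ) V
    rw [L2.inner_def] at h2
    rw [Complex.ofReal_pow]
    refine h2.symm.trans (integral_congr_ae (Eventually.of_forall fun r => ?_))
    simp only [inner_self_eq_norm_sq_to_K]
    simp
  rw [integral_complex_ofReal] at h1
  exact_mod_cast h1

theorem l2rNorm_congr {u v : ℝ → ℂ} (h : u =ᵐ[radialMeasure] v) : l2rNorm u = l2rNorm v := by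
  rw [l2rNorm, l2rNorm, eLpNorm_congr_ae h]

theorem l2rNorm_coe (V : L2r) : l2rNorm V = ‖V‖ := (Lp.norm_def V).symm

theorem RapidDecay.memLp {f : ℝ → ℝ} (hf : RapidDecay f) :
    MemLp (fun r => (f r : ℂ)) 2 radialMeasure := by
  have h : AEStronglyMeasurable (fun r => (f r : ℂ)) radialMeasure :=
    (Complex.continuous_ofReal.comp hf.continuous).aestronglyMeasurable
  rw [memLp_two_iff_integrable_sq_norm h, integrable_radialMeasure_iff]
  simpa [sq] using (hf.mul hf).id_mul.integrableOn

/-- The element of `L²_r` defined by a rapidly decaying function. -/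
def RapidDecay.toL2 {f : ℝ → ℝ} (hf : RapidDecay f) : L2r := hf.memLp.toLp _

theorem RapidDecay.coe_toL2 {f : ℝ → ℝ} (hf : RapidDecay f) :
    hf.toL2 =ᵐ[radialMeasure] fun r => (f r : ℂ) := hf.memLp.coeFn_toLp

theorem inner_eq_of_ae_real {g : ℝ → ℝ} {G : L2r} (hG : G =ᵐ[radialMeasure] fun r => (g r : ℂ))
    (V : L2r) : (inner ℂ G V : ℂ) = ∫ r in Ioi (0 : ℝ), (r * g r : ℂ) * V r := by
  rw [L2.inner_def]
  have h1 : ∫ r, (inner ℂ (G r) (V r) : ℂ) ∂radialMeasure =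
      ∫ r, (g r : ℂ) * V r ∂radialMeasure := by
    refine integral_congr_ae ?_
    filter_upwards [hG] with r hr
    rw [hr, RCLike.inner_apply, Complex.conj_ofReal, mul_comm]
  rw [h1, integral_radialMeasure]
  refine integral_congr_ae (Eventually.of_forall fun r => ?_)
  simp [mul_assoc]

theorem norm_sq_of_ae {P : L2r} {f g : ℝ → ℝ}
    (h : P =ᵐ[radialMeasure] fun r => (f r : ℂ) + Complex.I * g r) :
    ‖P‖ ^ 2 = ∫ r in Ioi (0 : ℝ), r * (f r ^ 2 + g r ^ 2) := by
  rw [norm_sq_L2r, ← integral_congr_ae (f := fun r => f r ^ 2 + g r ^ 2), integral_radialMeasure]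
  · rfl
  · filter_upwards [h] with r hr
    rw [hr, ← Complex.normSq_eq_norm_sq, Complex.normSq_apply]
    simp
    ring

/-- Since `φ` vanishes near the origin, `φ / r` is in `L²_r`, and the integral is the inner product
with it. -/
theorem continuous_setIntegral_smul {φ : ℝ → ℝ} (h1 : Continuous φ) (h2 : HasCompactSupport φ)
    (h3 : tsupport φ ⊆ Ioi 0) :
    Continuous fun f : L2r => ∫ r in Ioi (0 : ℝ), φ r • f r := by
  set h : ℝ → ℂ := fun r => ((φ r / r : ℝ) : ℂ) with hh
  have hsupp : tsupport (fun r => φ r / r) ⊆ tsupport φ := by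
    simp only [div_eq_mul_inv]; exact tsupport_mul_subset_left
  have hc0 : Continuous fun r => φ r / r := by
    refine ContinuousOn.continuous_of_tsupport_subset (s := Ioi 0) ?_ isOpen_Ioi (hsupp.trans h3)
    exact h1.continuousOn.div continuousOn_id fun r hr => ne_of_gt hr
  have hcs : HasCompactSupport fun r => φ r / r := by
    simp only [div_eq_mul_inv]; exact h2.mul_right
  have hm : MemLp h 2 radialMeasure :=
    (Complex.continuous_ofReal.comp hc0).memLp_of_hasCompactSupport
      (hcs.comp_left Complex.ofReal_zero)
  have key : ∀ f : L2r, ∫ r in Ioi (0 : ℝ), φ r • f r = inner ℂ (hm.toLp h) f := by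
    intro f
    rw [inner_eq_of_ae_real (g := fun r => φ r / r) hm.coeFn_toLp]
    refine setIntegral_congr_fun measurableSet_Ioi fun r hr => ?_
    have hr' : (r : ℂ) ≠ 0 := by exact_mod_cast (ne_of_gt hr)
    change φ r • f r = (r * ((φ r / r : ℝ) : ℂ)) * f r
    rw [Complex.real_smul]
    push_cast
    rw [mul_div_cancel₀ _ hr']
  simp only [key]
  fun_prop

/-- Local integrability is automatic in `L²_r`; what remains is a family of equations between
continuous functionals. -/
theorem isClosed_hasWeakDeriv : IsClosed {p : L2r × L2r | HasWeakDeriv p.1 p.2} := by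
  have : {p : L2r × L2r | HasWeakDeriv p.1 p.2} =
      ⋂ (φ : ℝ → ℝ) (_ : ContDiff ℝ (⊤ : ℕ∞) φ) (_ : HasCompactSupport φ)
        (_ : tsupport φ ⊆ Ioi 0), {p : L2r × L2r | ∫ r in Ioi (0 : ℝ), deriv φ r • p.1 r =
          -∫ r in Ioi (0 : ℝ), φ r • p.2 r} := by
    ext p
    simp only [mem_iInter]
    exact ⟨fun h => h.2.2, fun h => ⟨locallyIntegrableOn_of_memLp (Lp.memLp p.1),
      locallyIntegrableOn_of_memLp (Lp.memLp p.2), h⟩⟩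
  rw [this]
  refine isClosed_iInter fun φ => isClosed_iInter fun h1 => isClosed_iInter fun h2 =>
    isClosed_iInter fun h3 => ?_
  obtain ⟨d1, d2, d3⟩ := deriv_test h1 h2 h3
  exact isClosed_eq ((continuous_setIntegral_smul d1 d2 d3).comp continuous_fst)
    ((continuous_setIntegral_smul h1.continuous h2 h3).comp continuous_snd).neg

theorem isClosed_pow_mul_ae (k : ℕ) :
    IsClosed {p : L2r × L2r | ∀ᵐ r : ℝ ∂radialMeasure, (r : ℂ) ^ k * p.1 r = p.2 r} := by
  have hloc : ∀ p : L2r × L2r, LocallyIntegrableOn (fun r : ℝ => (r : ℂ) ^ k * p.1 r) (Ioi 0) :=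
    fun p => (locallyIntegrableOn_of_memLp (Lp.memLp p.1)).continuousOn_mul
      (Complex.continuous_ofReal.pow k).continuousOn isOpen_Ioi.isLocallyClosed
  have hloc2 : ∀ p : L2r × L2r, LocallyIntegrableOn p.2 (Ioi 0) :=
    fun p => locallyIntegrableOn_of_memLp (Lp.memLp p.2)
  have e : ∀ (φ : ℝ → ℝ) (f : ℝ → ℂ), ∫ r : ℝ in Ioi (0 : ℝ), φ r • ((r : ℂ) ^ k * f r) =
      ∫ r in Ioi (0 : ℝ), (φ r * r ^ k) • f r := by
    intro φ f
    refine integral_congr_ae (Eventually.of_forall fun r => ?_)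
    simp only [Complex.real_smul]
    push_cast
    ring
  have : {p : L2r × L2r | ∀ᵐ r : ℝ ∂radialMeasure, (r : ℂ) ^ k * p.1 r = p.2 r} =
      ⋂ (φ : ℝ → ℝ) (_ : ContDiff ℝ (⊤ : ℕ∞) φ) (_ : HasCompactSupport φ)
        (_ : tsupport φ ⊆ Ioi 0), {p : L2r × L2r | ∫ r in Ioi (0 : ℝ), (φ r * r ^ k) • p.1 r =
          ∫ r in Ioi (0 : ℝ), φ r • p.2 r} := by
    ext p
    simp only [mem_iInter]
    constructor
    · intro h φ h1 h2 h3
      refine (e φ p.1).symm.trans (integral_congr_ae ?_)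
      filter_upwards [ac_radialMeasure.ae_le h] with r hr
      rw [hr]
    · intro h
      refine ae_radialMeasure_iff.2 ?_
      have h0 := isOpen_Ioi.ae_eq_zero_of_integral_contDiff_smul_eq_zero
        ((hloc p).sub (hloc2 p)) ?_
      · filter_upwards [h0] with r hr hr0
        exact sub_eq_zero.1 (hr hr0)
      · intro φ h1 h2 h3
        rw [← integral_eq_setIntegral_of_tsupport h3]
        simp only [Pi.sub_apply, smul_sub]
        rw [integral_sub (integrableOn_test_smul h1.continuous h2 h3 (hloc p))
          (integrableOn_test_smul h1.continuous h2 h3 (hloc2 p)), e, sub_eq_zero]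
        exact h φ h1 h2 h3
  rw [this]
  refine isClosed_iInter fun φ => isClosed_iInter fun h1 => isClosed_iInter fun h2 =>
    isClosed_iInter fun h3 => ?_
  exact isClosed_eq ((continuous_setIntegral_smul (h1.continuous.mul (continuous_pow k))
      h2.mul_right ((tsupport_mul_subset_left).trans h3)).comp continuous_fst)
    ((continuous_setIntegral_smul h1.continuous h2 h3).comp continuous_snd)

end L2

/-! ### The closure of the smooth profiles, with all their derivatives, in seven copies of `L²_r`.
-/

section ProfileSpace

/-- The seven components of a profile: those of `IsProfile` and `r² u`. -/
def IsProfileVec (m : ℝ) (f : Fin 7 → ℝ → ℝ) : Prop :=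
  IsProfile m (f 0) (f 1) (f 2) (f 3) (f 4) (f 5) ∧ ∀ r, f 6 r = r ^ 2 * f 0 r

theorem IsProfileVec.add {m : ℝ} {f g : Fin 7 → ℝ → ℝ} (hf : IsProfileVec m f)
    (hg : IsProfileVec m g) : IsProfileVec m (fun i r => f i r + g i r) :=
  ⟨hf.1.add hg.1, fun r => by simp only [hf.2, hg.2, mul_add]⟩

theorem IsProfileVec.const_mul {m : ℝ} {f : Fin 7 → ℝ → ℝ} (hf : IsProfileVec m f) (c : ℝ) :
    IsProfileVec m (fun i r => c * f i r) :=
  ⟨hf.1.const_mul c, fun r => by simp only [hf.2, mul_left_comm]⟩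

theorem IsProfileVec.zero (m : ℝ) : IsProfileVec m (fun _ _ => 0) :=
  ⟨IsProfile.zero m, fun r => by simp⟩

theorem IsProfileVec.decay {m : ℝ} {f : Fin 7 → ℝ → ℝ} (hf : IsProfileVec m f) (i : Fin 7) :
    RapidDecay (f i) := by
  obtain ⟨h, h6⟩ := hf
  fin_cases i
  · exact h.decay_u
  · exact h.decay_w
  · exact h.decay_d
  · exact h.decay_y
  · exact h.decay_x
  · exact h.decay_A
  · have := h.decay_u.pow_mul 2
    rwa [← funext h6] at this

/-- The complex span of the profiles, in `(L²_r)⁷`. -/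
def profileSpace (m : ℝ) : Submodule ℂ (Fin 7 → L2r) where
  carrier := {P | ∃ f g, IsProfileVec m f ∧ IsProfileVec m g ∧
    ∀ i, P i =ᵐ[radialMeasure] fun r => (f i r : ℂ) + Complex.I * g i r}
  add_mem' := by
    rintro P Q ⟨f, g, hf, hg, hP⟩ ⟨f', g', hf', hg', hQ⟩
    refine ⟨_, _, hf.add hf', hg.add hg', fun i => ?_⟩
    filter_upwards [Lp.coeFn_add (P i) (Q i), hP i, hQ i] with r h1 h2 h3
    rw [Pi.add_apply, h1, Pi.add_apply, h2, h3]
    push_cast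
    ring
  zero_mem' := by
    refine ⟨_, _, IsProfileVec.zero m, IsProfileVec.zero m, fun i => ?_⟩
    filter_upwards [Lp.coeFn_zero ℂ 2 radialMeasure] with r hr
    rw [Pi.zero_apply, hr]
    simp
  smul_mem' := by
    rintro c P ⟨f, g, hf, hg, hP⟩
    refine ⟨_, _, (hf.const_mul c.re).add (hg.const_mul (-c.im)),
      (hf.const_mul c.im).add (hg.const_mul c.re), fun i => ?_⟩
    filter_upwards [Lp.coeFn_smul c (P i), hP i] with r h1 h2
    rw [Pi.smul_apply, h1, Pi.smul_apply, h2, smul_eq_mul]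
    conv_lhs => rw [← Complex.re_add_im c]
    push_cast
    linear_combination (c.im * g i r : ℂ) * Complex.I_sq

/-- The oscillator `-Δ_m + r²` in terms of the components of a profile. -/
def oscillator : (Fin 7 → L2r) →L[ℂ] L2r :=
  -ContinuousLinearMap.proj (R := ℂ) (φ := fun _ : Fin 7 => L2r) 2
    - ContinuousLinearMap.proj (R := ℂ) (φ := fun _ : Fin 7 => L2r) 5
    + ContinuousLinearMap.proj (R := ℂ) (φ := fun _ : Fin 7 => L2r) 6

theorem oscillator_apply (P : Fin 7 → L2r) : oscillator P = -P 2 - P 5 + P 6 := rfl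

theorem coeFn_oscillator (P : Fin 7 → L2r) :
    oscillator P =ᵐ[radialMeasure] fun r => -P 2 r - P 5 r + P 6 r := by
  rw [oscillator_apply]
  filter_upwards [Lp.coeFn_add (-P 2 - P 5) (P 6), Lp.coeFn_sub (-P 2) (P 5),
    Lp.coeFn_neg (P 2)] with r h1 h2 h3
  rw [h1, Pi.add_apply, h2, Pi.sub_apply, h3, Pi.neg_apply]

/-- Real and imaginary parts are profiles separately, and the real energy estimate is applied to
each. -/
theorem profileSpace_energy {m : ℝ} {P : Fin 7 → L2r} (hP : P ∈ profileSpace m) :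
    ‖P 0‖ ^ 2 + ‖P 1‖ ^ 2 + ‖P 3‖ ^ 2 + ‖P 2‖ ^ 2 + 2 * ‖P 4‖ ^ 2 + ‖P 5‖ ^ 2 + ‖P 6‖ ^ 2 ≤
      3 * ‖oscillator P‖ ^ 2 := by
  obtain ⟨f, g, hf, hg, h⟩ := hP
  have ht : oscillator P =ᵐ[radialMeasure] fun r =>
      ((-f 2 r - f 5 r + r ^ 2 * f 0 r : ℝ) : ℂ)
        + Complex.I * ((-g 2 r - g 5 r + r ^ 2 * g 0 r : ℝ) : ℂ) := by
    filter_upwards [coeFn_oscillator P, h 2, h 5, h 6] with r h1 h2 h3 h4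
    rw [h1, h2, h3, h4, hf.2, hg.2]
    push_cast
    ring
  have I1 : ∀ {f : Fin 7 → ℝ → ℝ}, IsProfileVec m f → ∀ i,
      IntegrableOn (fun r => r * f i r ^ 2) (Ioi 0) := fun hf i => by
    simpa only [sq] using ((hf.decay i).mul (hf.decay i)).id_mul.integrableOn
  have I2 : ∀ {f : Fin 7 → ℝ → ℝ}, IsProfileVec m f →
      IntegrableOn (fun r => r * (-f 2 r - f 5 r + r ^ 2 * f 0 r) ^ 2) (Ioi 0) := fun hf => by
    have := ((hf.decay 2).neg.sub (hf.decay 5)).add ((hf.decay 0).pow_mul 2)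
    simpa only [sq] using (this.mul this).id_mul.integrableOn
  have N : ∀ i, ‖P i‖ ^ 2 = (∫ r in Ioi (0 : ℝ), r * f i r ^ 2)
      + ∫ r in Ioi (0 : ℝ), r * g i r ^ 2 := by
    intro i
    rw [norm_sq_of_ae (h i), ← integral_add (I1 hf i) (I1 hg i)]
    simp only [mul_add]
  have NT : ‖oscillator P‖ ^ 2 =
      (∫ r in Ioi (0 : ℝ), r * (-f 2 r - f 5 r + r ^ 2 * f 0 r) ^ 2)
      + ∫ r in Ioi (0 : ℝ), r * (-g 2 r - g 5 r + r ^ 2 * g 0 r) ^ 2 := by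
    rw [norm_sq_of_ae ht, ← integral_add (I2 hf) (I2 hg)]
    simp only [mul_add]
  have E : ∀ {f : Fin 7 → ℝ → ℝ}, IsProfileVec m f →
      (∫ r in Ioi (0 : ℝ), r * f 0 r ^ 2) + (∫ r in Ioi (0 : ℝ), r * f 1 r ^ 2)
      + (∫ r in Ioi (0 : ℝ), r * f 3 r ^ 2) + (∫ r in Ioi (0 : ℝ), r * f 2 r ^ 2)
      + 2 * (∫ r in Ioi (0 : ℝ), r * f 4 r ^ 2) + (∫ r in Ioi (0 : ℝ), r * f 5 r ^ 2)
      + (∫ r in Ioi (0 : ℝ), r * f 6 r ^ 2) ≤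
      3 * ∫ r in Ioi (0 : ℝ), r * (-f 2 r - f 5 r + r ^ 2 * f 0 r) ^ 2 := by
    intro f hf
    refine le_of_eq_of_le ?_ hf.1.energy
    have J := I1 hf
    have e : ∀ r : ℝ, r * (f 0 r ^ 2 + f 1 r ^ 2 + f 3 r ^ 2 + f 2 r ^ 2 + 2 * f 4 r ^ 2
        + f 5 r ^ 2 + (r ^ 2 * f 0 r) ^ 2) = r * f 0 r ^ 2 + r * f 1 r ^ 2 + r * f 3 r ^ 2
        + r * f 2 r ^ 2 + 2 * (r * f 4 r ^ 2) + r * f 5 r ^ 2 + r * f 6 r ^ 2 := by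
      intro r; rw [hf.2]; ring
    have J2 := (J 0).add (J 1)
    have J3 := J2.add (J 3)
    have J4 := J3.add (J 2)
    have J5 := J4.add ((J 4).const_mul 2)
    simp only [e]
    rw [integral_add, integral_add, integral_add, integral_add, integral_add, integral_add,
      integral_const_mul]
    exacts [J 0, J 1, J2, J 3, J3, J 2, J4, (J 4).const_mul 2, J5, J 5, J5.add (J 5), J 6]
  rw [N, N, N, N, N, N, N, NT]
  linarith [E hf, E hg]

theorem hasWeakDeriv_of_real {f g f' g' : ℝ → ℝ} (hf : ∀ r, HasDerivAt f (f' r) r)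
    (hg : ∀ r, HasDerivAt g (g' r) r) (hf' : Continuous f') (hg' : Continuous g') :
    HasWeakDeriv (fun r => (f r : ℂ) + Complex.I * g r)
      (fun r => (f' r : ℂ) + Complex.I * g' r) := by
  refine hasWeakDeriv_of_hasDerivAt (fun r => ?_) (by fun_prop)
  exact (hf r).ofReal_comp.add ((hg r).ofReal_comp.const_mul Complex.I)

theorem coeFn_const_smul_sub (a b : ℂ) (U V : L2r) :
    ⇑(a • U - b • V) =ᵐ[radialMeasure] fun r => a * U r - b * V r := by
  filter_upwards [Lp.coeFn_sub (a • U) (b • V), Lp.coeFn_smul a U, Lp.coeFn_smul b V]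
    with r h1 h2 h3
  rw [h1, Pi.sub_apply, h2, h3]
  rfl

/-- The limits of profiles are in the domain of the oscillator, with the energy estimate. -/
theorem memH2_of_mem_closure {m : ℤ} {P : Fin 7 → L2r}
    (hP : P ∈ (profileSpace m).topologicalClosure) :
    MemH2 m (P 0) ∧ (∀ᵐ r : ℝ ∂radialMeasure,
      -radialLaplacian m (P 0) r + (r : ℂ) ^ 2 * P 0 r = oscillator P r) ∧
      h2NormSq m (P 0) ≤ 3 * ‖oscillator P‖ ^ 2 ∧
      weakDeriv (P 0) =ᵐ[radialMeasure] P 1 ∧ angularGrad m (P 0) =ᵐ[radialMeasure] P 3 := by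
  have hP' : P ∈ closure (profileSpace (m : ℝ) : Set (Fin 7 → L2r)) := hP
  have cl : ∀ S : Set (Fin 7 → L2r), IsClosed S → (∀ Q ∈ profileSpace (m : ℝ), Q ∈ S) → P ∈ S :=
    fun S hS h => closure_minimal h hS hP'
  have w1 : HasWeakDeriv (P 0) (P 1) := by
    refine cl {Q | HasWeakDeriv (Q 0) (Q 1)} (isClosed_hasWeakDeriv.preimage
      (f := fun Q : Fin 7 → L2r => (Q 0, Q 1)) (by fun_prop)) ?_
    rintro Q ⟨f, g, hf, hg, h⟩
    exact (hasWeakDeriv_of_real hf.1.deriv_u hg.1.deriv_u hf.1.decay_w.1 hg.1.decay_w.1).congr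
      (h 0).symm (h 1).symm
  have w2 : HasWeakDeriv (P 1) (P 2) := by
    refine cl {Q | HasWeakDeriv (Q 1) (Q 2)} (isClosed_hasWeakDeriv.preimage
      (f := fun Q : Fin 7 → L2r => (Q 1, Q 2)) (by fun_prop)) ?_
    rintro Q ⟨f, g, hf, hg, h⟩
    exact (hasWeakDeriv_of_real hf.1.deriv_w hg.1.deriv_w hf.1.decay_d.1 hg.1.decay_d.1).congr
      (h 1).symm (h 2).symm
  -- All pointwise relations between components have the form `r^k P_i = a P_{i₁} - b P_{i₂}`.
  -- Multiplying out the divisions by `r` makes them closed conditions, so they pass from profiles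
  -- to their limits.
  have aux : ∀ (k : ℕ) (i : Fin 7) (a b : ℂ) (i₁ i₂ : Fin 7),
      (∀ f, IsProfileVec m f → ∀ r : ℝ, (r : ℂ) ^ k * f i r = a * f i₁ r - b * f i₂ r) →
      ∀ᵐ r : ℝ ∂radialMeasure, (r : ℂ) ^ k * P i r = a * P i₁ r - b * P i₂ r := by
    intro k i a b i₁ i₂ hrel
    have h0 : P ∈ {Q : Fin 7 → L2r | ∀ᵐ r : ℝ ∂radialMeasure,
        (r : ℂ) ^ k * Q i r = (a • Q i₁ - b • Q i₂ : L2r) r} := by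
      refine cl _ ((isClosed_pow_mul_ae k).preimage
        (f := fun Q : Fin 7 → L2r => (Q i, a • Q i₁ - b • Q i₂)) (by fun_prop)) ?_
      rintro Q ⟨f, g, hf, hg, h⟩
      filter_upwards [h i, h i₁, h i₂, coeFn_const_smul_sub a b (Q i₁) (Q i₂)] with r e1 e2 e3 e4
      rw [e4, e1, e2, e3]
      linear_combination hrel f hf r + Complex.I * hrel g hg r
    filter_upwards [h0, coeFn_const_smul_sub a b (P i₁) (P i₂)] with r e1 e2
    rw [e1, e2]
  have ry := aux 1 3 m 0 0 0 (fun f hf r => by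
    rw [pow_one, zero_mul, sub_zero]; exact_mod_cast hf.1.mul_y r)
  have rx := aux 1 4 m 1 1 3 (fun f hf r => by
    rw [pow_one, one_mul]; exact_mod_cast hf.1.mul_x r)
  have rA := aux 1 5 1 m 1 3 (fun f hf r => by
    rw [pow_one, one_mul]; exact_mod_cast hf.1.mul_A r)
  have rs2 := aux 2 0 1 0 6 6 (fun f hf r => by
    rw [zero_mul, one_mul, sub_zero]; exact_mod_cast (hf.2 r).symm)
  have d1 : weakDeriv (P 0) =ᵐ[radialMeasure] P 1 := w1.weakDeriv_ae
  have d2 : weakDeriv (weakDeriv (P 0)) =ᵐ[radialMeasure] P 2 :=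
    (w2.congr d1.symm (ae_eq_refl _)).weakDeriv_ae
  have pos := ae_pos_radialMeasure
  have q3 : angularGrad m (P 0) =ᵐ[radialMeasure] P 3 := by
    filter_upwards [pos, ry] with r hr h1
    have hr' : (r : ℂ) ≠ 0 := by exact_mod_cast hr.ne'
    rw [angularGrad, div_eq_iff hr']
    linear_combination -h1
  have q4 : mixedHess m (P 0) =ᵐ[radialMeasure] P 4 := by
    filter_upwards [pos, ry, rx, d1] with r hr h1 h2 h3
    have hr' : (r : ℂ) ≠ 0 := by exact_mod_cast hr.ne'
    rw [mixedHess, h3]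
    field_simp
    linear_combination -(r : ℂ) * h2 + h1
  have q5 : angularHess m (P 0) =ᵐ[radialMeasure] P 5 := by
    filter_upwards [pos, ry, rA, d1] with r hr h1 h2 h3
    have hr' : (r : ℂ) ≠ 0 := by exact_mod_cast hr.ne'
    rw [angularHess, h3]
    field_simp
    linear_combination -(r : ℂ) * h2 + (m : ℂ) * h1
  have q6 : sqWeight (P 0) =ᵐ[radialMeasure] P 6 := by
    filter_upwards [rs2] with r h1
    rw [sqWeight, h1]
    ring
  refine ⟨⟨⟨P 1, P 2, w1, w2⟩, Lp.memLp _, (memLp_congr_ae d1).2 (Lp.memLp _),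
    (memLp_congr_ae q3).2 (Lp.memLp _), (memLp_congr_ae d2).2 (Lp.memLp _),
    (memLp_congr_ae q4).2 (Lp.memLp _), (memLp_congr_ae q5).2 (Lp.memLp _),
    (memLp_congr_ae q6).2 (Lp.memLp _)⟩, ?_, ?_, d1, q3⟩
  · filter_upwards [d2, q5, q6, coeFn_oscillator P] with r h2 h5 h6 h7
    have e5 : weakDeriv (P 0) r / r - (m : ℂ) ^ 2 * P 0 r / (r : ℂ) ^ 2 = P 5 r := h5
    have e6 : (r : ℂ) ^ 2 * P 0 r = P 6 r := h6
    rw [radialLaplacian, h7, h2, e6, ← e5]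
    ring
  · rw [h2NormSq, l2rNorm_congr d1, l2rNorm_congr q3, l2rNorm_congr d2, l2rNorm_congr q4,
      l2rNorm_congr q5, l2rNorm_congr q6]
    simp only [l2rNorm_coe]
    exact cl {Q | ‖Q 0‖ ^ 2 + ‖Q 1‖ ^ 2 + ‖Q 3‖ ^ 2 + ‖Q 2‖ ^ 2 + 2 * ‖Q 4‖ ^ 2 + ‖Q 5‖ ^ 2
      + ‖Q 6‖ ^ 2 ≤ 3 * ‖oscillator Q‖ ^ 2} (isClosed_le (by fun_prop) (by fun_prop))
      fun Q hQ => by rw [mem_ofPred_eq]; exact profileSpace_energy hQ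

/-- A sequence of profiles whose images under the oscillator converge is convergent. -/
theorem exists_limit_profile {m : ℤ} {P : ℕ → Fin 7 → L2r} (hP : ∀ n, P n ∈ profileSpace m)
    {V f : L2r} (hV : Tendsto (fun n => P n 0) atTop (𝓝 V))
    (hf : Tendsto (fun n => oscillator (P n)) atTop (𝓝 f)) :
    ∃ Q ∈ (profileSpace m).topologicalClosure, Q 0 = V ∧ oscillator Q = f := by
  -- The energy estimate controls every component by the oscillator alone, so convergence of the
  -- images forces convergence of the whole vector.
  have hbd : ∀ Q ∈ profileSpace (m : ℝ), ‖Q‖ ≤ 2 * ‖oscillator Q‖ := by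
    intro Q hQ
    refine (pi_norm_le_iff_of_nonneg (by positivity)).2 fun i => ?_
    have h1 := profileSpace_energy hQ
    have h2 : ‖Q i‖ ^ 2 ≤ 3 * ‖oscillator Q‖ ^ 2 := by
      have N := fun j => sq_nonneg ‖Q j‖
      fin_cases i <;> simp only [Fin.zero_eta, Fin.mk_one, Fin.reduceFinMk] <;>
      linarith [N 0, N 1, N 2, N 3, N 4, N 5, N 6]
    nlinarith [norm_nonneg (Q i), norm_nonneg (oscillator Q)]
  have hcau : CauchySeq P := by
    have hf' := hf.cauchySeq
    rw [Metric.cauchySeq_iff'] at hf' ⊢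
    intro ε hε
    obtain ⟨N, hN⟩ := hf' (ε / 2) (by positivity)
    refine ⟨N, fun n hn => ?_⟩
    have h1 := hbd _ ((profileSpace (m : ℝ)).sub_mem (hP n) (hP N))
    have h2 := hN n hn
    rw [dist_eq_norm] at h2 ⊢
    rw [map_sub] at h1
    linarith
  obtain ⟨Q, hQ⟩ := cauchySeq_tendsto_of_complete hcau
  have hQc : Q ∈ (profileSpace (m : ℝ)).topologicalClosure :=
    mem_closure_of_tendsto hQ (Eventually.of_forall hP)
  exact ⟨Q, hQc, tendsto_nhds_unique ((tendsto_pi_nhds.1 hQ) 0) hV,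
    tendsto_nhds_unique ((oscillator.continuous.tendsto Q).comp hQ) hf⟩

end ProfileSpace

/-! ### Completeness of the Gaussian monomials through a determinate moment problem. -/

section Completeness

open ProbabilityTheory in
/-- Finite measures with finite exponential moments near `0` and the same moments coincide. -/
theorem map_eq_of_moments {Ω : Type*} [MeasurableSpace Ω] {μ ν : Measure Ω} [IsFiniteMeasure μ]
    [IsFiniteMeasure ν] {X : Ω → ℝ} (hX : Measurable X) {a : ℝ} (ha : 0 < a)
    (hμ : ∀ t ∈ Ioo (-a) a, Integrable (fun ω => Real.exp (t * X ω)) μ)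
    (hν : ∀ t ∈ Ioo (-a) a, Integrable (fun ω => Real.exp (t * X ω)) ν)
    (h : ∀ n : ℕ, ∫ ω, X ω ^ n ∂μ = ∫ ω, X ω ^ n ∂ν) : μ.map X = ν.map X := by
  have iμ : Ioo (-a) a ⊆ interior (integrableExpSet X μ) :=
    interior_maximal hμ isOpen_Ioo
  have iν : Ioo (-a) a ⊆ interior (integrableExpSet X ν) :=
    interior_maximal hν isOpen_Ioo
  have h0 : (0 : ℝ) ∈ Ioo (-a) a := ⟨by linarith, ha⟩
  set S : Set ℂ := {z | z.re ∈ Ioo (-a) a} with hS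
  have aμ : AnalyticOnNhd ℂ (complexMGF X μ) S := fun z hz => analyticAt_complexMGF (iμ hz)
  have aν : AnalyticOnNhd ℂ (complexMGF X ν) S := fun z hz => analyticAt_complexMGF (iν hz)
  have hder : ∀ n, iteratedDeriv n (complexMGF X μ) 0 = iteratedDeriv n (complexMGF X ν) 0 := by
    intro n
    rw [iteratedDeriv_complexMGF (by simpa using iμ h0),
      iteratedDeriv_complexMGF (by simpa using iν h0)]
    simp only [zero_mul, Complex.exp_zero, mul_one]
    have := h n
    have e : ∀ κ : Measure Ω, ∫ ω, (X ω : ℂ) ^ n ∂κ = ((∫ ω, X ω ^ n ∂κ : ℝ) : ℂ) := fun κ => by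
      rw [← integral_complex_ofReal]; simp
    rw [e, e, this]
  -- The moments are the Taylor data at `0` of the complex moment generating functions. These are
  -- analytic on a vertical strip, so they agree on it, in particular on the imaginary axis, where
  -- they are the characteristic functions.
  have hev : complexMGF X μ =ᶠ[𝓝 0] complexMGF X ν := by
    have p1 := (aμ 0 (by simpa [hS] using ha)).hasFPowerSeriesAt
    have p2 := (aν 0 (by simpa [hS] using ha)).hasFPowerSeriesAt
    simp only [hder] at p1
    filter_upwards [p1.eventually_hasSum_sub, p2.eventually_hasSum_sub] with z h1 h2
    exact h1.unique h2
  have hconv : Convex ℝ S := (convex_Ioo (-a) a).linear_preimage Complex.reLm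
  have heq : EqOn (complexMGF X μ) (complexMGF X ν) S :=
    aμ.eqOn_of_preconnected_of_eventuallyEq aν hconv.isPreconnected (z₀ := 0)
      (by simpa [hS] using ha) hev
  refine Measure.ext_of_charFun (funext fun t => ?_)
  rw [← complexMGF_mul_I hX.aemeasurable, ← complexMGF_mul_I hX.aemeasurable]
  exact heq (by simpa [hS] using ha)

theorem rapidDecay_exp_quarter (j : ℕ) :
    RapidDecay fun r => r ^ j * Real.exp (-r ^ 2 / 4) := by
  refine ⟨by fun_prop, fun k => ?_⟩
  have h1 : (fun r : ℝ => r ^ (k + j)) =O[atTop] fun r => Real.exp r :=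
    (Real.isLittleO_pow_exp_atTop (n := k + j)).isBigO
  have h2 : (fun r : ℝ => Real.exp (-r ^ 2 / 4)) =O[atTop] fun r => Real.exp (-2 * r) := by
    refine IsBigO.of_bound 1 ?_
    filter_upwards [eventually_ge_atTop 8] with r hr
    rw [Real.norm_eq_abs, Real.abs_exp, Real.norm_eq_abs, Real.abs_exp, one_mul, Real.exp_le_exp]
    nlinarith
  have h3 := h1.mul h2
  have e1 : (fun r : ℝ => Real.exp r * Real.exp (-2 * r)) = fun r => Real.exp (-r) := by
    funext r; rw [← Real.exp_add]; ring_nf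
  rw [e1] at h3
  refine h3.congr_left fun r => ?_
  rw [pow_add]; ring

theorem RapidDecay.memLp_real {f : ℝ → ℝ} (hf : RapidDecay f) : MemLp f 2 radialMeasure := by
  rw [memLp_two_iff_integrable_sq_norm hf.continuous.aestronglyMeasurable,
    integrable_radialMeasure_iff]
  simpa [sq] using (hf.mul hf).id_mul.integrableOn

/-- The positive and negative parts of `h r^M e^{-r²/2}` are densities of two finite measures. The
hypothesis says that the variable `r²` has the same moments under both, and their Gaussian tails
make these moments determine them. -/
theorem ae_eq_zero_of_moments {M : ℕ} {h : ℝ → ℝ} (hh : MemLp h 2 radialMeasure)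
    (h0 : ∀ k : ℕ, ∫ r, h r * gaussMono (M + 2 * k) r ∂radialMeasure = 0) :
    h =ᵐ[radialMeasure] 0 := by
  set q : ℝ → ℝ := fun r => h r * gaussMono M r with hq
  have hmul : ∀ {g : ℝ → ℝ}, RapidDecay g → Integrable (fun r => h r * g r) radialMeasure :=
    fun hg => hh.integrable_mul hg.memLp_real
  have hqi : Integrable q radialMeasure := hmul (rapidDecay_gaussMono M)
  -- For `|t| < 1/4` half of the Gaussian remains: `-r²/2 + t r² ≤ -r²/4`.
  have hexp : ∀ t ∈ Ioo (-(1 / 4) : ℝ) (1 / 4),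
      Integrable (fun r => q r * Real.exp (t * r ^ 2)) radialMeasure := by
    intro t ht
    refine (hmul (rapidDecay_exp_quarter M)).mono
      (hqi.aestronglyMeasurable.mul (by fun_prop)) ?_
    filter_upwards [ae_pos_radialMeasure] with r hr
    have e1 : q r * Real.exp (t * r ^ 2)
        = h r * (r ^ M * Real.exp (-r ^ 2 / 2 + t * r ^ 2)) := by
      simp only [hq, gaussMono, Real.exp_add]
      ring
    rw [e1]
    simp only [norm_mul, Real.norm_eq_abs, Real.abs_exp]
    gcongr
    nlinarith [ht.2, sq_nonneg r]
  have hpow : ∀ n : ℕ, Integrable (fun r => q r * (r ^ 2) ^ n) radialMeasure ∧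
      ∫ r, q r * (r ^ 2) ^ n ∂radialMeasure = 0 := by
    intro n
    have e : (fun r => q r * (r ^ 2) ^ n) = fun r => h r * gaussMono (M + 2 * n) r := by
      funext r; rw [gaussMono_add, pow_mul, hq]; ring
    rw [e]
    exact ⟨hmul (rapidDecay_gaussMono _), h0 n⟩
  have key : ∀ {s : ℝ → ℝ}, AEMeasurable s radialMeasure → ∀ {g : ℝ → ℝ},
      (∫ r, g r ∂radialMeasure.withDensity (fun r => ENNReal.ofReal (s r)) =
        ∫ r, max (s r) 0 * g r ∂radialMeasure) ∧
      (AEStronglyMeasurable g radialMeasure → Integrable (fun r => s r * g r) radialMeasure →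
        Integrable (fun r => max (s r) 0 * g r) radialMeasure ∧
        Integrable g (radialMeasure.withDensity fun r => ENNReal.ofReal (s r))) := by
    intro s hs g
    constructor
    · rw [integral_withDensity_eq_integral_toReal_smul₀ hs.ennreal_ofReal (by simp)]
      simp only [ENNReal.toReal_ofReal', smul_eq_mul]
    · intro hg hi
      have h1 : Integrable (fun r => max (s r) 0 * g r) radialMeasure := by
        refine hi.mono ((hs.max aemeasurable_const).aestronglyMeasurable.mul hg)
          (Eventually.of_forall fun r => ?_)
        rw [norm_mul, norm_mul]
        gcongr
        rw [Real.norm_eq_abs, Real.norm_eq_abs, abs_of_nonneg (le_max_right _ _)]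
        exact max_le (le_abs_self _) (abs_nonneg _)
      refine ⟨h1, ?_⟩
      rw [integrable_withDensity_iff_integrable_smul₀' hs.ennreal_ofReal (by simp)]
      simpa only [ENNReal.toReal_ofReal', smul_eq_mul] using h1
  have hqm : AEMeasurable q radialMeasure := hqi.aemeasurable
  set μ := radialMeasure.withDensity fun r => ENNReal.ofReal (q r) with hμ
  set ν := radialMeasure.withDensity fun r => ENNReal.ofReal (-q r) with hν
  have : IsFiniteMeasure μ := isFiniteMeasure_withDensity_ofReal hqi.2
  have : IsFiniteMeasure ν := isFiniteMeasure_withDensity_ofReal hqi.neg.2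
  have hmap : μ.map (fun r => r ^ 2) = ν.map (fun r => r ^ 2) := by
    refine map_eq_of_moments (by fun_prop) (a := 1 / 4) (by norm_num) (fun t ht => ?_)
      (fun t ht => ?_) (fun n => ?_)
    · exact ((key hqm).2 (by fun_prop) (hexp t ht)).2
    · exact ((key hqm.neg).2 (by fun_prop) (by simpa using (hexp t ht).neg)).2
    · have i1 := ((key hqm (g := fun r => (r ^ 2) ^ n)).2 (by fun_prop) (hpow n).1).1
      have i2 := ((key hqm.neg (g := fun r => (r ^ 2) ^ n)).2 (by fun_prop)
        (by simpa using (hpow n).1.neg)).1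
      have e2 := (key hqm.neg (g := fun r => (r ^ 2) ^ n)).1
      simp only [Pi.neg_apply] at e2 i2
      rw [(key hqm).1, e2, ← sub_eq_zero, ← integral_sub i1 i2]
      refine Eq.trans (integral_congr_ae (Eventually.of_forall fun r => ?_)) (hpow n).2
      simp only
      rw [← sub_mul, max_zero_sub_eq_self]
  -- No information is lost in passing to `r²`, since `r > 0` almost everywhere.
  have hback : ∀ {κ : Measure ℝ}, κ ≪ radialMeasure →
      (κ.map (fun r => r ^ 2)).map Real.sqrt = κ := by
    intro κ hκ
    rw [Measure.map_map (by fun_prop) (by fun_prop)]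
    conv_rhs => rw [← Measure.map_id (μ := κ)]
    refine Measure.map_congr (hκ.ae_le ?_)
    filter_upwards [ae_pos_radialMeasure] with r hr
    exact Real.sqrt_sq hr.le
  have hμν : μ = ν := by
    rw [← hback (κ := μ) (withDensity_absolutelyContinuous _ _), hmap,
      hback (withDensity_absolutelyContinuous _ _)]
  have hfin : ∫⁻ r, ENNReal.ofReal (q r) ∂radialMeasure ≠ ⊤ := by
    have := measure_ne_top μ univ
    rwa [hμ, withDensity_apply _ MeasurableSet.univ, Measure.restrict_univ] at this
  have hae := (withDensity_eq_iff hqm.ennreal_ofReal hqm.neg.ennreal_ofReal hfin).1 hμν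
  filter_upwards [hae, ae_pos_radialMeasure] with r hr hr0
  have h1 : q r = 0 := by
    have h2 := congrArg ENNReal.toReal hr
    simp only [ENNReal.toReal_ofReal', Pi.neg_apply] at h2
    have h3 := max_zero_sub_eq_self (q r)
    linarith
  have h4 : gaussMono M r ≠ 0 := by
    rw [gaussMono]
    positivity
  exact (mul_eq_zero.1 h1).resolve_right h4

/-- The functions `r ^ (M + 2k) e^{-r²/2}` span a dense subspace of `L²_r`. -/
theorem eq_zero_of_forall_inner_gaussMono {M : ℕ} {f : L2r}
    (h : ∀ k : ℕ, (inner ℂ (rapidDecay_gaussMono (M + 2 * k)).toL2 f : ℂ) = 0) : f = 0 := by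
  have hint : ∀ k : ℕ, ∫ r, f r * (gaussMono (M + 2 * k) r : ℂ) ∂radialMeasure = 0 := by
    intro k
    rw [← h k, L2.inner_def]
    refine integral_congr_ae ?_
    filter_upwards [(rapidDecay_gaussMono (M + 2 * k)).coe_toL2] with r hr
    rw [hr, RCLike.inner_apply, Complex.conj_ofReal]
  have hi : ∀ k : ℕ, Integrable (fun r => f r * (gaussMono (M + 2 * k) r : ℂ)) radialMeasure :=
    fun k => (Lp.memLp f).integrable_mul (rapidDecay_gaussMono _).memLp
  have hre : (fun r => (f r).re) =ᵐ[radialMeasure] 0 := by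
    refine ae_eq_zero_of_moments (M := M) (Lp.memLp f).re fun k => ?_
    have := congrArg Complex.re (hint k)
    rw [← RCLike.re_eq_complex_re, ← integral_re (hi k)] at this
    simpa using this
  have him : (fun r => (f r).im) =ᵐ[radialMeasure] 0 := by
    refine ae_eq_zero_of_moments (M := M) (Lp.memLp f).im fun k => ?_
    have := congrArg Complex.im (hint k)
    rw [← RCLike.im_eq_complex_im, ← integral_im (hi k)] at this
    simpa using this
  rw [Lp.eq_zero_iff_ae_eq_zero]
  filter_upwards [hre, him] with r h1 h2
  exact Complex.ext h1 h2

end Completeness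

/-! ### Green's identity for the oscillator against a smooth profile. -/

section Symmetry

theorem integrableOn_mul_of_decay {g : ℝ → ℝ} (hg : RapidDecay g) {V : ℝ → ℂ}
    (hV : MemLp V 2 radialMeasure) : IntegrableOn (fun r : ℝ => (r : ℂ) * (g r * V r)) (Ioi 0) := by
  have h := hg.memLp.integrable_mul hV
  rw [integrable_radialMeasure_iff] at h
  simpa only [Complex.real_smul, Pi.mul_apply] using h

/-- The oscillator is symmetric on pairs of a smooth profile and an element of the domain. -/
theorem IsProfile.integral_mul_laplacian {m : ℤ} {u w d y x A : ℝ → ℝ}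
    (h : IsProfile m u w d y x A) (hu : ContDiff ℝ (⊤ : ℕ∞) u) {V : ℝ → ℂ} (hV : MemH2 m V) :
    ∫ r in Ioi (0 : ℝ), (r * u r : ℂ) * (-radialLaplacian m V r + (r : ℂ) ^ 2 * V r) =
      ∫ r in Ioi (0 : ℝ), (r * ((-d r - A r + r ^ 2 * u r : ℝ) : ℂ)) * V r := by
  have dw : deriv u = w := funext fun r => (h.deriv_u r).deriv
  have hw : ContDiff ℝ (⊤ : ℕ∞) w := dw ▸ (contDiff_infty_iff_deriv.1 hu).2
  have pos : ∀ᵐ r : ℝ ∂volume.restrict (Ioi 0), 0 < r :=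
    (ae_restrict_iff' measurableSet_Ioi).2 (Eventually.of_forall fun _ h => h)
  have e1 : ∀ r, deriv (fun r => r * u r) r = u r + r * w r := fun r => by
    refine (((hasDerivAt_id' r).mul (h.deriv_u r)).deriv).trans ?_; simp
  have e2 : ∀ r, deriv (fun r => r * w r) r = w r + r * d r := fun r => by
    refine (((hasDerivAt_id' r).mul (h.deriv_w r)).deriv).trans ?_; simp
  -- The Wronskian `B = r (u V' - u' V)`. Its derivative is the difference of the two integrands,
  -- and the integral of `B'` vanishes once `B / r` is integrable.
  have hB := (hV.derivs.snd.smooth_mul (contDiff_id.mul hu)).sub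
    (hV.derivs.fst.smooth_mul (contDiff_id.mul hw))
  simp only [id] at hB
  have I := fun {g : ℝ → ℝ} (hg : RapidDecay g) {U : ℝ → ℂ} (hU : MemLp U 2 radialMeasure) =>
    integrableOn_mul_of_decay hg hU
  -- Integrability for `dr` instead of `r dr` needs an extra factor `r` near the origin. For `m ≠ 0`
  -- it comes from `m u = r y`; for `m = 0` from `V' = r · (V' / r)`, the quotient being in `L²_r`
  -- as a component of the Hessian. The term `w V` is treated likewise, the roles of the profile and
  -- `V` being exchanged.
  have iuV' : IntegrableOn (fun r : ℝ => (u r : ℂ) * weakDeriv V r) (Ioi 0) := by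
    by_cases hm : m = 0
    · refine (I h.decay_u hV.memLp_angularHess).congr ?_
      filter_upwards [pos] with r hr
      have hr' : (r : ℂ) ≠ 0 := by exact_mod_cast hr.ne'
      simp only [angularHess, hm]
      field_simp
      simp
      ring
    · have hm' : (m : ℝ) ≠ 0 := by exact_mod_cast hm
      refine (I (h.decay_y.const_mul (m : ℝ)⁻¹) hV.memLp_deriv).congr ?_
      filter_upwards [pos] with r hr
      have := h.mul_y r
      have e : r * ((m : ℝ)⁻¹ * y r) = u r := by
        field_simp
        linarith
      rw [← mul_assoc, ← Complex.ofReal_mul, e]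
  have iwV : IntegrableOn (fun r : ℝ => (w r : ℂ) * V r) (Ioi 0) := by
    by_cases hm : m = 0
    · refine (I h.decay_A hV.memLp).congr ?_
      filter_upwards [pos] with r hr
      have := h.mul_A r
      rw [← mul_assoc, ← Complex.ofReal_mul, this]
      simp [hm]
    · have hm' : (m : ℂ) ≠ 0 := by exact_mod_cast hm
      refine ((I h.decay_w hV.memLp_angularGrad).const_mul (m : ℂ)⁻¹).congr ?_
      filter_upwards [pos] with r hr
      have hr' : (r : ℂ) ≠ 0 := by exact_mod_cast hr.ne'
      simp only [angularGrad]
      field_simp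
  have i1 := (I h.decay_u hV.memLp_deriv2)
  have i2 := (I h.decay_d hV.memLp)
  have hz : ∫ r : ℝ in Ioi (0 : ℝ), ((u r : ℂ) * weakDeriv V r + r * (u r * weakDeriv (weakDeriv V) r)
      - (w r * V r + r * (d r * V r))) = 0 := by
    have hB2 := (hB.congr (ae_eq_refl _) (v' := fun r : ℝ =>
      ((u r : ℂ) * weakDeriv V r + r * (u r * weakDeriv (weakDeriv V) r)
      - (w r * V r + r * (d r * V r)))) (Eventually.of_forall fun r => by
        simp only [e1, e2]; push_cast; ring))
    refine hB2.integral_eq_zero ?_ ((iuV'.add i1).sub (iwV.add i2))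
    refine (iuV'.sub iwV).congr ?_
    filter_upwards [pos] with r hr
    have hr' : (r : ℂ) ≠ 0 := by exact_mod_cast hr.ne'
    simp only [Pi.sub_apply]
    push_cast
    field_simp
  have iL : IntegrableOn (fun r : ℝ => (r * u r : ℂ) *
      (-radialLaplacian m V r + (r : ℂ) ^ 2 * V r)) (Ioi 0) := by
    refine (((I h.decay_u hV.memLp_sqWeight).sub i1).sub (I h.decay_u hV.memLp_angularHess)).congr
      (Eventually.of_forall fun r => ?_)
    simp only [Pi.sub_apply, sqWeight, angularHess, radialLaplacian]
    ring
  have iR : IntegrableOn (fun r : ℝ => (r * ((-d r - A r + r ^ 2 * u r : ℝ) : ℂ)) * V r)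
      (Ioi 0) := by
    refine (I ((h.decay_d.neg.sub h.decay_A).add (h.decay_u.pow_mul 2)) hV.memLp).congr
      (Eventually.of_forall fun r => ?_)
    simp only [mul_assoc]
  rw [← sub_eq_zero, ← integral_sub iL iR, ← neg_eq_zero, ← integral_neg]
  refine Eq.trans (integral_congr_ae ?_) hz
  filter_upwards [pos] with r hr
  have hr' : (r : ℂ) ≠ 0 := by exact_mod_cast hr.ne'
  have hy : y r = m * u r / r := by rw [eq_div_iff hr.ne']; linarith [h.mul_y r]
  have hA : A r = (w r - m * y r) / r := by rw [eq_div_iff hr.ne']; linarith [h.mul_A r]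
  rw [hA, hy, radialLaplacian]
  push_cast
  field_simp
  ring

end Symmetry

/-! ### The Laguerre–Gauss eigenbasis and the domain in terms of coefficients. -/

section Eigenbasis

/-- The components of the monomial profiles. -/
def gaussProfile (m : ℤ) (k : ℕ) : Fin 7 → ℝ → ℝ :=
  let j := m.natAbs + 2 * k
  ![gaussMono j, fun r => j * gaussMono (j - 1) r - gaussMono (j + 1) r,
    fun r => j * (j - 1) * gaussMono (j - 2) r - (2 * j + 1) * gaussMono j r + gaussMono (j + 2) r,
    fun r => m * gaussMono (j - 1) r,
    fun r => m * ((j - 1) * gaussMono (j - 2) r - gaussMono j r),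
    fun r => (j - (m : ℝ) ^ 2) * gaussMono (j - 2) r - gaussMono j r,
    gaussMono (j + 2)]

theorem isProfileVec_gaussProfile (m : ℤ) (k : ℕ) : IsProfileVec m (gaussProfile m k) :=
  ⟨isProfile_gaussMono m rfl, fun r => gaussMono_add _ 2 r⟩

/-- The monomial profiles as elements of `(L²_r)⁷`. -/
def gaussVec (m : ℤ) (k : ℕ) : Fin 7 → L2r := fun i =>
  ((isProfileVec_gaussProfile m k).decay i).toL2

theorem coeFn_gaussVec (m : ℤ) (k : ℕ) (i : Fin 7) :
    gaussVec m k i =ᵐ[radialMeasure] fun r => (gaussProfile m k i r : ℂ) :=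
  RapidDecay.coe_toL2 _

theorem gaussVec_mem (m : ℤ) (k : ℕ) : gaussVec m k ∈ profileSpace m := by
  refine ⟨_, _, isProfileVec_gaussProfile m k, IsProfileVec.zero _, fun i => ?_⟩
  filter_upwards [coeFn_gaussVec m k i] with r hr
  rw [hr]
  simp

/-- The eigenvalues of the oscillator. -/
def oscEigenvalue (m : ℤ) (n : ℕ) : ℝ := 2 * (m.natAbs + 1) + 4 * n

/-- The oscillator is triangular on the Gaussian monomials. At `k = 0` the index `k - 1` is
truncated, but its coefficient is zero. -/
theorem oscillator_gaussVec (m : ℤ) (k : ℕ) :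
    oscillator (gaussVec m k) = (oscEigenvalue m k : ℂ) • gaussVec m k 0
      - ((4 * k * (k + m.natAbs) : ℝ) : ℂ) • gaussVec m (k - 1) 0 := by
  refine Lp.ext ?_
  filter_upwards [coeFn_oscillator (gaussVec m k), coeFn_gaussVec m k 2, coeFn_gaussVec m k 5,
    coeFn_gaussVec m k 6, coeFn_gaussVec m k 0, coeFn_gaussVec m (k - 1) 0,
    coeFn_const_smul_sub (oscEigenvalue m k : ℂ) ((4 * k * (k + m.natAbs) : ℝ) : ℂ)
      (gaussVec m k 0) (gaussVec m (k - 1) 0)] with r h1 h2 h3 h4 h5 h6 h7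
  rw [h1, h2, h3, h4, h7, h5, h6]
  norm_cast
  have hm : (m : ℝ) ^ 2 = (m.natAbs : ℝ) ^ 2 := by
    rw [Nat.cast_natAbs, Int.cast_abs, sq_abs]
  rw [oscEigenvalue]
  change -((((m.natAbs + 2 * k : ℕ) : ℝ) * (((m.natAbs + 2 * k : ℕ) : ℝ) - 1)
      * gaussMono (m.natAbs + 2 * k - 2) r - (2 * ((m.natAbs + 2 * k : ℕ) : ℝ) + 1)
      * gaussMono (m.natAbs + 2 * k) r + gaussMono (m.natAbs + 2 * k + 2) r))
    - ((((m.natAbs + 2 * k : ℕ) : ℝ) - (m : ℝ) ^ 2) * gaussMono (m.natAbs + 2 * k - 2) r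
      - gaussMono (m.natAbs + 2 * k) r) + gaussMono (m.natAbs + 2 * k + 2) r
    = (2 * ((m.natAbs : ℝ) + 1) + 4 * (k : ℝ)) * gaussMono (m.natAbs + 2 * k) r
      - ((4 * k * (k + m.natAbs) : ℕ) : ℝ) * gaussMono (m.natAbs + 2 * (k - 1)) r
  rw [hm]
  rcases k with _ | k
  · push_cast
    ring
  · have : m.natAbs + 2 * (k + 1) - 2 = m.natAbs + 2 * (k + 1 - 1) := by omega
    rw [this]
    push_cast
    ring

theorem inner_gaussVec (m : ℤ) (k : ℕ) {V f : L2r} (hV : MemH2 m V)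
    (hf : ∀ᵐ r : ℝ ∂radialMeasure, -radialLaplacian m V r + (r : ℂ) ^ 2 * V r = f r) :
    (inner ℂ (gaussVec m k 0) f : ℂ) = inner ℂ (oscillator (gaussVec m k)) V := by
  have hp := isProfileVec_gaussProfile m k
  have ht : oscillator (gaussVec m k) =ᵐ[radialMeasure] fun r =>
      ((-gaussProfile m k 2 r - gaussProfile m k 5 r + r ^ 2 * gaussProfile m k 0 r : ℝ) : ℂ) := by
    filter_upwards [coeFn_oscillator (gaussVec m k), coeFn_gaussVec m k 2, coeFn_gaussVec m k 5,
      coeFn_gaussVec m k 6] with r h1 h2 h3 h4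
    rw [h1, h2, h3, h4, hp.2]
    push_cast
    ring
  rw [inner_eq_of_ae_real (coeFn_gaussVec m k 0), inner_eq_of_ae_real ht,
    ← hp.1.integral_mul_laplacian (contDiff_gaussMono _) hV]
  refine integral_congr_ae ?_
  filter_upwards [ac_radialMeasure.ae_le hf] with r hr
  rw [hr]

/-- The coefficients of the Laguerre polynomials. -/
def laguerreCoeff (M n k : ℕ) : ℝ :=
  ∏ i ∈ Finset.range k, ((i : ℝ) - n) / ((i + 1) * (i + 1 + M))

theorem laguerreCoeff_succ (M n k : ℕ) : 4 * ((k : ℝ) + 1) * (k + 1 + M) * laguerreCoeff M n (k + 1) =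
    4 * (k - n) * laguerreCoeff M n k := by
  rw [laguerreCoeff, Finset.prod_range_succ, ← laguerreCoeff]
  have h1 : (k : ℝ) + 1 ≠ 0 := by positivity
  have h2 : (k : ℝ) + 1 + M ≠ 0 := by positivity
  field_simp

theorem laguerreCoeff_self_ne_zero (M n : ℕ) : laguerreCoeff M n n ≠ 0 := by
  refine Finset.prod_ne_zero_iff.2 fun i hi => div_ne_zero ?_ (by positivity)
  have : (i : ℝ) < n := by exact_mod_cast Finset.mem_range.1 hi
  linarith

/-- The eigenfunctions of the oscillator, with the components of their profiles. -/
def eigenVec (m : ℤ) (n : ℕ) : Fin 7 → L2r :=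
  ∑ k ∈ Finset.range (n + 1), (laguerreCoeff m.natAbs n k : ℂ) • gaussVec m k

theorem eigenVec_mem (m : ℤ) (n : ℕ) : eigenVec m n ∈ profileSpace m :=
  Submodule.sum_mem _ fun k _ => Submodule.smul_mem _ _ (gaussVec_mem m k)

theorem eigenVec_apply (m : ℤ) (n : ℕ) (i : Fin 7) : eigenVec m n i =
    ∑ k ∈ Finset.range (n + 1), (laguerreCoeff m.natAbs n k : ℂ) • gaussVec m k i := by
  rw [eigenVec, Finset.sum_apply]
  rfl

/-- The recursion for the Laguerre coefficients is what turns the triangular action into an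
eigenvector equation, because the oscillator eigenvalues satisfy `λ_k - 4(k - n) = λ_n`. -/
theorem oscillator_eigenVec (m : ℤ) (n : ℕ) :
    oscillator (eigenVec m n) = (oscEigenvalue m n : ℂ) • eigenVec m n 0 := by
  have e1 : oscillator (eigenVec m n) = ∑ k ∈ Finset.range (n + 1),
      ((laguerreCoeff m.natAbs n k * oscEigenvalue m k : ℝ) : ℂ) • gaussVec m k 0
      - ∑ k ∈ Finset.range (n + 1), ((4 * k * (k + m.natAbs) * laguerreCoeff m.natAbs n k : ℝ) : ℂ)
        • gaussVec m (k - 1) 0 := by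
    rw [eigenVec, map_sum, ← Finset.sum_sub_distrib]
    refine Finset.sum_congr rfl fun k _ => ?_
    rw [map_smul, oscillator_gaussVec, smul_sub, smul_smul, smul_smul]
    push_cast
    ring_nf
  -- Index shift: the lowest term on the left carries the factor `k = 0`, the highest one on the
  -- right the factor `k - n = 0`.
  have e2 : ∑ k ∈ Finset.range (n + 1), ((4 * k * (k + m.natAbs) * laguerreCoeff m.natAbs n k : ℝ) : ℂ)
        • gaussVec m (k - 1) 0 = ∑ k ∈ Finset.range (n + 1),
        ((4 * (k - n) * laguerreCoeff m.natAbs n k : ℝ) : ℂ) • gaussVec m k 0 := by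
    rw [Finset.sum_range_succ', Finset.sum_range_succ]
    simp only [Nat.add_sub_cancel, Nat.cast_add, Nat.cast_one, laguerreCoeff_succ]
    simp
  rw [e1, e2, eigenVec_apply, Finset.smul_sum, ← Finset.sum_sub_distrib]
  refine Finset.sum_congr rfl fun k _ => ?_
  rw [← sub_smul, smul_smul, oscEigenvalue, oscEigenvalue]
  push_cast
  ring_nf

theorem memH2_eigenVec (m : ℤ) (n : ℕ) : MemH2 m (eigenVec m n 0) ∧
    ∀ᵐ r : ℝ ∂radialMeasure, -radialLaplacian m (eigenVec m n 0) r + (r : ℂ) ^ 2 * eigenVec m n 0 r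
      = ((oscEigenvalue m n : ℂ) • eigenVec m n 0 : L2r) r := by
  have h := memH2_of_mem_closure (subset_closure (eigenVec_mem m n))
  rw [oscillator_eigenVec] at h
  exact ⟨h.1, h.2.1⟩

theorem inner_eigenVec (m : ℤ) (n : ℕ) {V f : L2r} (hV : MemH2 m V)
    (hf : ∀ᵐ r : ℝ ∂radialMeasure, -radialLaplacian m V r + (r : ℂ) ^ 2 * V r = f r) :
    (inner ℂ (eigenVec m n 0) f : ℂ) = oscEigenvalue m n * inner ℂ (eigenVec m n 0) V := by
  have h1 : (inner ℂ (eigenVec m n 0) f : ℂ) = inner ℂ (oscillator (eigenVec m n)) V := by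
    rw [eigenVec_apply, eigenVec, map_sum, sum_inner, sum_inner]
    refine Finset.sum_congr rfl fun k _ => ?_
    rw [map_smul, inner_smul_left, inner_smul_left, inner_gaussVec m k hV hf]
  rw [h1, oscillator_eigenVec, inner_smul_left, Complex.conj_ofReal]

theorem oscEigenvalue_injective (m : ℤ) : Function.Injective (oscEigenvalue m) := by
  intro n k h
  simp only [oscEigenvalue] at h
  have : (n : ℝ) = k := by linarith
  exact_mod_cast this

theorem inner_eigenVec_eigenVec (m : ℤ) {n k : ℕ} (hnk : n ≠ k) :
    (inner ℂ (eigenVec m n 0) (eigenVec m k 0) : ℂ) = 0 := by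
  have h := inner_eigenVec m n (memH2_eigenVec m k).1 (memH2_eigenVec m k).2
  rw [inner_smul_right] at h
  have h1 : (oscEigenvalue m k : ℂ) - oscEigenvalue m n ≠ 0 := by
    rw [sub_ne_zero]
    exact_mod_cast fun h => hnk (oscEigenvalue_injective m h).symm
  refine (mul_eq_zero.1 (?_ : ((oscEigenvalue m k : ℂ) - oscEigenvalue m n) * _ = 0)).resolve_left h1
  rw [sub_mul, h, sub_self]

/-- Each eigenfunction is triangular in the monomials with nonzero leading coefficient, so
orthogonality passes to the monomials by induction. -/
theorem eq_zero_of_forall_inner_eigenVec (m : ℤ) {f : L2r}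
    (h : ∀ n, (inner ℂ (eigenVec m n 0) f : ℂ) = 0) : f = 0 := by
  refine eq_zero_of_forall_inner_gaussMono (M := m.natAbs) fun n => ?_
  change (inner ℂ (gaussVec m n 0) f : ℂ) = 0
  induction n using Nat.strong_induction_on with
  | _ n ih =>
    have h1 := h n
    rw [eigenVec_apply, sum_inner, Finset.sum_range_succ, Finset.sum_eq_zero, zero_add,
      inner_smul_left] at h1
    · exact (mul_eq_zero.1 h1).resolve_left (by simpa using laguerreCoeff_self_ne_zero _ n)
    · intro k hk
      rw [inner_smul_left, ih k (Finset.mem_range.1 hk), mul_zero]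

theorem eigenVec_ne_zero (m : ℤ) (n : ℕ) : eigenVec m n 0 ≠ 0 := by
  intro h
  set q : ℝ → ℝ := fun r => ∑ k ∈ Finset.range (n + 1), laguerreCoeff m.natAbs n k * r ^ (2 * k)
    with hq
  have hqc : Continuous q := by fun_prop
  have h1 : ∀ᵐ r : ℝ ∂radialMeasure, q r = 0 := by
    rw [eigenVec_apply] at h
    have h2 : ∀ s : Finset ℕ, ⇑(∑ k ∈ s, (laguerreCoeff m.natAbs n k : ℂ) • gaussVec m k 0)
        =ᵐ[radialMeasure] fun r => ((∑ k ∈ s, laguerreCoeff m.natAbs n k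
          * gaussMono (m.natAbs + 2 * k) r : ℝ) : ℂ) := by
      intro s
      induction s using Finset.induction_on with
      | empty =>
        filter_upwards [Lp.coeFn_zero ℂ 2 radialMeasure] with r hr
        rw [Finset.sum_empty, hr]
        simp
      | insert k s hk ih =>
        rw [Finset.sum_insert hk]
        filter_upwards [ih, coeFn_gaussVec m k 0,
          Lp.coeFn_add ((laguerreCoeff m.natAbs n k : ℂ) • gaussVec m k 0)
            (∑ k ∈ s, (laguerreCoeff m.natAbs n k : ℂ) • gaussVec m k 0),
          Lp.coeFn_smul (laguerreCoeff m.natAbs n k : ℂ) (gaussVec m k 0)] with r e1 e2 e3 e4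
        rw [e3, Pi.add_apply, e1, e4, Pi.smul_apply, e2, Finset.sum_insert hk]
        push_cast
        rfl
    have h3 := h2 (Finset.range (n + 1))
    rw [h] at h3
    filter_upwards [h3, Lp.coeFn_zero ℂ 2 radialMeasure, ae_pos_radialMeasure] with r e1 e2 hr
    rw [e2, Pi.zero_apply, eq_comm, Complex.ofReal_eq_zero] at e1
    simp only [gaussMono_add, ← mul_assoc, ← Finset.sum_mul] at e1
    refine (mul_eq_zero.1 e1).resolve_right ?_
    rw [gaussMono]
    positivity
  -- A continuous function vanishing almost everywhere on the half-line vanishes at its endpoint,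
  -- whereas the constant coefficient of `q` is an empty product, equal to `1`.
  have h2 : EqOn q (fun _ => 0) (Ici 0) := by
    refine Measure.eqOn_of_ae_eq (μ := volume) ?_ hqc.continuousOn continuousOn_const ?_
    · rw [← restrict_Ioi_eq_restrict_Ici]
      exact ac_radialMeasure.ae_le h1
    · rw [interior_Ici, closure_Ioi]
  have h3 := h2 (show (0 : ℝ) ∈ Ici 0 from mem_Ici.2 le_rfl)
  simp only [hq, Finset.sum_range_succ', zero_pow_eq] at h3
  simp [laguerreCoeff] at h3

theorem orthonormal_eigenVec (m : ℤ) :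
    Orthonormal ℂ fun n => ((‖eigenVec m n 0‖ : ℂ)⁻¹) • eigenVec m n 0 :=
  ⟨fun n => norm_smul_inv_norm (𝕜 := ℂ) (eigenVec_ne_zero m n), fun n k hnk => by
    simp only [inner_smul_left, inner_smul_right, inner_eigenVec_eigenVec m hnk, mul_zero]⟩

theorem span_eigenVec_orthogonal (m : ℤ) :
    (Submodule.span ℂ (range fun n => ((‖eigenVec m n 0‖ : ℂ)⁻¹) • eigenVec m n 0))ᗮ = ⊥ := by
  rw [Submodule.eq_bot_iff]
  intro f hf
  refine eq_zero_of_forall_inner_eigenVec m fun n => ?_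
  have h := (Submodule.mem_orthogonal _ _).1 hf _ (Submodule.subset_span ⟨n, rfl⟩)
  rw [inner_smul_left] at h
  refine (mul_eq_zero.1 h).resolve_left ?_
  simpa using eigenVec_ne_zero m n

/-- The Hilbert basis of eigenfunctions of the oscillator. -/
def oscBasis (m : ℤ) : HilbertBasis ℕ ℂ L2r :=
  HilbertBasis.mkOfOrthogonalEqBot (orthonormal_eigenVec m) (span_eigenVec_orthogonal m)

theorem oscBasis_apply (m : ℤ) (n : ℕ) :
    oscBasis m n = ((‖eigenVec m n 0‖ : ℂ)⁻¹) • eigenVec m n 0 := by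
  rw [oscBasis, HilbertBasis.coe_mkOfOrthogonalEqBot]

theorem inner_oscBasis {m : ℤ} {V f : L2r} (hV : MemH2 m V)
    (hf : ∀ᵐ r : ℝ ∂radialMeasure, -radialLaplacian m V r + (r : ℂ) ^ 2 * V r = f r) (n : ℕ) :
    (inner ℂ (oscBasis m n) f : ℂ) = oscEigenvalue m n * inner ℂ (oscBasis m n) V := by
  rw [oscBasis_apply, inner_smul_left, inner_smul_left, inner_eigenVec m n hV hf]
  ring

/-- Partial sums of the expansion of `V` are smooth profiles, and the oscillator maps them to the
partial sums for `f`. Both sequences converge, so the profiles converge with all their components.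
-/
theorem exists_profile_of_inner_oscBasis {m : ℤ} {V f : L2r}
    (h : ∀ n, (inner ℂ (oscBasis m n) f : ℂ) = oscEigenvalue m n * inner ℂ (oscBasis m n) V) :
    ∃ Q ∈ (profileSpace m).topologicalClosure, Q 0 = V ∧ oscillator Q = f := by
  set P : ℕ → Fin 7 → L2r := fun N => ∑ n ∈ Finset.range N,
    (inner ℂ (oscBasis m n) V : ℂ) • ((‖eigenVec m n 0‖ : ℂ)⁻¹) • eigenVec m n with hP
  refine exists_limit_profile (P := P) (fun N => Submodule.sum_mem _ fun n _ =>
    Submodule.smul_mem _ _ (Submodule.smul_mem _ _ (eigenVec_mem m n))) ?_ ?_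
  · have h1 := ((oscBasis m).hasSum_repr V).tendsto_sum_nat
    refine h1.congr fun N => ?_
    simp only [hP]
    rw [Finset.sum_apply]
    refine Finset.sum_congr rfl fun n _ => ?_
    rw [HilbertBasis.repr_apply_apply, oscBasis_apply]
    rfl
  · have h1 := ((oscBasis m).hasSum_repr f).tendsto_sum_nat
    refine h1.congr fun N => ?_
    rw [hP, map_sum]
    refine Finset.sum_congr rfl fun n _ => ?_
    rw [HilbertBasis.repr_apply_apply, h n, map_smul, map_smul, oscillator_eigenVec,
      smul_comm _ (oscEigenvalue m n : ℂ), ← oscBasis_apply, smul_smul, mul_comm]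

/-- The domain of the oscillator in terms of coefficients, with the elliptic estimate. -/
theorem memH2_of_inner_oscBasis {m : ℤ} {V f : L2r}
    (h : ∀ n, (inner ℂ (oscBasis m n) f : ℂ) = oscEigenvalue m n * inner ℂ (oscBasis m n) V) :
    MemH2 m V ∧ (∀ᵐ r : ℝ ∂radialMeasure, -radialLaplacian m V r + (r : ℂ) ^ 2 * V r = f r) ∧
      h2NormSq m V ≤ 3 * ‖f‖ ^ 2 := by
  obtain ⟨Q, hQ, rfl, rfl⟩ := exists_profile_of_inner_oscBasis h
  obtain ⟨h1, h2, h3, _⟩ := memH2_of_mem_closure hQ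
  exact ⟨h1, h2, h3⟩

end Eigenbasis

/-! ### Smallness of the primary branch in `L^∞`. -/

section SupBound

theorem HasWeakDeriv.weakDeriv_congr {u u' v : ℝ → ℂ} (h : HasWeakDeriv u v)
    (hu : u =ᵐ[radialMeasure] u') : weakDeriv u =ᵐ[radialMeasure] weakDeriv u' :=
  h.weakDeriv_ae.trans (h.congr hu (ae_eq_refl _)).weakDeriv_ae.symm

theorem radialLaplacian_congr {m : ℤ} {u u' : ℝ → ℂ} (h : HasTwoWeakDerivs u)
    (hu : u =ᵐ[radialMeasure] u') :
    radialLaplacian m u =ᵐ[radialMeasure] radialLaplacian m u' := by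
  have d1 := h.fst.weakDeriv_congr hu
  filter_upwards [hu, d1, h.snd.weakDeriv_congr d1] with r e0 e1 e2
  rw [radialLaplacian, radialLaplacian, e0, e1, e2]

theorem MemH2.congr {m : ℤ} {u u' : ℝ → ℂ} (h : MemH2 m u) (hu : u =ᵐ[radialMeasure] u') :
    MemH2 m u' := by
  have d1 := h.derivs.fst.weakDeriv_congr hu
  have d2 := h.derivs.snd.weakDeriv_congr d1
  refine ⟨⟨_, _, h.derivs.fst.congr hu (ae_eq_refl _), h.derivs.snd⟩,
    (memLp_congr_ae hu).1 h.memLp, (memLp_congr_ae d1).1 h.memLp_deriv,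
    (memLp_congr_ae ?_).1 h.memLp_angularGrad, (memLp_congr_ae d2).1 h.memLp_deriv2,
    (memLp_congr_ae ?_).1 h.memLp_mixedHess, (memLp_congr_ae ?_).1 h.memLp_angularHess,
    (memLp_congr_ae ?_).1 h.memLp_sqWeight⟩ <;>
  filter_upwards [hu, d1] with r e0 e1
  · rw [angularGrad, angularGrad, e0]
  · rw [mixedHess, mixedHess, e0, e1]
  · rw [angularHess, angularHess, e0, e1]
  · rw [sqWeight, sqWeight, e0]

theorem MemH2.memLp_oscillator {m : ℤ} {u : ℝ → ℂ} (h : MemH2 m u) :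
    MemLp (fun r : ℝ => -radialLaplacian m u r + (r : ℂ) ^ 2 * u r) 2 radialMeasure := by
  refine (memLp_congr_ae (Eventually.of_forall fun r => ?_)).1
    ((h.memLp_sqWeight.sub h.memLp_deriv2).sub h.memLp_angularHess)
  simp only [Pi.sub_apply, sqWeight, angularHess, radialLaplacian]
  ring

theorem MemH2.exists_profile {m : ℤ} {u : ℝ → ℂ} (h : MemH2 m u) :
    ∃ Q ∈ (profileSpace m).topologicalClosure, Q 0 =ᵐ[radialMeasure] u := by
  have hu := h.memLp.coeFn_toLp
  have hf := h.memLp_oscillator.coeFn_toLp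
  obtain ⟨Q, hQ, hQ0, -⟩ := exists_profile_of_inner_oscBasis
    (inner_oscBasis (V := h.memLp.toLp u) (f := h.memLp_oscillator.toLp _) (h.congr hu.symm) (by
      filter_upwards [hf, hu, radialLaplacian_congr (m := m) h.derivs hu.symm] with r e1 e2 e3
      rw [e1, e2, e3]))
  exact ⟨Q, hQ, hQ0 ▸ hu⟩

/-- Write `u(r)²` as the integral of `-2 u u'` over `(r, ∞)` and bound the integrand by `s u'² + u²
/ s`. The last term is at most `s y² = m² u² / s` precisely because `m² ≥ 1`. -/
theorem IsProfile.sq_le {m : ℝ} (hm : 1 ≤ m ^ 2) {u w d y x A : ℝ → ℝ}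
    (h : IsProfile m u w d y x A) {r : ℝ} (hr : 0 < r) :
    u r ^ 2 ≤ (∫ s in Ioi (0 : ℝ), s * w s ^ 2) + ∫ s in Ioi (0 : ℝ), s * y s ^ 2 := by
  have I := fun {f : ℝ → ℝ} (hf : RapidDecay f) => (hf.mul hf).id_mul.integrableOn
  have iw : IntegrableOn (fun s => s * w s ^ 2) (Ioi 0) := by simpa only [sq] using I h.decay_w
  have iy : IntegrableOn (fun s => s * y s ^ 2) (Ioi 0) := by simpa only [sq] using I h.decay_y
  have hsub : Ioi r ⊆ Ioi (0 : ℝ) := Ioi_subset_Ioi hr.le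
  have i1 : IntegrableOn (fun s => w s * u s + u s * w s) (Ioi r) :=
    (((h.decay_w.mul h.decay_u).add (h.decay_u.mul h.decay_w)).integrableOn).mono_set hsub
  have h1 := integral_Ioi_of_hasDerivAt_of_tendsto' (a := r)
    (fun s _ => (h.deriv_u s).mul (h.deriv_u s)) i1 (h.decay_u.mul h.decay_u).tendsto
  have h2 : u r ^ 2 = ∫ s in Ioi r, -(w s * u s + u s * w s) := by
    rw [integral_neg, h1, Pi.mul_apply]
    ring
  rw [h2, ← integral_add iw iy]
  refine le_trans (setIntegral_mono_on i1.neg ((iw.add iy).mono_set hsub) measurableSet_Ioi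
    fun s hs => ?_) (setIntegral_mono_set (iw.add iy) ?_ hsub.eventuallyLE)
  · have hs0 : 0 < s := hr.trans hs
    have h3 : u s ^ 2 ≤ (s * y s) ^ 2 := by
      rw [h.mul_y, mul_pow]
      nlinarith [sq_nonneg (u s)]
    have h4 : u s ^ 2 / s ≤ s * y s ^ 2 := by
      rw [div_le_iff₀ hs0]
      linarith
    have h5 : -(w s * u s + u s * w s) ≤ s * w s ^ 2 + u s ^ 2 / s := by
      have : s * w s ^ 2 + u s ^ 2 / s + (w s * u s + u s * w s) = (s * w s + u s) ^ 2 / s := by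
        field_simp
        ring
      have h6 : 0 ≤ (s * w s + u s) ^ 2 / s := by positivity
      linarith
    simp only [Pi.add_apply]
    linarith
  · refine (ae_restrict_iff' measurableSet_Ioi).2 (Eventually.of_forall fun s hs => ?_)
    have hs0 : 0 < s := hs
    simp only [Pi.add_apply, Pi.zero_apply]
    positivity

/-- The embedding of `H¹` functions with nonzero angular index into `L^∞`. -/
theorem norm_sq_le_of_mem_closure {m : ℝ} (hm : 1 ≤ m ^ 2) {P : Fin 7 → L2r}
    (hP : P ∈ (profileSpace m).topologicalClosure) :
    ∀ᵐ r : ℝ ∂radialMeasure, ‖P 0 r‖ ^ 2 ≤ ‖P 1‖ ^ 2 + ‖P 3‖ ^ 2 := by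
  have h1 : ∀ Q ∈ profileSpace m, ∀ᵐ r : ℝ ∂radialMeasure,
      ‖Q 0 r‖ ^ 2 ≤ ‖Q 1‖ ^ 2 + ‖Q 3‖ ^ 2 := by
    rintro Q ⟨f, g, hf, hg, h⟩
    have I : ∀ {f : Fin 7 → ℝ → ℝ}, IsProfileVec m f → ∀ i,
        IntegrableOn (fun r => r * f i r ^ 2) (Ioi 0) := fun hf i => by
      simpa only [sq] using ((hf.decay i).mul (hf.decay i)).id_mul.integrableOn
    have N : ∀ i, ‖Q i‖ ^ 2 = (∫ r in Ioi (0 : ℝ), r * f i r ^ 2)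
        + ∫ r in Ioi (0 : ℝ), r * g i r ^ 2 := by
      intro i
      rw [norm_sq_of_ae (h i), ← integral_add (I hf i) (I hg i)]
      simp only [mul_add]
    filter_upwards [h 0, ae_pos_radialMeasure] with r hr hr0
    have e : ‖Q 0 r‖ ^ 2 = f 0 r ^ 2 + g 0 r ^ 2 := by
      rw [hr, ← Complex.normSq_eq_norm_sq, Complex.normSq_apply]
      simp
      ring
    rw [e, N, N]
    linarith [hf.1.sq_le hm hr0, hg.1.sq_le hm hr0]
  -- `L²` convergence yields almost everywhere convergence along a subsequence, along which the
  -- pointwise bound passes to the limit.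
  obtain ⟨x, hx, hlim⟩ := mem_closure_iff_seq_limit.1
    (show P ∈ closure (profileSpace m : Set (Fin 7 → L2r)) from hP)
  have hlim' := tendsto_pi_nhds.1 hlim
  obtain ⟨ns, hns, hae⟩ := (tendstoInMeasure_of_tendsto_Lp (hlim' 0)).exists_seq_tendsto_ae
  filter_upwards [hae, ae_all_iff.2 fun n => h1 (x n) (hx n)] with r e1 e2
  refine le_of_tendsto_of_tendsto (e1.norm.pow 2)
    ((((hlim' 1).norm.pow 2).add ((hlim' 3).norm.pow 2)).comp hns.tendsto_atTop)
    (Eventually.of_forall fun n => e2 (ns n))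

theorem groundState_eq (m₀ : ℕ) (r : ℝ) : groundState m₀ r =
    √2 / √(m₀.factorial : ℝ) * gaussMono m₀ r := by
  rw [groundState, gaussMono]
  ring

/-- The distance of a solution to the multiples of the ground state, in `L^∞`. -/
theorem MemH2.norm_sub_groundState_le {m₀ : ℕ} (hm₀ : 1 ≤ m₀) {ψ : ℝ → ℝ}
    (h : MemH2 m₀ fun r => (ψ r : ℂ)) (a : ℝ) :
    ∀ᵐ r : ℝ ∂radialMeasure, |ψ r - a * groundState m₀ r| ≤
      h1Norm m₀ (fun r => ((ψ r - a * groundState m₀ r : ℝ) : ℂ)) := by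
  obtain ⟨Q, hQ, hQ0⟩ := h.exists_profile
  set c : ℝ := a * (√2 / √(m₀.factorial : ℝ)) with hc
  set P : Fin 7 → L2r := Q - (c : ℂ) • gaussVec m₀ 0 with hP
  have hPc : P ∈ (profileSpace ((m₀ : ℤ) : ℝ)).topologicalClosure :=
    Submodule.sub_mem _ hQ (Submodule.smul_mem _ _ (subset_closure (gaussVec_mem _ 0)))
  have hP0 : P 0 =ᵐ[radialMeasure] fun r => ((ψ r - a * groundState m₀ r : ℝ) : ℂ) := by
    have e : P 0 = Q 0 - (c : ℂ) • gaussVec m₀ 0 0 := rfl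
    rw [e]
    filter_upwards [hQ0, coeFn_gaussVec m₀ 0 0, Lp.coeFn_sub (Q 0) ((c : ℂ) • gaussVec m₀ 0 0),
      Lp.coeFn_smul (c : ℂ) (gaussVec m₀ 0 0)] with r e1 e2 e3 e4
    have e5 : gaussProfile m₀ 0 0 r = gaussMono m₀ r := rfl
    rw [e3, Pi.sub_apply, e4, Pi.smul_apply, e1, e2, groundState_eq, e5, hc]
    push_cast
    rw [smul_eq_mul]
    ring
  obtain ⟨hmem, -, -, d1, q3⟩ := memH2_of_mem_closure hPc
  have d1' := (hmem.derivs.fst.weakDeriv_congr hP0).symm.trans d1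
  have q3' : angularGrad m₀ (fun r => ((ψ r - a * groundState m₀ r : ℝ) : ℂ))
      =ᵐ[radialMeasure] P 3 := by
    filter_upwards [q3, hP0] with r e1 e2
    rw [← e1, angularGrad, angularGrad, e2]
  rw [h1Norm, l2rNorm_congr d1', l2rNorm_congr q3', l2rNorm_coe, l2rNorm_coe]
  have hm1 : (1 : ℝ) ≤ ((m₀ : ℤ) : ℝ) ^ 2 := by
    have : (1 : ℝ) ≤ m₀ := by exact_mod_cast hm₀
    push_cast
    nlinarith
  filter_upwards [norm_sq_le_of_mem_closure hm1 hPc, hP0] with r e1 e2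
  rw [e2, Complex.norm_real, Real.norm_eq_abs] at e1
  refine Real.le_sqrt_of_sq_le (e1.trans ?_)
  have := sq_nonneg (l2rNorm fun r => ((ψ r - a * groundState m₀ r : ℝ) : ℂ))
  linarith

theorem exists_bound_groundState (m₀ : ℕ) : ∃ C : ℝ, ∀ r > 0, |groundState m₀ r| ≤ C := by
  have hC : ∀ r ∈ Ici (0 : ℝ), |gaussMono m₀ r| ≤ m₀.factorial * Real.exp (1 / 2) := by
    intro r hr
    have hr0 : 0 ≤ r := hr
    have h1 := Real.pow_div_factorial_le_exp r hr0 m₀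
    rw [div_le_iff₀ (by positivity)] at h1
    rw [gaussMono, abs_of_nonneg (by positivity)]
    calc r ^ m₀ * Real.exp (-r ^ 2 / 2) ≤
        Real.exp r * m₀.factorial * Real.exp (-r ^ 2 / 2) := by gcongr
      _ = m₀.factorial * Real.exp (r + -r ^ 2 / 2) := by rw [Real.exp_add]; ring
      _ ≤ _ := by
        gcongr
        nlinarith [sq_nonneg (r - 1)]
  refine ⟨|√2 / √(m₀.factorial : ℝ)| * (m₀.factorial * Real.exp (1 / 2)), fun r hr => ?_⟩
  rw [groundState_eq, abs_mul]
  gcongr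
  exact hC r hr.le

/-- The primary branch is small in `L^∞`. -/
theorem IsPrimaryBranch.eventually_abs_le {m₀ : ℕ} (hm₀ : 1 ≤ m₀) {ψ : ℝ → ℝ → ℝ} {ω : ℝ → ℝ}
    (h : IsPrimaryBranch m₀ ψ ω) {κ : ℝ} (hκ : 0 < κ) :
    ∀ᶠ a in 𝓝[>] (0 : ℝ), ∀ᵐ r : ℝ ∂radialMeasure, |ψ a r| ≤ κ := by
  obtain ⟨C, hC⟩ := exists_bound_groundState m₀
  have t1 : Tendsto (fun a : ℝ => a ^ 3) (𝓝[>] 0) (𝓝 0) := by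
    have : Tendsto (fun a : ℝ => a ^ 3) (𝓝 0) (𝓝 (0 ^ 3)) := (continuous_pow 3).tendsto 0
    simpa using this.mono_left nhdsWithin_le_nhds
  have t2 := h.profile.trans_tendsto t1
  have t3 : Tendsto (fun a : ℝ => a * C) (𝓝[>] 0) (𝓝 0) := by
    have : Tendsto (fun a : ℝ => a * C) (𝓝 0) (𝓝 (0 * C)) := (continuous_mul_const C).tendsto 0
    simpa using this.mono_left nhdsWithin_le_nhds
  have t4 := t3.add t2
  rw [add_zero] at t4
  filter_upwards [h.mem, t4.eventually (gt_mem_nhds hκ), self_mem_nhdsWithin] with a h1 h2 ha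
  filter_upwards [h1.norm_sub_groundState_le hm₀ a, ae_pos_radialMeasure] with r h3 hr
  have ha0 : 0 < a := ha
  have h4 : |a * groundState m₀ r| ≤ a * C := by
    rw [abs_mul, abs_of_pos ha0]
    gcongr
    exact hC r hr
  have h5 : |ψ a r| ≤ |ψ a r - a * groundState m₀ r| + |a * groundState m₀ r| := by
    have := abs_add_le (ψ a r - a * groundState m₀ r) (a * groundState m₀ r)
    rwa [sub_add_cancel] at this
  linarith

theorem IsPrimaryBranch.tendsto_frequency {m₀ : ℕ} {ψ : ℝ → ℝ → ℝ} {ω : ℝ → ℝ}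
    (h : IsPrimaryBranch m₀ ψ ω) : Tendsto ω (𝓝[>] 0) (𝓝 (2 * ((m₀ : ℝ) + 1))) := by
  have t1 : Tendsto (fun a : ℝ => a ^ 4) (𝓝[>] 0) (𝓝 0) := by
    have : Tendsto (fun a : ℝ => a ^ 4) (𝓝 0) (𝓝 (0 ^ 4)) := (continuous_pow 4).tendsto 0
    simpa using this.mono_left nhdsWithin_le_nhds
  have t2 := h.frequency.trans_tendsto t1
  set J := ∫ r, groundState m₀ r ^ 4 ∂radialMeasure
  have t3 : Tendsto (fun a : ℝ => 2 * ((m₀ : ℝ) + 1) + a ^ 2 * J) (𝓝[>] 0)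
      (𝓝 (2 * ((m₀ : ℝ) + 1))) := by
    have : Tendsto (fun a : ℝ => 2 * ((m₀ : ℝ) + 1) + a ^ 2 * J) (𝓝 0)
        (𝓝 (2 * ((m₀ : ℝ) + 1) + 0 ^ 2 * J)) :=
      (by fun_prop : Continuous fun a : ℝ => 2 * ((m₀ : ℝ) + 1) + a ^ 2 * J).tendsto 0
    simpa using this.mono_left nhdsWithin_le_nhds
  simpa using t2.add t3

end SupBound

/-! ### Multiplication operators on `L²_r`. -/

section Multiplication

/-- Multiplication by a bounded real function. -/
theorem exists_mulOperator {s : ℝ → ℝ} (hs : AEStronglyMeasurable s radialMeasure) {κ : ℝ}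
    (hκ : ∀ᵐ r : ℝ ∂radialMeasure, |s r| ≤ κ) :
    ∃ M : L2r →L[ℂ] L2r, (∀ V, M V =ᵐ[radialMeasure] fun r => (s r : ℂ) * V r) ∧
      (∀ V, ‖M V‖ ≤ κ * ‖V‖) ∧ ∀ V W, (inner ℂ (M V) W : ℂ) = inner ℂ V (M W) := by
  have hm : ∀ V : L2r, MemLp (fun r => (s r : ℂ) * V r) 2 radialMeasure := fun V => by
    refine (Lp.memLp V).of_le_mul (c := κ)
      ((Complex.continuous_ofReal.comp_aestronglyMeasurable hs).mul (Lp.aestronglyMeasurable V)) ?_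
    filter_upwards [hκ] with r hr
    rw [norm_mul, Complex.norm_real, Real.norm_eq_abs]
    gcongr
  have hb : ∀ V, ‖(hm V).toLp _‖ ≤ κ * ‖V‖ := fun V => by
    refine Lp.norm_le_mul_norm_of_ae_le_mul ?_
    filter_upwards [hκ, (hm V).coeFn_toLp] with r hr h1
    rw [h1, norm_mul, Complex.norm_real, Real.norm_eq_abs]
    gcongr
  refine ⟨LinearMap.mkContinuous
    { toFun := fun V => (hm V).toLp _
      map_add' := fun V W => ?_
      map_smul' := fun c V => ?_ } κ hb, fun V => (hm V).coeFn_toLp, hb, fun V W => ?_⟩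
  · refine Lp.ext ?_
    filter_upwards [(hm (V + W)).coeFn_toLp, (hm V).coeFn_toLp, (hm W).coeFn_toLp,
      Lp.coeFn_add V W, Lp.coeFn_add ((hm V).toLp _) ((hm W).toLp _)] with r h1 h2 h3 h4 h5
    rw [h1, h5, h4, Pi.add_apply, Pi.add_apply, h2, h3, mul_add]
  · refine Lp.ext ?_
    filter_upwards [(hm (c • V)).coeFn_toLp, (hm V).coeFn_toLp,
      Lp.coeFn_smul c V, Lp.coeFn_smul c ((hm V).toLp _)] with r h1 h2 h3 h4
    rw [h1, RingHom.id_apply, h4, h3, Pi.smul_apply, Pi.smul_apply, h2, smul_eq_mul, smul_eq_mul]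
    ring
  · rw [L2.inner_def, L2.inner_def]
    refine integral_congr_ae ?_
    filter_upwards [(hm V).coeFn_toLp, (hm W).coeFn_toLp] with r h1 h2
    change inner ℂ ((hm V).toLp _ r) (W r) = inner ℂ (V r) ((hm W).toLp _ r)
    rw [h1, h2, RCLike.inner_apply, RCLike.inner_apply, map_mul, Complex.conj_ofReal]
    ring

end Multiplication

/-! ### Diagonal entries of the unperturbed block and their uniform gap. -/

section Diagonal

/-- The diagonal entries of the block for `ψ = 0`. -/
def blockDiag (m₀ : ℕ) (m : ℤ) (Ω : ℝ) : ℕ ⊕ ℕ → ℝ :=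
  Sum.elim (fun n => oscEigenvalue m n - 2 * ((m₀ : ℝ) + 1) - Ω * (m - m₀))
    (fun n => oscEigenvalue (m - 2 * m₀) n - 2 * ((m₀ : ℝ) + 1) + Ω * (m - m₀))

theorem one_le_sub_of_lt {m₀ : ℕ} {m : ℤ} (hm : (m₀ : ℤ) < m) : (1 : ℝ) ≤ (m : ℝ) - m₀ := by
  have : (m₀ : ℤ) + 1 ≤ m := hm
  have h : (m₀ : ℝ) + 1 ≤ m := by exact_mod_cast this
  linarith

/-- Since `|m| = m`, the oscillator eigenvalue exceeds the limit frequency by `2(m - m₀) + 4n`: with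
`Ω < 2` the `V` side never contributes a negative or critical entry. -/
theorem blockDiag_inl {m₀ : ℕ} {m : ℤ} (hm : (m₀ : ℤ) < m) (Ω : ℝ) (n : ℕ) :
    blockDiag m₀ m Ω (Sum.inl n) = (2 - Ω) * (m - m₀) + 4 * n := by
  have h : (m.natAbs : ℝ) = m := by
    rw [Nat.cast_natAbs, abs_of_nonneg (by omega)]
  rw [blockDiag, Sum.elim_inl, oscEigenvalue, h]
  ring

theorem limitFreq_mul {m₀ : ℕ} {m : ℤ} (hm : (m₀ : ℤ) < m) (n : ℕ) :
    limitFreq m₀ m n * (m - m₀) = 2 * ((m₀ : ℝ) - |(m : ℝ) - 2 * m₀|) - 4 * n := by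
  have h : (m : ℝ) - m₀ ≠ 0 := by linarith [one_le_sub_of_lt hm]
  rw [limitFreq]
  field_simp

/-- The numbers `Ω_{m,n}(0)` are the zeros of the `W` entries. These increase with `Ω`, which is why
negative directions are lost upwards. -/
theorem blockDiag_inr {m₀ : ℕ} {m : ℤ} (hm : (m₀ : ℤ) < m) (Ω : ℝ) (n : ℕ) :
    blockDiag m₀ m Ω (Sum.inr n) = (Ω - limitFreq m₀ m n) * (m - m₀) := by
  have h : ((m - 2 * m₀).natAbs : ℝ) = |(m : ℝ) - 2 * m₀| := by
    rw [Nat.cast_natAbs, Int.cast_abs]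
    push_cast
    rfl
  rw [sub_mul, limitFreq_mul hm, blockDiag, Sum.elim_inr, oscEigenvalue, h]
  ring

theorem limitFreq_nonpos {m₀ : ℕ} {m : ℤ} (hm : (m₀ : ℤ) < m) {n : ℕ}
    (h : 3 * (m₀ : ℤ) ≤ m ∨ m₀ ≤ n) : limitFreq m₀ m n ≤ 0 := by
  have h1 := limitFreq_mul hm n
  have h2 := one_le_sub_of_lt hm
  have h3 : limitFreq m₀ m n * (m - m₀) ≤ 0 := by
    rw [h1]
    rcases h with h | h
    · have h4 : 3 * (m₀ : ℝ) ≤ m := by exact_mod_cast h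
      linarith [le_abs_self ((m : ℝ) - 2 * m₀), (Nat.cast_nonneg n : (0 : ℝ) ≤ n)]
    · have h4 : (m₀ : ℝ) ≤ n := by exact_mod_cast h
      linarith [abs_nonneg ((m : ℝ) - 2 * m₀), (Nat.cast_nonneg m₀ : (0 : ℝ) ≤ m₀)]
  by_contra! h4
  nlinarith

/-- The indices of the negative diagonal entries at `Ω₀`. -/
def negIndices (m₀ : ℕ) (m : ℤ) (Ω₀ : ℝ) : Finset (ℕ ⊕ ℕ) :=
  ((Finset.range m₀).filter fun n => Ω₀ < limitFreq m₀ m n).map Function.Embedding.inr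

theorem mem_negIndices_inr {m₀ : ℕ} {m : ℤ} (hm : (m₀ : ℤ) < m) {Ω₀ : ℝ} (h0 : 0 < Ω₀) {n : ℕ} :
    Sum.inr n ∈ negIndices m₀ m Ω₀ ↔ Ω₀ < limitFreq m₀ m n := by
  simp only [negIndices, Finset.mem_map, Finset.mem_filter, Finset.mem_range,
    Function.Embedding.inr_apply, Sum.inr.injEq, exists_eq_right, and_iff_right_iff_imp]
  intro h
  by_contra! h1
  linarith [limitFreq_nonpos hm (Or.inr h1)]

theorem inl_notMem_negIndices {m₀ : ℕ} {m : ℤ} {Ω₀ : ℝ} {n : ℕ} :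
    Sum.inl n ∉ negIndices m₀ m Ω₀ := by
  simp [negIndices]

theorem exists_pos_le_abs {α : Type*} (s : Finset α) (f : α → ℝ) :
    ∃ c > 0, ∀ x ∈ s, f x ≠ 0 → c ≤ |f x| := by
  classical
  induction s using Finset.induction_on with
  | empty => exact ⟨1, one_pos, by simp⟩
  | insert x s _ ih =>
    obtain ⟨c, hc, h⟩ := ih
    by_cases hx : f x = 0
    · refine ⟨c, hc, fun y hy hy0 => ?_⟩
      rcases Finset.mem_insert.1 hy with rfl | hy
      · exact absurd hx hy0
      · exact h y hy hy0
    · refine ⟨min c |f x|, lt_min hc (abs_pos.2 hx), fun y hy hy0 => ?_⟩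
      rcases Finset.mem_insert.1 hy with rfl | hy
      · exact min_le_right _ _
      · exact (min_le_left _ _).trans (h y hy hy0)

/-- Outside a finite box of indices the limit frequency is at most zero, hence at distance at least
`Ω₀` from `Ω₀`; inside the box the minimum is over finitely many nonzero numbers. -/
theorem exists_limitFreq_gap (m₀ : ℕ) {Ω₀ : ℝ} (h0 : 0 < Ω₀) :
    ∃ c > 0, ∀ m : ℤ, (m₀ : ℤ) < m → ∀ n, limitFreq m₀ m n ≠ Ω₀ →
      c ≤ |Ω₀ - limitFreq m₀ m n| := by
  obtain ⟨c, hc, h⟩ := exists_pos_le_abs (Finset.Ioo (m₀ : ℤ) (3 * m₀) ×ˢ Finset.range m₀)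
    fun x => Ω₀ - limitFreq m₀ x.1 x.2
  refine ⟨min c Ω₀, lt_min hc h0, fun m hm n hn => ?_⟩
  by_cases h1 : 3 * (m₀ : ℤ) ≤ m ∨ m₀ ≤ n
  · have h2 := limitFreq_nonpos hm h1
    exact (min_le_right _ _).trans (le_trans (by linarith) (le_abs_self _))
  · push Not at h1
    exact (min_le_left _ _).trans (h (m, n) (by simp [hm, h1.1, h1.2]) (sub_ne_zero.2 hn.symm))

/-- The diagonal entries have a gap around zero, uniformly in `m`, apart from those which vanish
at `Ω₀`. -/
theorem exists_blockDiag_gap (m₀ : ℕ) {Ω₀ : ℝ} (hΩ₀ : Ω₀ ∈ Ioo (0 : ℝ) 2) :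
    ∃ c > 0, ∀ m : ℤ, (m₀ : ℤ) < m → ∀ Ω, |Ω - Ω₀| ≤ c / 4 →
      (∀ i ∈ negIndices m₀ m Ω₀, blockDiag m₀ m Ω i ≤ -(c / 2 * (m - m₀))) ∧
      ∀ i ∉ negIndices m₀ m Ω₀, (∀ n, i = Sum.inr n → limitFreq m₀ m n ≠ Ω₀) →
        c / 2 * (m - m₀) ≤ blockDiag m₀ m Ω i := by
  obtain ⟨c, hc, h⟩ := exists_limitFreq_gap m₀ hΩ₀.1
  have hc2 : 0 < 2 - Ω₀ := by linarith [hΩ₀.2]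
  refine ⟨min c (2 - Ω₀), lt_min hc hc2, fun m hm Ω hΩ => ?_⟩
  set c' := min c (2 - Ω₀) with hc'
  have hc0 : 0 < c' := lt_min hc hc2
  have k1 : c' ≤ c := min_le_left _ _
  have k2 : c' ≤ 2 - Ω₀ := min_le_right _ _
  have hμ := one_le_sub_of_lt hm
  have hμ0 : (0 : ℝ) ≤ m - m₀ := by linarith
  obtain ⟨a1, a2⟩ := abs_le.1 hΩ
  constructor
  · rintro (n | n) hi
    · exact absurd hi inl_notMem_negIndices
    · have h1 := (mem_negIndices_inr hm hΩ₀.1).1 hi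
      have h2 := h m hm n h1.ne'
      rw [abs_of_neg (by linarith)] at h2
      rw [blockDiag_inr hm, ← neg_mul]
      refine mul_le_mul_of_nonneg_right ?_ hμ0
      linarith
  · rintro (n | n) hi hne
    · rw [blockDiag_inl hm]
      have h1 : c' / 2 * ((m : ℝ) - m₀) ≤ (2 - Ω) * (m - m₀) :=
        mul_le_mul_of_nonneg_right (by linarith) hμ0
      have h2 : (0 : ℝ) ≤ n := Nat.cast_nonneg n
      linarith
    · rw [mem_negIndices_inr hm hΩ₀.1, not_lt] at hi
      have h2 := h m hm n (hne n rfl)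
      rw [abs_of_nonneg (by linarith)] at h2
      rw [blockDiag_inr hm]
      exact mul_le_mul_of_nonneg_right (by linarith) hμ0

end Diagonal

/-! ### The space of pairs, its basis and the perturbation. -/

section Block

/-- The Hilbert space of pairs. -/
abbrev Pair : Type := WithLp 2 (L2r × L2r)

theorem norm_sq_pair (x : Pair) : ‖x‖ ^ 2 = ‖x.fst‖ ^ 2 + ‖x.snd‖ ^ 2 :=
  WithLp.prod_norm_sq_eq_of_L2 x

theorem inner_pair (x y : Pair) : (inner ℂ x y : ℂ) = inner ℂ x.fst y.fst + inner ℂ x.snd y.snd :=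
  WithLp.prod_inner_apply x y

theorem norm_le_of_norm_sq {x : Pair} {c : ℝ} (hc : 0 ≤ c) {y : Pair}
    (h : ‖x.fst‖ ^ 2 + ‖x.snd‖ ^ 2 ≤ c ^ 2 * (‖y.fst‖ ^ 2 + ‖y.snd‖ ^ 2)) : ‖x‖ ≤ c * ‖y‖ := by
  rw [← norm_sq_pair, ← norm_sq_pair, ← mul_pow] at h
  exact (sq_le_sq₀ (norm_nonneg _) (by positivity)).1 h

/-- The orthonormal family of pairs built from two Hilbert bases. -/
def pairVec (m m' : ℤ) : ℕ ⊕ ℕ → Pair :=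
  Sum.elim (fun n => WithLp.toLp 2 (oscBasis m n, 0)) (fun n => WithLp.toLp 2 (0, oscBasis m' n))

theorem inner_pairVec_inl (m m' : ℤ) (n : ℕ) (x : Pair) :
    (inner ℂ (pairVec m m' (Sum.inl n)) x : ℂ) = inner ℂ (oscBasis m n) x.fst := by
  rw [inner_pair]
  change inner ℂ (oscBasis m n) x.fst + inner ℂ (0 : L2r) x.snd = _
  rw [inner_zero_left, add_zero]

theorem inner_pairVec_inr (m m' : ℤ) (n : ℕ) (x : Pair) :
    (inner ℂ (pairVec m m' (Sum.inr n)) x : ℂ) = inner ℂ (oscBasis m' n) x.snd := by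
  rw [inner_pair]
  change inner ℂ (0 : L2r) x.fst + inner ℂ (oscBasis m' n) x.snd = _
  rw [inner_zero_left, zero_add]

theorem orthonormal_pairVec (m m' : ℤ) : Orthonormal ℂ (pairVec m m') := by
  classical
  rw [orthonormal_iff_ite]
  rintro (n | n) (k | k)
  · rw [inner_pairVec_inl]
    change inner ℂ (oscBasis m n) (oscBasis m k) = _
    simpa using HilbertBasis.inner_self_or_zero (oscBasis m) n k
  · rw [inner_pairVec_inl]
    change inner ℂ (oscBasis m n) (0 : L2r) = _
    simp
  · rw [inner_pairVec_inr]
    change inner ℂ (oscBasis m' n) (0 : L2r) = _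
    simp
  · rw [inner_pairVec_inr]
    change inner ℂ (oscBasis m' n) (oscBasis m' k) = _
    simpa using HilbertBasis.inner_self_or_zero (oscBasis m') n k

theorem span_pairVec_orthogonal (m m' : ℤ) :
    (Submodule.span ℂ (range (pairVec m m')))ᗮ = ⊥ := by
  rw [Submodule.eq_bot_iff]
  intro x hx
  have h : ∀ i, (inner ℂ (pairVec m m' i) x : ℂ) = 0 := fun i =>
    (Submodule.mem_orthogonal _ _).1 hx _ (Submodule.subset_span ⟨i, rfl⟩)
  have h1 : x.fst = 0 := HilbertBasis.eq_zero_of_forall_inner (oscBasis m) fun n => by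
    rw [← inner_pairVec_inl m m', h]
  have h2 : x.snd = 0 := HilbertBasis.eq_zero_of_forall_inner (oscBasis m') fun n => by
    rw [← inner_pairVec_inr m m', h]
  have h3 := norm_sq_pair x
  rw [h1, h2] at h3
  simpa using h3

/-- The Hilbert basis of pairs built from two Hilbert bases. -/
def pairBasis (m m' : ℤ) : HilbertBasis (ℕ ⊕ ℕ) ℂ Pair :=
  HilbertBasis.mkOfOrthogonalEqBot (orthonormal_pairVec m m') (span_pairVec_orthogonal m m')

theorem inner_pairBasis_inl (m m' : ℤ) (n : ℕ) (x : Pair) :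
    (inner ℂ (pairBasis m m' (Sum.inl n)) x : ℂ) = inner ℂ (oscBasis m n) x.fst := by
  rw [pairBasis, HilbertBasis.coe_mkOfOrthogonalEqBot, inner_pairVec_inl]

theorem inner_pairBasis_inr (m m' : ℤ) (n : ℕ) (x : Pair) :
    (inner ℂ (pairBasis m m' (Sum.inr n)) x : ℂ) = inner ℂ (oscBasis m' n) x.snd := by
  rw [pairBasis, HilbertBasis.coe_mkOfOrthogonalEqBot, inner_pairVec_inr]

/-- The operator on pairs with the given matrix of operators. -/
def matrixOperator (A B C D : L2r →L[ℂ] L2r) : Pair →L[ℂ] Pair :=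
  (WithLp.prodContinuousLinearEquiv 2 ℂ L2r L2r).symm.toContinuousLinearMap ∘L
    (((A ∘L ContinuousLinearMap.fst ℂ L2r L2r) + (B ∘L ContinuousLinearMap.snd ℂ L2r L2r)).prod
      ((C ∘L ContinuousLinearMap.fst ℂ L2r L2r) + (D ∘L ContinuousLinearMap.snd ℂ L2r L2r))) ∘L
    (WithLp.prodContinuousLinearEquiv 2 ℂ L2r L2r).toContinuousLinearMap

theorem matrixOperator_fst (A B C D : L2r →L[ℂ] L2r) (x : Pair) :
    (matrixOperator A B C D x).fst = A x.fst + B x.snd := rfl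

theorem matrixOperator_snd (A B C D : L2r →L[ℂ] L2r) (x : Pair) :
    (matrixOperator A B C D x).snd = C x.fst + D x.snd := rfl

/-- The perturbation `ψ² [2, 1; 1, 2] - c`, where `M` is the multiplication by `ψ²`. -/
def perturbation (M : L2r →L[ℂ] L2r) (c : ℝ) : Pair →L[ℂ] Pair :=
  matrixOperator ((2 : ℂ) • M - (c : ℂ) • ContinuousLinearMap.id ℂ L2r) M M
    ((2 : ℂ) • M - (c : ℂ) • ContinuousLinearMap.id ℂ L2r)

/-- The reflection `diag(1, -1)`. -/
def reflection : Pair →L[ℂ] Pair :=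
  matrixOperator (ContinuousLinearMap.id ℂ L2r) 0 0 (-ContinuousLinearMap.id ℂ L2r)

theorem perturbation_fst (M : L2r →L[ℂ] L2r) (c : ℝ) (x : Pair) :
    (perturbation M c x).fst = (2 : ℂ) • M x.fst - (c : ℂ) • x.fst + M x.snd := rfl

theorem perturbation_snd (M : L2r →L[ℂ] L2r) (c : ℝ) (x : Pair) :
    (perturbation M c x).snd = M x.fst + ((2 : ℂ) • M x.snd - (c : ℂ) • x.snd) := rfl

theorem reflection_fst (x : Pair) : (reflection x).fst = x.fst := by
  rw [reflection, matrixOperator_fst]; simp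

theorem reflection_snd (x : Pair) : (reflection x).snd = -x.snd := by
  rw [reflection, matrixOperator_snd]; simp

theorem norm_reflection (x : Pair) : ‖reflection x‖ ≤ ‖x‖ := by
  have := norm_le_of_norm_sq (x := reflection x) (c := 1) zero_le_one (y := x)
    (by rw [reflection_fst, reflection_snd, norm_neg]; simp)
  simpa using this

theorem inner_perturbation {M : L2r →L[ℂ] L2r}
    (hM : ∀ V W, (inner ℂ (M V) W : ℂ) = inner ℂ V (M W)) (c : ℝ) (x y : Pair) :
    (inner ℂ (perturbation M c x) y : ℂ) = inner ℂ x (perturbation M c y) := by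
  rw [inner_pair, inner_pair, perturbation_fst, perturbation_fst, perturbation_snd,
    perturbation_snd]
  simp only [inner_add_left, inner_add_right, inner_sub_left, inner_sub_right, inner_smul_left,
    inner_smul_right, hM, Complex.conj_ofReal, map_ofNat]
  ring

theorem norm_perturbation_le {M : L2r →L[ℂ] L2r} {κ : ℝ} (hκ : 0 ≤ κ)
    (hM : ∀ V, ‖M V‖ ≤ κ * ‖V‖) (c : ℝ) (x : Pair) :
    ‖perturbation M c x‖ ≤ (|c| + 3 * κ) * ‖x‖ := by
  have h1 : ∀ V, ‖(2 : ℂ) • M V - (c : ℂ) • V‖ ≤ (|c| + 2 * κ) * ‖V‖ := fun V => by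
    refine (norm_sub_le _ _).trans ?_
    rw [norm_smul, norm_smul, Complex.norm_real, Real.norm_eq_abs, Complex.norm_ofNat]
    nlinarith [hM V]
  refine norm_le_of_norm_sq (by positivity) ?_
  set v := ‖x.fst‖
  set w := ‖x.snd‖
  have h2 : ‖(perturbation M c x).fst‖ ≤ (|c| + 2 * κ) * v + κ * w := by
    rw [perturbation_fst]
    exact (norm_add_le _ _).trans (add_le_add (h1 _) (hM _))
  have h3 : ‖(perturbation M c x).snd‖ ≤ κ * v + (|c| + 2 * κ) * w := by
    rw [perturbation_snd]
    exact (norm_add_le _ _).trans (add_le_add (hM _) (h1 _))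
  calc _ ≤ ((|c| + 2 * κ) * v + κ * w) ^ 2 + (κ * v + (|c| + 2 * κ) * w) ^ 2 := by gcongr
    _ ≤ _ := by
      -- The matrix with diagonal `p = |c| + 2κ` and off-diagonal `κ` has norm `p + κ`; the defect
      -- in the inequality is exactly `2 p κ (v - w)²`.
      have : 0 ≤ 2 * ((|c| + 2 * κ) * κ) * (v - w) ^ 2 := by positivity
      nlinarith

end Block

/-! ### The operator `H_m` as a perturbed diagonal relation. -/

section Maps

theorem memH2_and_oscillator_iff {m : ℤ} {V f : L2r} :
    (MemH2 m V ∧ ∀ᵐ r : ℝ ∂radialMeasure, -radialLaplacian m V r + (r : ℂ) ^ 2 * V r = f r) ↔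
      ∀ n, (inner ℂ (oscBasis m n) f : ℂ) = oscEigenvalue m n * inner ℂ (oscBasis m n) V :=
  ⟨fun h n => inner_oscBasis h.1 h.2 n, fun h =>
    ⟨(memH2_of_inner_oscBasis h).1, (memH2_of_inner_oscBasis h).2.1⟩⟩

variable {m₀ : ℕ} {ψ : ℝ → ℝ} {ω : ℝ} {M : L2r →L[ℂ] L2r}

theorem coeFn_shift (x y z : L2r) (a : ℂ) :
    ⇑(x - y + a • z) =ᵐ[radialMeasure] fun r => x r - y r + a * z r := by
  filter_upwards [Lp.coeFn_add (x - y) (a • z), Lp.coeFn_sub x y, Lp.coeFn_smul a z]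
    with r h1 h2 h3
  rw [h1, Pi.add_apply, h2, h3]
  rfl

theorem coeFn_perturbation (hM : ∀ V, M V =ᵐ[radialMeasure] fun r => ((ψ r ^ 2 : ℝ) : ℂ) * V r)
    (c : ℝ) (x : Pair) :
    ((perturbation M c x).fst =ᵐ[radialMeasure] fun r =>
      2 * (ψ r : ℂ) ^ 2 * x.fst r - c * x.fst r + (ψ r : ℂ) ^ 2 * x.snd r) ∧
    ((perturbation M c x).snd =ᵐ[radialMeasure] fun r =>
      (ψ r : ℂ) ^ 2 * x.fst r + (2 * (ψ r : ℂ) ^ 2 * x.snd r - c * x.snd r)) := by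
  constructor
  · rw [perturbation_fst]
    filter_upwards [hM x.fst, hM x.snd, coeFn_const_smul_sub 2 c (M x.fst) x.fst,
      Lp.coeFn_add ((2 : ℂ) • M x.fst - (c : ℂ) • x.fst) (M x.snd)] with r h1 h2 h3 h4
    rw [h4, Pi.add_apply, h3, h1, h2]
    push_cast
    ring
  · rw [perturbation_snd]
    filter_upwards [hM x.fst, hM x.snd, coeFn_const_smul_sub 2 c (M x.snd) x.snd,
      Lp.coeFn_add (M x.fst) ((2 : ℂ) • M x.snd - (c : ℂ) • x.snd)] with r h1 h2 h3 h4
    rw [h4, Pi.add_apply, h3, h1, h2]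
    push_cast
    ring

/-- The block `H_m` in terms of the oscillators. -/
theorem maps_iff_oscillator
    (hM : ∀ V, M V =ᵐ[radialMeasure] fun r => ((ψ r ^ 2 : ℝ) : ℂ) * V r) (m : ℤ) (Ω : ℝ)
    (x y : Pair) :
    Maps m₀ ψ ω m Ω (x.fst, x.snd) (y.fst, y.snd) ↔
      (∀ n, (inner ℂ (oscBasis m n) (y.fst - (perturbation M (ω - 2 * ((m₀ : ℝ) + 1)) x).fst
        + ((2 * ((m₀ : ℝ) + 1) + Ω * (m - m₀) : ℝ) : ℂ) • x.fst) : ℂ)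
        = oscEigenvalue m n * inner ℂ (oscBasis m n) x.fst) ∧
      (∀ n, (inner ℂ (oscBasis (m - 2 * m₀) n)
        (y.snd - (perturbation M (ω - 2 * ((m₀ : ℝ) + 1)) x).snd
        + ((2 * ((m₀ : ℝ) + 1) - Ω * (m - m₀) : ℝ) : ℂ) • x.snd) : ℂ)
        = oscEigenvalue (m - 2 * m₀) n * inner ℂ (oscBasis (m - 2 * m₀) n) x.snd) := by
  obtain ⟨p1, p2⟩ := coeFn_perturbation hM (ω - 2 * ((m₀ : ℝ) + 1)) x
  rw [← memH2_and_oscillator_iff, ← memH2_and_oscillator_iff, Maps, and_and_and_comm, ← and_assoc,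
    and_assoc]
  have a1 : ((blockH m₀ ψ ω m Ω x.fst x.snd).1 =ᵐ[radialMeasure] y.fst) ↔
      ∀ᵐ r : ℝ ∂radialMeasure, -radialLaplacian m x.fst r + (r : ℂ) ^ 2 * x.fst r =
        (y.fst - (perturbation M (ω - 2 * ((m₀ : ℝ) + 1)) x).fst
        + ((2 * ((m₀ : ℝ) + 1) + Ω * (m - m₀) : ℝ) : ℂ) • x.fst) r := by
    refine eventually_congr ?_
    filter_upwards [p1, coeFn_shift y.fst (perturbation M (ω - 2 * ((m₀ : ℝ) + 1)) x).fst x.fst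
      ((2 * ((m₀ : ℝ) + 1) + Ω * (m - m₀) : ℝ) : ℂ)] with r h1 h2
    rw [h2, h1, blockH, blockK]
    push_cast
    constructor <;> intro h <;> linear_combination h
  have a2 : ((blockH m₀ ψ ω m Ω x.fst x.snd).2 =ᵐ[radialMeasure] y.snd) ↔
      ∀ᵐ r : ℝ ∂radialMeasure, -radialLaplacian (m - 2 * m₀) x.snd r + (r : ℂ) ^ 2 * x.snd r =
        (y.snd - (perturbation M (ω - 2 * ((m₀ : ℝ) + 1)) x).snd
        + ((2 * ((m₀ : ℝ) + 1) - Ω * (m - m₀) : ℝ) : ℂ) • x.snd) r := by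
    refine eventually_congr ?_
    filter_upwards [p2, coeFn_shift y.snd (perturbation M (ω - 2 * ((m₀ : ℝ) + 1)) x).snd x.snd
      ((2 * ((m₀ : ℝ) + 1) - Ω * (m - m₀) : ℝ) : ℂ)] with r h1 h2
    rw [h2, h1, blockH, blockK]
    push_cast
    constructor <;> intro h <;> linear_combination h
  rw [a1, a2]
  tauto

/-- This transfers the abstract results: the graph of `H_m` on its concrete domain is the graph
defined by coefficients, hence self-adjoint. -/
theorem maps_iff_diagRel
    (hM : ∀ V, M V =ᵐ[radialMeasure] fun r => ((ψ r ^ 2 : ℝ) : ℂ) * V r) (m : ℤ) (Ω : ℝ)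
    (x y : Pair) :
    Maps m₀ ψ ω m Ω (x.fst, x.snd) (y.fst, y.snd) ↔
      (x, y) ∈ diagRel (pairBasis m (m - 2 * m₀)) (blockDiag m₀ m Ω)
        (perturbation M (ω - 2 * ((m₀ : ℝ) + 1))) := by
  rw [maps_iff_oscillator hM, mem_diagRel, Sum.forall]
  refine and_congr (forall_congr' fun n => ?_) (forall_congr' fun n => ?_)
  · rw [inner_pairBasis_inl, inner_pairBasis_inl, inner_pairBasis_inl, inner_add_right,
      inner_sub_right, inner_smul_right, blockDiag, Sum.elim_inl]
    push_cast
    constructor <;> intro h <;> linear_combination h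
  · rw [inner_pairBasis_inr, inner_pairBasis_inr, inner_pairBasis_inr, inner_add_right,
      inner_sub_right, inner_smul_right, blockDiag, Sum.elim_inr]
    push_cast
    constructor <;> intro h <;> linear_combination h

/-- The elliptic estimate for the block. -/
theorem h2NormSq_le_of_maps
    (hM : ∀ V, M V =ᵐ[radialMeasure] fun r => ((ψ r ^ 2 : ℝ) : ℂ) * V r) {m : ℤ} {Ω : ℝ} {x y : Pair}
    {ε : ℝ} (hε : ∀ z, ‖perturbation M (ω - 2 * ((m₀ : ℝ) + 1)) z‖ ≤ ε * ‖z‖)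
    (h : Maps m₀ ψ ω m Ω (x.fst, x.snd) (y.fst, y.snd)) :
    √(h2NormSq m x.fst + h2NormSq (m - 2 * m₀) x.snd) ≤
      2 * (‖y‖ + (ε + (2 * ((m₀ : ℝ) + 1) + |Ω * (m - m₀)|)) * ‖x‖) := by
  obtain ⟨h1, h2⟩ := (maps_iff_oscillator hM m Ω x y).1 h
  have e1 := (memH2_of_inner_oscBasis h1).2.2
  have e2 := (memH2_of_inner_oscBasis h2).2.2
  set c : ℝ := ω - 2 * ((m₀ : ℝ) + 1)
  set s : ℝ := Ω * (m - m₀)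
  set A : ℂ → L2r →L[ℂ] L2r := fun a => a • ContinuousLinearMap.id ℂ L2r with hA
  set D : Pair →L[ℂ] Pair := matrixOperator (A ((2 * ((m₀ : ℝ) + 1) + s : ℝ) : ℂ)) 0 0
    (A ((2 * ((m₀ : ℝ) + 1) - s : ℝ) : ℂ)) with hD
  have d1 : (D x).fst = ((2 * ((m₀ : ℝ) + 1) + s : ℝ) : ℂ) • x.fst := by
    rw [hD, matrixOperator_fst]; simp [hA]
  have d2 : (D x).snd = ((2 * ((m₀ : ℝ) + 1) - s : ℝ) : ℂ) • x.snd := by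
    rw [hD, matrixOperator_snd]; simp [hA]
  rw [← d1] at e1
  rw [← d2] at e2
  have hm0 : (0 : ℝ) ≤ 2 * ((m₀ : ℝ) + 1) := by positivity
  have hDx : ‖D x‖ ≤ (2 * ((m₀ : ℝ) + 1) + |s|) * ‖x‖ := by
    refine norm_le_of_norm_sq (by positivity) ?_
    have k1 : |2 * ((m₀ : ℝ) + 1) + s| ≤ 2 * ((m₀ : ℝ) + 1) + |s| := by
      rw [abs_le]; constructor <;> linarith [neg_abs_le s, le_abs_self s]
    have k2 : |2 * ((m₀ : ℝ) + 1) - s| ≤ 2 * ((m₀ : ℝ) + 1) + |s| := by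
      rw [abs_le]; constructor <;> linarith [neg_abs_le s, le_abs_self s]
    rw [d1, d2, norm_smul, norm_smul, Complex.norm_real, Complex.norm_real, Real.norm_eq_abs,
      Real.norm_eq_abs, mul_pow, mul_pow, mul_add (_ ^ 2)]
    exact add_le_add (mul_le_mul_of_nonneg_right (pow_le_pow_left₀ (abs_nonneg _) k1 2)
      (sq_nonneg _)) (mul_le_mul_of_nonneg_right (pow_le_pow_left₀ (abs_nonneg _) k2 2)
      (sq_nonneg _))
  set F : Pair := y - perturbation M c x + D x with hF
  have hFn : ‖F‖ ≤ ‖y‖ + (ε + (2 * ((m₀ : ℝ) + 1) + |s|)) * ‖x‖ := by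
    have k1 := norm_add_le (y - perturbation M c x) (D x)
    have k2 := norm_sub_le y (perturbation M c x)
    have k3 := hε x
    rw [add_mul]
    linarith
  have hsum : h2NormSq m x.fst + h2NormSq (m - 2 * m₀) x.snd ≤ 3 * ‖F‖ ^ 2 := by
    rw [norm_sq_pair F, mul_add]
    exact add_le_add e1 e2
  refine (Real.sqrt_le_sqrt hsum).trans ?_
  rw [Real.sqrt_le_left (by linarith [norm_nonneg F])]
  nlinarith [norm_nonneg F]

theorem invertible_of_diagRel
    (hM : ∀ V, M V =ᵐ[radialMeasure] fun r => ((ψ r ^ 2 : ℝ) : ℂ) * V r) {m : ℤ} {Ω : ℝ}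
    (h : ∀ q, ∃! p, (p, q) ∈ diagRel (pairBasis m (m - 2 * m₀)) (blockDiag m₀ m Ω)
        (perturbation M (ω - 2 * ((m₀ : ℝ) + 1)))) : Invertible m₀ ψ ω m Ω := by
  intro q
  obtain ⟨p, hp, hu⟩ := h (WithLp.toLp 2 q)
  refine ⟨(p.fst, p.snd), (maps_iff_diagRel hM m Ω p (WithLp.toLp 2 q)).2 hp, fun p' hp' => ?_⟩
  have := hu (WithLp.toLp 2 p') ((maps_iff_diagRel hM m Ω (WithLp.toLp 2 p') (WithLp.toLp 2 q)).1 hp')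
  rw [← this]
  rfl

theorem negCount_eq_of_diagRel
    (hM : ∀ V, M V =ᵐ[radialMeasure] fun r => ((ψ r ^ 2 : ℝ) : ℂ) * V r) (m : ℤ) (Ω : ℝ) :
    negCount m₀ ψ ω m Ω = Module.rank ℂ (Submodule.span ℂ
      {p : Pair | ∃ μ : ℝ, μ < 0 ∧ (p, (μ : ℂ) • p) ∈
        diagRel (pairBasis m (m - 2 * m₀)) (blockDiag m₀ m Ω)
        (perturbation M (ω - 2 * ((m₀ : ℝ) + 1)))}) := by
  set e : Pair ≃ₗ[ℂ] L2r × L2r := WithLp.linearEquiv 2 ℂ (L2r × L2r)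
  have hset : {p : L2r × L2r | ∃ μ : ℝ, μ < 0 ∧ Maps m₀ ψ ω m Ω p ((μ : ℂ) • p)} =
      e '' {p : Pair | ∃ μ : ℝ, μ < 0 ∧ (p, (μ : ℂ) • p) ∈
        diagRel (pairBasis m (m - 2 * m₀)) (blockDiag m₀ m Ω)
        (perturbation M (ω - 2 * ((m₀ : ℝ) + 1)))} := by
    ext p
    constructor
    · rintro ⟨μ, hμ, h⟩
      exact ⟨WithLp.toLp 2 p, ⟨μ, hμ, (maps_iff_diagRel hM m Ω (WithLp.toLp 2 p)
        ((μ : ℂ) • WithLp.toLp 2 p)).1 h⟩, rfl⟩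
    · rintro ⟨x, ⟨μ, hμ, h⟩, rfl⟩
      exact ⟨μ, hμ, (maps_iff_diagRel hM m Ω x ((μ : ℂ) • x)).2 h⟩
  rw [negCount, hset]
  erw [← Submodule.map_span e.toLinearMap]
  exact LinearEquiv.rank_map_eq e _

/-- Away from the bifurcating indices. -/
theorem block_gap (hM : ∀ V, M V =ᵐ[radialMeasure] fun r => ((ψ r ^ 2 : ℝ) : ℂ) * V r)
    (hsym : ∀ V W, (inner ℂ (M V) W : ℂ) = inner ℂ V (M W)) {m : ℤ} (hm : (m₀ : ℤ) < m)
    {Ω ε c : ℝ} (hε : ∀ z, ‖perturbation M (ω - 2 * ((m₀ : ℝ) + 1)) z‖ ≤ ε * ‖z‖)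
    (hc : 0 < c) (hεc : ε ≤ c / 4) (hΩ : |Ω| ≤ 2) {N : Finset (ℕ ⊕ ℕ)}
    (hN : ∀ i ∈ N, blockDiag m₀ m Ω i ≤ -(c / 2 * (m - m₀)))
    (hP : ∀ i ∉ N, c / 2 * (m - m₀) ≤ blockDiag m₀ m Ω i) :
    Invertible m₀ ψ ω m Ω ∧
      InverseBoundedBy m₀ ψ ω m Ω (2 * (1 + (c / 4 + (2 * ((m₀ : ℝ) + 1) + 2)) * (8 / c))) ∧
      negCount m₀ ψ ω m Ω = N.card := by
  have hμ := one_le_sub_of_lt hm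
  have hεc' : ε < c / 2 * ((m : ℝ) - m₀) := by nlinarith
  obtain ⟨h1, h2, h3⟩ := diagRel_gap (b := pairBasis m (m - 2 * m₀)) (inner_perturbation hsym _)
    hε hεc' N hN hP
  refine ⟨invertible_of_diagRel hM h1, fun p q hpq => ?_, (negCount_eq_of_diagRel hM m Ω).trans h3⟩
  set x : Pair := WithLp.toLp 2 p
  set y : Pair := WithLp.toLp 2 q
  have e1 := h2 (x, y) ((maps_iff_diagRel hM m Ω x y).1 hpq)
  have e2 := h2NormSq_le_of_maps hM hε (x := x) (y := y) hpq
  have e3 : √(‖q.1‖ ^ 2 + ‖q.2‖ ^ 2) = ‖y‖ := by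
    rw [← Real.sqrt_sq (norm_nonneg y), norm_sq_pair y]
    rfl
  rw [e3]
  refine e2.trans ?_
  have hμ0 : 0 < (m : ℝ) - m₀ := by linarith
  -- From `ε ≤ c/4` and `m - m₀ ≥ 1`, the gap left is at least `c (m - m₀) / 4`. The decay in `m -
  -- m₀` cancels the growth of `Ω (m - m₀)` bounded below.
  have e4 : ‖x‖ ≤ 8 / (c * (m - m₀)) * ‖y‖ := by
    refine e1.trans (mul_le_mul_of_nonneg_right ?_ (norm_nonneg _))
    rw [div_le_div_iff₀ (by linarith) (by positivity)]
    nlinarith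
  have e5 : |Ω * (m - m₀)| ≤ 2 * (m - m₀) := by
    rw [abs_mul, abs_of_pos hμ0]
    gcongr
  have e6 : ε + (2 * ((m₀ : ℝ) + 1) + |Ω * (m - m₀)|) ≤
      (c / 4 + (2 * ((m₀ : ℝ) + 1) + 2)) * (m - m₀) := by
    have k1 : c / 4 ≤ c / 4 * ((m : ℝ) - m₀) := by nlinarith
    have k2 : 2 * ((m₀ : ℝ) + 1) ≤ 2 * ((m₀ : ℝ) + 1) * (m - m₀) :=
      le_mul_of_one_le_right (by positivity) hμ
    linarith
  have e7 : (ε + (2 * ((m₀ : ℝ) + 1) + |Ω * (m - m₀)|)) * ‖x‖ ≤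
      (c / 4 + (2 * ((m₀ : ℝ) + 1) + 2)) * (m - m₀) * (8 / (c * (m - m₀)) * ‖y‖) :=
    mul_le_mul e6 e4 (norm_nonneg _) (by positivity)
  have e8 : (c / 4 + (2 * ((m₀ : ℝ) + 1) + 2)) * (m - m₀) * (8 / (c * (m - m₀)) * ‖y‖) =
      (c / 4 + (2 * ((m₀ : ℝ) + 1) + 2)) * (8 / c) * ‖y‖ := by
    field_simp
  rw [e8] at e7
  linarith

/-- A kernel vector at a bifurcation point. -/
theorem krein_kernel_le (hM : ∀ V, M V =ᵐ[radialMeasure] fun r => ((ψ r ^ 2 : ℝ) : ℂ) * V r)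
    {m : ℤ} (hm : (m₀ : ℤ) < m) {Ω ε c : ℝ}
    (hε : ∀ z, ‖perturbation M (ω - 2 * ((m₀ : ℝ) + 1)) z‖ ≤ ε * ‖z‖) (hε0 : 0 ≤ ε)
    (hc : 0 < c) (hεc : ε ≤ c / 4) {n : ℕ}
    (hd : ∀ i, i ≠ Sum.inr n → c / 2 * (m - m₀) ≤ |blockDiag m₀ m Ω i|) {x : Pair}
    (hx : Maps m₀ ψ ω m Ω (x.fst, x.snd) 0) :
    ‖x.fst‖ ^ 2 - ‖x.snd‖ ^ 2 ≤ -(1 / 2) * ‖x‖ ^ 2 ∧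
      3 / 4 * ‖x‖ ^ 2 ≤ ‖(inner ℂ (pairBasis m (m - 2 * m₀) (Sum.inr n)) x : ℂ)‖ ^ 2 := by
  have hμ := one_le_sub_of_lt hm
  have hx' := (maps_iff_diagRel hM m Ω x 0).1 hx
  have h1 := norm_sq_sub_le_of_kernel (half_pos hc) hε hx' (i₀ := Sum.inr n) fun i hi =>
    le_trans (by nlinarith) (hd i hi)
  set t := ‖(inner ℂ (pairBasis m (m - 2 * m₀) (Sum.inr n)) x : ℂ)‖ with ht
  have h2 : (ε * ‖x‖) ^ 2 ≤ (c / 4 * ‖x‖) ^ 2 := by gcongr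
  have h3 : 3 / 4 * ‖x‖ ^ 2 ≤ t ^ 2 := by
    -- Gap `c/2` against perturbation `c/4`: the part of `x` off the critical vector carries at most
    -- a quarter of `‖x‖²`.
    have : c ^ 2 * (3 / 4 * ‖x‖ ^ 2) ≤ c ^ 2 * t ^ 2 := by nlinarith
    exact le_of_mul_le_mul_left this (by positivity)
  refine ⟨?_, h3⟩
  have h4 : t ≤ ‖x.snd‖ := by
    rw [ht, inner_pairBasis_inr]
    refine (norm_inner_le_norm _ _).trans ?_
    rw [(oscBasis (m - 2 * m₀)).orthonormal.1 n, one_mul]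
  have h5 : t ^ 2 ≤ ‖x.snd‖ ^ 2 := by gcongr
  have h6 := norm_sq_pair x
  linarith

/-- The crossing at a bifurcation point. -/
theorem block_crossing (hM : ∀ V, M V =ᵐ[radialMeasure] fun r => ((ψ r ^ 2 : ℝ) : ℂ) * V r)
    (hsym : ∀ V W, (inner ℂ (M V) W : ℂ) = inner ℂ V (M W)) {m : ℤ} (hm : (m₀ : ℤ) < m)
    {Ω Ω' ε c : ℝ} (hε : ∀ z, ‖perturbation M (ω - 2 * ((m₀ : ℝ) + 1)) z‖ ≤ ε * ‖z‖)
    (hε0 : 0 ≤ ε) (hc : 0 < c) (hεc : ε ≤ c / 4) {N : Finset (ℕ ⊕ ℕ)} {n : ℕ}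
    (hn : Sum.inr n ∉ N)
    (hd : ∀ i, i ≠ Sum.inr n → c / 2 * (m - m₀) ≤ |blockDiag m₀ m Ω i|)
    (hN : ∀ i ∈ N, blockDiag m₀ m Ω' i ≤ -(c / 2 * (m - m₀)))
    (hP : ∀ i, i ∉ N → i ≠ Sum.inr n → c / 2 * (m - m₀) ≤ blockDiag m₀ m Ω' i) {x : Pair}
    (hx0 : x ≠ 0) (hx : Maps m₀ ψ ω m Ω (x.fst, x.snd) 0) (hne : Ω' ≠ Ω)
    (hΩ : |Ω - Ω'| ≤ c / 32) :
    Invertible m₀ ψ ω m Ω' ∧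
      negCount m₀ ψ ω m Ω' = (if Ω' < Ω then N.card + 1 else N.card : ℕ) := by
  have hμ := one_le_sub_of_lt hm
  have hμ0 : 0 < (m : ℝ) - m₀ := by linarith
  obtain ⟨k1, k2⟩ := krein_kernel_le hM hm hε hε0 hc hεc hd hx
  have hx' := (maps_iff_diagRel hM m Ω x 0).1 hx
  have hxn : 0 < ‖x‖ := norm_pos_iff.2 hx0
  have hεc' : ε < c / 2 * ((m : ℝ) - m₀) := by nlinarith
  have hδ0 : (Ω - Ω') * ((m : ℝ) - m₀) ≠ 0 := mul_ne_zero (sub_ne_zero.2 hne.symm) hμ0.ne'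
  -- Moving `Ω` to `Ω'` shifts the diagonal by `δ σ` with `δ = (Ω - Ω')(m - m₀)` and `σ = ±1` on the
  -- two sides. The bound `c/32` gives `4|δ| ≤ c (m - m₀) / 8`, which is at most half of the
  -- remaining gap, as required for `κ = 1/2`.
  obtain ⟨h1, h2⟩ := diagRel_crossing (b := pairBasis m (m - 2 * m₀)) (inner_perturbation hsym _)
    hε hεc' (κ := 1 / 2) (by norm_num) hn (d := blockDiag m₀ m Ω) (d' := blockDiag m₀ m Ω')
    (σ := Sum.elim (fun _ => 1) fun _ => -1) (S := reflection) (δ := (Ω - Ω') * (m - m₀))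
    norm_reflection (by
      rintro (i | i) z
      · rw [inner_pairBasis_inl, inner_pairBasis_inl, reflection_fst]
        simp
      · rw [inner_pairBasis_inr, inner_pairBasis_inr, reflection_snd]
        simp) (by
      rintro (i | i)
      · simp only [blockDiag, Sum.elim_inl]
        ring
      · simp only [blockDiag, Sum.elim_inr]
        ring) hN hP hx' (by
      intro h
      rw [h] at k2
      have : 0 < ‖x‖ ^ 2 := by positivity
      simp at k2
      linarith) (by
      rw [inner_pair, reflection_fst, reflection_snd, inner_neg_left,
        inner_self_eq_norm_sq_to_K, inner_self_eq_norm_sq_to_K]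
      refine le_of_eq_of_le ?_ k1
      simp [← Complex.ofReal_pow]
      ring) hδ0 (by
      rw [abs_mul, abs_of_pos hμ0]
      nlinarith [mul_le_mul_of_nonneg_right hΩ hμ0.le])
  refine ⟨invertible_of_diagRel hM h1, ((negCount_eq_of_diagRel hM m Ω').trans h2).trans ?_⟩
  have : 0 < (Ω - Ω') * ((m : ℝ) - m₀) ↔ Ω' < Ω := by
    rw [mul_pos_iff_of_pos_right hμ0, sub_pos]
  simp only [this]

end Maps
end Vortex

end

open Vortex

/-! ### The proposition: choice of constants and the two cases. -/

theorem mainTheorem4 (m₀ : ℕ) (hm₀ : 1 ≤ m₀) (ψ : ℝ → ℝ → ℝ) (ω : ℝ → ℝ)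
    (hψ : Vortex.IsPrimaryBranch m₀ ψ ω)
    (Ω₀ : ℝ) (hΩ₀ : Ω₀ ∈ Set.Ioo (0 : ℝ) 2)
    (k : ℕ) (m : Fin k → ℤ) (n : Fin k → ℕ) (hm : Function.Injective m)
    (hlist : ∀ (m' : ℤ) (n' : ℕ),
      ((m₀ : ℤ) < m' ∧ Vortex.limitFreq m₀ m' n' = Ω₀) ↔ ∃ j, m j = m' ∧ n j = n')
    (Ωb : Fin k → ℝ → ℝ)
    (hΩb : ∀ j, Vortex.IsBifurcationPoint m₀ ψ ω (m j) (n j) (Ωb j))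
    (i : Fin k) :
    ∃ a₀ > 0, ∃ C > 0, ∃ E > 0, ∀ a : ℝ, 0 < a → a < a₀ →
      (∀ m' : ℤ, (m₀ : ℤ) < m' → m' ∉ Set.range m →
        (∀ Ω : ℝ, |Ω - Ωb i a| < C * a ^ 2 →
          Vortex.Invertible m₀ (ψ a) (ω a) m' Ω ∧
          Vortex.InverseBoundedBy m₀ (ψ a) (ω a) m' Ω E) ∧
        ∃ N : ℕ, ∀ Ω : ℝ, |Ω - Ωb i a| < C * a ^ 2 →
          Vortex.negCount m₀ (ψ a) (ω a) m' Ω = N) ∧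
      (∀ j : Fin k,
        (∀ p : Vortex.L2r × Vortex.L2r, p ≠ 0 →
          Vortex.Maps m₀ (ψ a) (ω a) (m j) (Ωb j a) p 0 → Vortex.krein p < 0) ∧
        (∀ Ω : ℝ, |Ω - Ωb i a| < C * a ^ 2 → Ω ≠ Ωb j a →
          Vortex.Invertible m₀ (ψ a) (ω a) (m j) Ω) ∧
        ∃ N : ℕ, ∀ Ω : ℝ, |Ω - Ωb i a| < C * a ^ 2 →
          (Ω < Ωb j a → Vortex.negCount m₀ (ψ a) (ω a) (m j) Ω = (N + 1 : ℕ)) ∧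
          (Ωb j a < Ω → Vortex.negCount m₀ (ψ a) (ω a) (m j) Ω = N)) := by
  obtain ⟨c, hc, hgap⟩ := exists_blockDiag_gap m₀ hΩ₀
  have hj : ∀ j, (m₀ : ℤ) < m j ∧ limitFreq m₀ (m j) (n j) = Ω₀ := fun j =>
    (hlist _ _).2 ⟨j, rfl, rfl⟩
  have hne : ∀ m' : ℤ, (m₀ : ℤ) < m' → m' ∉ Set.range m → ∀ n', limitFreq m₀ m' n' ≠ Ω₀ := by
    intro m' h1 h2 n' h3
    obtain ⟨j, h4, -⟩ := (hlist m' n').1 ⟨h1, h3⟩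
    exact h2 ⟨j, h4⟩
  -- Distinctness of the `m_j` makes the critical entry unique in each block.
  have huniq : ∀ j n', limitFreq m₀ (m j) n' = Ω₀ → n' = n j := by
    intro j n' h
    obtain ⟨j', h1, h2⟩ := (hlist (m j) n').1 ⟨(hj j).1, h⟩
    rw [← h2, hm h1]
  -- Every `Ω` in the window is within `2η` of `Ω₀` and every `Ω_j(a)` within `η`, so `3η ≤ c/32` is
  -- what the crossing needs. The second bound keeps `Ω ≤ 2`.
  obtain ⟨η, hη, hη1, hη2⟩ : ∃ η > 0, η ≤ c / 128 ∧ η ≤ (2 - Ω₀) / 2 :=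
    ⟨min (c / 128) ((2 - Ω₀) / 2), lt_min (by positivity) (by linarith [hΩ₀.2]),
      min_le_left _ _, min_le_right _ _⟩
  have t1 : Tendsto (fun a : ℝ => a ^ 2) (𝓝[>] 0) (𝓝 0) := by
    have : Tendsto (fun a : ℝ => a ^ 2) (𝓝 0) (𝓝 (0 ^ 2)) := (continuous_pow 2).tendsto 0
    simpa using this.mono_left nhdsWithin_le_nhds
  have e1 := hψ.eventually_abs_le hm₀ (Real.sqrt_pos.2 (by positivity : 0 < c / 16))
  have e2 : ∀ᶠ a in 𝓝[>] (0 : ℝ), |ω a - 2 * ((m₀ : ℝ) + 1)| ≤ c / 16 := by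
    have := (tendsto_sub_nhds_zero_iff.2 hψ.tendsto_frequency).abs
    rw [abs_zero] at this
    exact this.eventually (ge_mem_nhds (by positivity))
  have e3 : ∀ᶠ a in 𝓝[>] (0 : ℝ), ∀ j, |Ωb j a - Ω₀| ≤ η := by
    rw [eventually_all]
    intro j
    have := ((hΩb j).expansion.trans_tendsto t1).abs
    rw [abs_zero, (hj j).2] at this
    exact this.eventually (ge_mem_nhds hη)
  have e4 : ∀ᶠ a in 𝓝[>] (0 : ℝ), a ^ 2 ≤ η := t1.eventually (ge_mem_nhds hη)
  have e5 := eventually_all.2 fun j => (hΩb j).kernel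
  obtain ⟨a₀, ha₀, hsub⟩ := mem_nhdsGT_iff_exists_Ioo_subset.1
    (hψ.mem.and (e1.and (e2.and (e3.and (e4.and e5)))))
  -- The choice `C = 1` suffices because `a² ≤ η`: the whole window lies in the fixed neighbourhood
  -- of `Ω₀` where the gap holds.
  refine ⟨a₀, ha₀, 1, one_pos, 2 * (1 + (c / 4 + (2 * ((m₀ : ℝ) + 1) + 2)) * (8 / c)),
    by positivity, fun a ha ha' => ?_⟩
  obtain ⟨f0, f1, f2, f3, f4, f5⟩ := hsub ⟨ha, ha'⟩
  have hmeas : MeasureTheory.AEStronglyMeasurable (fun r => ψ a r ^ 2) radialMeasure := by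
    have := f0.memLp.re.aestronglyMeasurable
    exact this.pow 2
  have hbd : ∀ᵐ r : ℝ ∂radialMeasure, |ψ a r ^ 2| ≤ c / 16 := by
    filter_upwards [f1] with r hr
    rw [abs_pow, ← Real.sq_sqrt (by positivity : 0 ≤ c / 16)]
    gcongr
  obtain ⟨M, hM, hMκ, hsym⟩ := exists_mulOperator hmeas hbd
  -- The frequency shift contributes `c/16` and the matrix with entries `2, 1` times `ψ² ≤ c/16`
  -- contributes `3c/16`.
  obtain ⟨ε, hε0, hεc, hε⟩ : ∃ ε : ℝ, 0 ≤ ε ∧ ε ≤ c / 4 ∧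
      ∀ z, ‖perturbation M (ω a - 2 * ((m₀ : ℝ) + 1)) z‖ ≤ ε * ‖z‖ :=
    ⟨|ω a - 2 * ((m₀ : ℝ) + 1)| + 3 * (c / 16), by positivity, by linarith,
      norm_perturbation_le (by positivity) hMκ _⟩
  have hnear : ∀ Ω : ℝ, |Ω - Ωb i a| < 1 * a ^ 2 → |Ω - Ω₀| ≤ 2 * η := by
    intro Ω h
    have := abs_sub_le Ω (Ωb i a) Ω₀
    linarith [f3 i]
  have h2 : ∀ Ω : ℝ, |Ω - Ω₀| ≤ 2 * η → |Ω| ≤ 2 := by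
    intro Ω h
    obtain ⟨h3, h4⟩ := abs_le.1 h
    exact abs_le.2 ⟨by linarith [hΩ₀.1], by linarith⟩
  constructor
  · intro m' hm' hmr
    have key := fun (Ω : ℝ) (hΩ : |Ω - Ωb i a| < 1 * a ^ 2) =>
      block_gap hM hsym hm' hε hc hεc (h2 Ω (hnear Ω hΩ))
        (hgap m' hm' Ω (by linarith [hnear Ω hΩ])).1 fun l hl =>
        (hgap m' hm' Ω (by linarith [hnear Ω hΩ])).2 l hl fun n' _ => hne m' hm' hmr n'
    exact ⟨fun Ω hΩ => ⟨(key Ω hΩ).1, (key Ω hΩ).2.1⟩, _, fun Ω hΩ => (key Ω hΩ).2.2⟩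
  · intro j
    have hmj := (hj j).1
    have hnN : Sum.inr (n j) ∉ negIndices m₀ (m j) Ω₀ := by
      rw [mem_negIndices_inr hmj hΩ₀.1, (hj j).2]
      exact lt_irrefl _
    have hoff : ∀ l : ℕ ⊕ ℕ, l ≠ Sum.inr (n j) →
        ∀ n', l = Sum.inr n' → limitFreq m₀ (m j) n' ≠ Ω₀ := by
      rintro l hl n' rfl h
      exact hl (by rw [huniq j n' h])
    have hd : ∀ l, l ≠ Sum.inr (n j) →
        c / 2 * ((m j : ℝ) - m₀) ≤ |blockDiag m₀ (m j) (Ωb j a) l| := by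
      intro l hl
      obtain ⟨g1, g2⟩ := hgap (m j) hmj (Ωb j a) (by linarith [f3 j])
      by_cases hlN : l ∈ negIndices m₀ (m j) Ω₀
      · exact le_abs.2 (Or.inr (by linarith [g1 l hlN]))
      · exact le_abs.2 (Or.inl (g2 l hlN (hoff l hl)))
    have hkrein : ∀ p : L2r × L2r, p ≠ 0 → Maps m₀ (ψ a) (ω a) (m j) (Ωb j a) p 0 →
        krein p < 0 := by
      intro p hp hpm
      have h3 := (krein_kernel_le hM hmj hε hε0 hc hεc hd (x := WithLp.toLp 2 p) hpm).1
      have h4 : 0 < ‖(WithLp.toLp 2 p : Pair)‖ := norm_pos_iff.2 fun h =>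
        hp ((WithLp.toLp_eq_zero 2).1 h)
      have h5 : krein p ≤ -(1 / 2) * ‖(WithLp.toLp 2 p : Pair)‖ ^ 2 := h3
      have h6 : 0 < ‖(WithLp.toLp 2 p : Pair)‖ ^ 2 := by positivity
      linarith
    -- A kernel vector at `Ω_j(a)` is the extra direction for the counts on both sides, with base
    -- count the number of entries negative at `Ω₀`.
    obtain ⟨p, hp, hpm⟩ := f5 j
    have key := fun (Ω : ℝ) (hΩ : |Ω - Ωb i a| < 1 * a ^ 2) (hΩne : Ω ≠ Ωb j a) =>
      block_crossing hM hsym hmj hε hε0 hc hεc hnN hd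
        (hgap (m j) hmj Ω (by linarith [hnear Ω hΩ])).1
        (fun l hl hl' => (hgap (m j) hmj Ω (by linarith [hnear Ω hΩ])).2 l hl (hoff l hl'))
        (x := WithLp.toLp 2 p) (fun h => hp ((WithLp.toLp_eq_zero 2).1 h)) hpm hΩne (by
          have h3 := abs_sub_le (Ωb j a) Ω₀ Ω
          rw [abs_sub_comm Ω₀ Ω] at h3
          linarith [f3 j, hnear Ω hΩ])
    refine ⟨hkrein, fun Ω hΩ hΩne => (key Ω hΩ hΩne).1, (negIndices m₀ (m j) Ω₀).card,
      fun Ω hΩ => ⟨fun h => ?_, fun h => ?_⟩⟩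
    · rw [(key Ω hΩ h.ne).2, if_pos h]
    · rw [(key Ω hΩ h.ne').2, if_neg (not_lt.2 h.le)]
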